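/- **Setting.** Let $X_i$ ($i\in\mathcal I$) be finitely many random variables with finite alphabets whose joint pmf factorizes as $p(\mathbf x)=\prod_{a\in\mathcal A_{\rm MF}}f_a(\mathbf x_a)\prod_{a\in\mathcal A_{\rm BP}}f_a(\mathbf x_a)$, where $\mathbf x_a=(x_i\mid i\in\mathcal N(a))$, $f_a\ge 0$ for $a\in\mathcal A_{\rm BP}$, $f_a>0$ for $a\in\mathcal A_{\rm MF}$, and every $i$ lies in some $\mathcal N(a)$. Put $\mathcal I_{\rm BP}=\bigcup_{a\in\mathcal A_{\rm BP}}\mathcal N(a)$, $\mathcal I_{\rm MF}=\bigcup_{a\in\mathcal A_{\rm MF}}\mathcal N(a)$, and let $\mathcal N_{\rm BP}(i)$, $\mathcal N_{\rm MF}(i)$ be the sets of $a\in\mathcal A_{\rm BP}$, resp. $a\in\mathcal A_{\rm MF}$, with $i\in\mathcal N(a)$. Beliefs are functions $b_i(x_i)$ ($i\in\mathcal I$) and $b_a(\mathbf x_a)$ ($a\in\mathcal A_{\rm BP}$). They are *feasible* if they are nonnegative, $b_i$ ($i\in\mathcal I_{\rm MF}\setminus\mathcal I_{\rm BP}$) and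 $b_a$ ($a\in\mathcal A_{\rm BP}$) sum to one, and $b_i(x_i)=\sum_{\mathbf x_a\setminus x_i}b_a(\mathbf x_a)$ for all $a\in\mathcal A_{\rm BP}$, $i\in\mathcal N(a)$. With $0\ln\frac 0v=0$ for every $v\ge 0$ and $u\ln\frac u0=\infty$ for $u>0$, let $$F_{\rm BP,MF}(b)=\sum_{a\in\mathcal A_{\rm BP}}\sum_{\mathbf x_a}b_a\ln\frac{b_a}{f_a}-\sum_{a\in\mathcal A_{\rm MF}}\sum_{\mathbf x_a}\prod_{i\in\mathcal N(a)}b_i(x_i)\ln f_a(\mathbf x_a)-\sum_{i\in\mathcal I}(|\mathcal N_{\rm BP}(i)|-1)\sum_{x_i}b_i\ln b_i .$$ For $a\in\mathcal A_{\rm MF}$, $i\in\mathcal N(a)$, the beliefs $b$ produce the messages $m^{\rm MF}_{a\to i}(x_i)=\exp\big(\sum_{\mathbf x_a\setminus x_i}\prod_{j\in\mathcal N(a)\setminus i}b_j(x_j)\ln f_a(\mathbf x_a)\big)$. * *BP step.* Fix all $m^{\rm MF}_{a\to i}$ with $i\in\mathcal I_{\rm BP}\cap\mathcal I_{\rm MF}$,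 $a\in\mathcal N_{\rm MF}(i)$. Run the forward/backward algorithm in the BP part: compute each of the messages $m^{\rm BP}_{a\to i}(x_i)=\omega_{a,i}\sum_{\mathbf x_a\setminus x_i}f_a(\mathbf x_a)\prod_{j\in\mathcal N(a)\setminus i}n_{j\to a}(x_j)$ and $n_{i\to a}(x_i)=\prod_{c\in\mathcal N_{\rm BP}(i)\setminus a}m^{\rm BP}_{c\to i}(x_i)\prod_{c\in\mathcal N_{\rm MF}(i)}m^{\rm MF}_{c\to i}(x_i)$ ($a\in\mathcal A_{\rm BP}$, $i\in\mathcal N(a)$) exactly once, each after the messages that it needs ($\omega_{a,i}>0$ are arbitrary scaling constants). Then replace $b_a$ ($a\in\mathcal A_{\rm BP}$) and $b_i$ ($i\in\mathcal I_{\rm BP}$) by the normalizations of $f_a\prod_{i\in\mathcal N(a)}n_{i\to a}$ and of $\prod_{a\in\mathcal N_{\rm BP}(i)}m^{\rm BP}_{a\to i}\prod_{a\in\mathcal N_{\rm MF}(i)}m^{\rm MF}_{a\to i}$. * *MF update at $i\in\mathcal I_{\rm MF}\setminus\mathcal I_{\rm BP}$.* Replace $b_i$ by the normalization of $\prod_{a\in\mathcal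 N_{\rm MF}(i)}m^{\rm MF}_{a\to i}$. The *algorithm* starts with arbitrary pmfs $b_i$, $i\in\mathcal I_{\rm MF}\setminus\mathcal I_{\rm BP}$; each round is a BP step followed by MF updates at all $i\in\mathcal I_{\rm MF}\setminus\mathcal I_{\rm BP}$, once each, successively, in any order (schedules, scalings and orders may vary between rounds). Let $b^{(t)}$ be the beliefs after $t$ rounds. A feasible $b$ is a *fixed point* if there are messages and constants $z_i>0$, $z_a>0$, with $z_i=1$ for $i\in\mathcal I_{\rm BP}$, such that $b_a=z_af_a\prod_{i\in\mathcal N(a)}n_{i\to a}$ for $a\in\mathcal A_{\rm BP}$, $b_i=z_i\prod_{a\in\mathcal N_{\rm BP}(i)}m^{\rm BP}_{a\to i}\prod_{a\in\mathcal N_{\rm MF}(i)}m^{\rm MF}_{a\to i}$ for $i\in\mathcal I$, and $n_{i\to a}=z_i\prod_{c\in\mathcal N_{\rm BP}(i)\setminus a}m^{\rm BP}_{c\to i}\prod_{c\in\mathcal N_{\rm MF}(i)}m^{\rm MF}_{c\to i}$ ($a\in\mathcal A$, $i\in\mathcal N(a)$), $m^{\rm BP}_{a\to i}=z_a\sum_{\mathbf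 x_a\setminus x_i}f_a\prod_{j\in\mathcal N(a)\setminus i}n_{j\to a}$ ($a\in\mathcal A_{\rm BP}$, $i\in\mathcal N(a)$), $m^{\rm MF}_{a\to i}=\exp\big(\sum_{\mathbf x_a\setminus x_i}\prod_{j\in\mathcal N(a)\setminus i}n_{j\to a}\ln f_a\big)$ ($a\in\mathcal A_{\rm MF}$, $i\in\mathcal N(a)$). **Theorem.** Suppose that the factor graph of $\prod_{a\in\mathcal A_{\rm BP}}f_a$ has no cycle and that $|\mathcal N(a)\cap\mathcal I_{\rm BP}|\le 1$ for all $a\in\mathcal A_{\rm MF}$. Then: 1. A forward/backward schedule for the BP part exists. 2. Given beliefs $b$ whose $b_i$, $i\in\mathcal I_{\rm MF}\setminus\mathcal I_{\rm BP}$, are pmfs, the BP step yields feasible beliefs $b'$ and does not change these $b_i$; the beliefs of $b'$ in the BP part are the marginals of the pmf proportional to $\prod_{a\in\mathcal A_{\rm BP}}f_a(\mathbf x_a)\prod_{i\in\mathcal I_{\rm BP}\cap\mathcal I_{\rm MF}}\prod_{a\in\mathcal N_{\rm MF}(i)}m^{\rm MF}_{a\to i}(x_i)$. Among all feasible beliefs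 with the same $b_i$, $i\in\mathcal I_{\rm MF}\setminus\mathcal I_{\rm BP}$, $b'$ is the unique minimizer both of $F_{\rm BP,MF}$ and of the Bethe free energy with fixed messages $$F_{\rm BP}=\sum_{a\in\mathcal A_{\rm BP}}\sum_{\mathbf x_a}b_a\ln\frac{b_a}{f_a}-\sum_{i\in\mathcal I_{\rm BP}\cap\mathcal I_{\rm MF}}\sum_{a\in\mathcal N_{\rm MF}(i)}\sum_{x_i}b_i\ln m^{\rm MF}_{a\to i}-\sum_{i\in\mathcal I_{\rm BP}}(|\mathcal N_{\rm BP}(i)|-1)\sum_{x_i}b_i\ln b_i .$$ In particular the BP step does not increase $F_{\rm BP,MF}$ on feasible beliefs. 3. If the fixed messages in $F_{\rm BP}$ come from beliefs $b$, then at all beliefs with finite $F_{\rm BP,MF}$ and with the same $b_i$, $i\in\mathcal I_{\rm MF}\setminus\mathcal I_{\rm BP}$, the partial derivatives of $F_{\rm BP,MF}$ and $F_{\rm BP}$ with respect to each positive $b_i(x_i)$, $i\in\mathcal I_{\rm BP}$, and each positive $b_a(\mathbf x_a)$, $a\in\mathcal A_{\rm BP}$, exist and agree. 4. Each MF update preserves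 feasibility and minimizes $F_{\rm BP,MF}$ over all pmfs $b_i$, the other beliefs being fixed; in particular it does not increase $F_{\rm BP,MF}$. 5. The algorithm converges: $b^{(t)}$ is feasible for $t\ge1$; $F_{\rm BP,MF}(b^{(t+1)})\le F_{\rm BP,MF}(b^{(t)})$ whenever $b^{(t)}$ is feasible; $F_{\rm BP,MF}(b^{(t)})$ converges to a finite limit; $b^{(t+1)}-b^{(t)}\to0$; the set of fixed points is nonempty and the distance of $b^{(t)}$ to it tends to $0$; every limit point of $(b^{(t)})$ is a fixed point; and if some limit point is isolated in the set of fixed points, then $b^{(t)}$ converges to it. -/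

import Mathlib

open Filter Topology

noncomputable section

namespace BPMF

/-- A probability mass function on `∏ i, X i` in partially factorized form
`p(x) = ∏_{a ∈ A_MF} f_a(x_a) ∏_{a ∈ A_BP} f_a(x_a)`.  Here `bp` is `A_BP`, its complement is `A_MF`,
and `nbr a` is `N(a)`, the set of variables on which `f_a` depends.  Factors of the BP part may
vanish (hard constraints), those of the MF part are strictly positive. -/
structure Model (I A : Type*) (X : I → Type*) [Fintype I] [DecidableEq I] [Fintype A]
    [∀ i, Fintype (X i)] where
  nbr : A → Finset I
  bp : Finset A
  f : (a : A) → ((j : {j // j ∈ nbr a}) → X j.1) → ℝ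
  f_nonneg : ∀ a ∈ bp, ∀ y, 0 ≤ f a y
  f_pos : ∀ a ∉ bp, ∀ y, 0 < f a y
  sum_eq_one : ∑ x : (∀ i, X i), ∏ a, f a (fun j => x j.1) = 1
  /-- Every variable node is joined to some factor node. -/
  covered : ∀ i, ∃ a, i ∈ nbr a

variable {I A : Type*} {X : I → Type*} [Fintype I] [DecidableEq I] [Fintype A] [DecidableEq A]
  [∀ i, Fintype (X i)] [∀ i, DecidableEq (X i)]

namespace Model

/-- The local configurations `x_a = (x_j | j ∈ N(a))`. -/
abbrev Loc (M : Model I A X) (a : A) := (j : {j // j ∈ M.nbr a}) → X j.1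

/-- `A_MF`. -/
def mf (M : Model I A X) : Finset A := M.bpᶜ

/-- `I_BP`, the variables of the BP part. -/
def IBP (M : Model I A X) : Finset I := M.bp.biUnion M.nbr

/-- `I_MF`, the variables of the MF part. -/
def IMF (M : Model I A X) : Finset I := M.mf.biUnion M.nbr

/-- `N_BP(i)`. -/
def NBP (M : Model I A X) (i : I) : Finset A := M.bp.filter (fun a => i ∈ M.nbr a)

/-- `N_MF(i)`. -/
def NMF (M : Model I A X) (i : I) : Finset A := M.mf.filter (fun a => i ∈ M.nbr a)

/-- The factor graph of the BP part: variable nodes `I`, factor nodes `A`, and an edge between `i`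
and `a` when `a ∈ A_BP` and `i ∈ N(a)` (factor nodes of the MF part are isolated here). -/
def bpGraph (M : Model I A X) : SimpleGraph (I ⊕ A) :=
  SimpleGraph.fromRel fun u v =>
    match u, v with
    | Sum.inl i, Sum.inr a => a ∈ M.bp ∧ i ∈ M.nbr a
    | _, _ => False

/-- A family of beliefs: `b.1 i` is `b_i` for `i ∈ I`, and `b.2 a` is `b_a` for `a ∈ A_BP`. -/
abbrev Beliefs (M : Model I A X) :=
  ((i : I) → X i → ℝ) × ((a : {a // a ∈ M.bp}) → M.Loc a.1 → ℝ)

/-- The beliefs `b_i`, `i ∈ I_MF \ I_BP`, are probability mass functions. -/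
def MFNormalized (M : Model I A X) (b : M.Beliefs) : Prop :=
  ∀ i ∈ M.IMF \ M.IBP, (∀ x, 0 ≤ b.1 i x) ∧ ∑ x, b.1 i x = 1

/-- Nonnegative beliefs which satisfy the normalization and the marginalization constraints. -/
structure Feasible (M : Model I A X) (b : M.Beliefs) : Prop where
  var_nonneg : ∀ i x, 0 ≤ b.1 i x
  fac_nonneg : ∀ a y, 0 ≤ b.2 a y
  var_sum : ∀ i ∈ M.IMF \ M.IBP, ∑ x, b.1 i x = 1
  fac_sum : ∀ a, ∑ y, b.2 a y = 1
  marginal : ∀ (a : {a // a ∈ M.bp}) (i : {i // i ∈ M.nbr a.1}) (x : X i.1),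
    b.1 i.1 x = ∑ y : M.Loc a.1 with y i = x, b.2 a y

/-- `b` and `c` have the same beliefs at all variables outside the BP part. -/
def AgreeOffBP (M : Model I A X) (b c : M.Beliefs) : Prop :=
  ∀ i ∈ M.IMF \ M.IBP, b.1 i = c.1 i

/-- `u ln (u / v)` with the conventions `0 ln (0 / v) = 0` (also for `v = 0`) and
`u ln (u / 0) = ∞` for `u > 0`. -/
def klTerm (u v : ℝ) : EReal :=
  if v = 0 ∧ 0 < u then ⊤ else ((u * Real.log (u / v) : ℝ) : EReal)

/-- The region-based free energy approximation `F_{BP,MF}`. -/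
def freeEnergy (M : Model I A X) (b : M.Beliefs) : EReal :=
  (∑ a : {a // a ∈ M.bp}, ∑ y : M.Loc a.1, klTerm (b.2 a y) (M.f a.1 y))
    + ((- ∑ a ∈ M.mf, ∑ y : M.Loc a, (∏ j, b.1 j.1 (y j)) * Real.log (M.f a y)
        - ∑ i, (((M.NBP i).card : ℝ) - 1) * ∑ x, b.1 i x * Real.log (b.1 i x) : ℝ) : EReal)

/-- The message `m^MF_{a → i}(x)`, that is
`exp (∑_{x_a \ x_i} ∏_{j ∈ N(a) \ i} n_{j → a}(x_j) ln f_a(x_a))`. -/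
def mfMessage (M : Model I A X) (n : (i : I) → A → X i → ℝ) (a : A) (i : I) (x : X i) : ℝ :=
  Real.exp (∑ y : M.Loc a with ∀ h : i ∈ M.nbr a, y ⟨i, h⟩ = x,
    (∏ j : {j // j ∈ M.nbr a} with j.1 ≠ i, n j.1 a (y j)) * Real.log (M.f a y))

/-- The messages of the MF part which are sent when the current beliefs are `b`: the variables send
`n_{j → a} = b_j` to the factors `a ∈ A_MF`. -/
def mfMessagesOf (M : Model I A X) (b : M.Beliefs) : (a : A) → (i : I) → X i → ℝ :=
  M.mfMessage (fun j _ => b.1 j)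

/-- The sum `∑_{x_a \ x_i} f_a(x_a) ∏_{j ∈ N(a) \ i} n_{j → a}(x_j)` of the BP update. -/
def sumProduct (M : Model I A X) (n : (i : I) → A → X i → ℝ) (a : A) (i : I) (x : X i) : ℝ :=
  ∑ y : M.Loc a with ∀ h : i ∈ M.nbr a, y ⟨i, h⟩ = x,
    M.f a y * ∏ j : {j // j ∈ M.nbr a} with j.1 ≠ i, n j.1 a (y j)

/-- The product `∏_{c ∈ N_BP(i) \ a} m^BP_{c → i}(x) ∏_{c ∈ N_MF(i)} m^MF_{c → i}(x)`. -/
def extrinsic (M : Model I A X) (mBP mMF : (a : A) → (i : I) → X i → ℝ) (i : I) (a : A) (x : X i) :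
    ℝ :=
  (∏ c ∈ (M.NBP i).erase a, mBP c i x) * ∏ c ∈ M.NMF i, mMF c i x

/-- The product `∏_{a ∈ N_BP(i)} m^BP_{a → i}(x) ∏_{a ∈ N_MF(i)} m^MF_{a → i}(x)`. -/
def incoming (M : Model I A X) (mBP mMF : (a : A) → (i : I) → X i → ℝ) (i : I) (x : X i) : ℝ :=
  (∏ a ∈ M.NBP i, mBP a i x) * ∏ a ∈ M.NMF i, mMF a i x

/-- Division by the total mass. -/
def normalize {Y : Type*} [Fintype Y] (g : Y → ℝ) (y : Y) : ℝ := g y / ∑ y', g y'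

/-! ### The Bethe free energy of the BP part with fixed messages from the MF part -/

/-- The Bethe free energy of the factorization
`∏_{a ∈ A_BP} f_a(x_a) ∏_{i ∈ I_BP ∩ I_MF} ∏_{a ∈ N_MF(i)} m_{a → i}(x_i)`. -/
def betheFreeEnergy (M : Model I A X) (m : (a : A) → (i : I) → X i → ℝ) (b : M.Beliefs) : EReal :=
  (∑ a : {a // a ∈ M.bp}, ∑ y : M.Loc a.1, klTerm (b.2 a y) (M.f a.1 y))
    + ((- ∑ i ∈ M.IBP ∩ M.IMF, ∑ a ∈ M.NMF i, ∑ x, b.1 i x * Real.log (m a i x)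
        - ∑ i ∈ M.IBP, (((M.NBP i).card : ℝ) - 1) * ∑ x, b.1 i x * Real.log (b.1 i x) : ℝ) : EReal)

theorem mem_IBP (M : Model I A X) (a : {a // a ∈ M.bp}) (j : {j // j ∈ M.nbr a.1}) :
    j.1 ∈ M.IBP :=
  Finset.mem_biUnion.2 ⟨a.1, a.2, j.2⟩

/-- The realizations of `x_BP = (x_i | i ∈ I_BP)`. -/
abbrev BPConfig (M : Model I A X) := (i : {i // i ∈ M.IBP}) → X i.1

/-- The restriction of `x_BP` to `x_a`, for `a ∈ A_BP`. -/
def BPConfig.local (M : Model I A X) (x : M.BPConfig) (a : {a // a ∈ M.bp}) : M.Loc a.1 :=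
  fun j => x ⟨j.1, M.mem_IBP a j⟩

/-- The probability mass function `p(x_BP)` proportional to
`∏_{a ∈ A_BP} f_a(x_a) ∏_{i ∈ I_BP ∩ I_MF} ∏_{a ∈ N_MF(i)} m_{a → i}(x_i)`. -/
def bpPmf (M : Model I A X) (m : (a : A) → (i : I) → X i → ℝ) : M.BPConfig → ℝ :=
  normalize fun x : M.BPConfig =>
    (∏ a : {a // a ∈ M.bp}, M.f a.1 (BPConfig.local M x a))
      * ∏ i : {i // i ∈ M.IBP}, ∏ a ∈ M.NMF i.1, m a i.1 (x i)

/-! ### The forward/backward algorithm in the BP part -/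

/-- Names of messages: `Sum.inl (a, i)` is `m^BP_{a → i}` and `Sum.inr (i, a)` is `n_{i → a}`. -/
abbrev MsgName (_M : Model I A X) := (A × I) ⊕ (I × A)

/-- The name is that of a message along an edge of the BP part. -/
def IsBPMsg (M : Model I A X) : M.MsgName → Prop
  | Sum.inl (a, i) => a ∈ M.bp ∧ i ∈ M.nbr a
  | Sum.inr (i, a) => a ∈ M.bp ∧ i ∈ M.nbr a

/-- `M.Needs e d`: the update of the message `e` uses the message `d` of the BP part. -/
def Needs (M : Model I A X) : M.MsgName → M.MsgName → Prop
  | Sum.inl (a, i), Sum.inr (j, a') => a' = a ∧ j ∈ M.nbr a ∧ j ≠ i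
  | Sum.inr (i, a), Sum.inl (c, i') => i' = i ∧ c ∈ M.NBP i ∧ c ≠ a
  | _, _ => False

/-- A forward/backward schedule: every message of the BP part is sent exactly once, and it is sent
after all the messages which its update needs.  (So the leaves start; a forward pass from the leaves
to a root, followed by a backward pass from the root to the leaves, is of this form.) -/
structure IsForwardBackward (M : Model I A X) (S : List M.MsgName) : Prop where
  nodup : S.Nodup
  mem_iff : ∀ e, e ∈ S ↔ M.IsBPMsg e
  ordered : ∀ S₁ e S₂, S = S₁ ++ e :: S₂ → ∀ d, M.Needs e d → d ∈ S₁

/-- The messages `m^BP_{a → i}` and `n_{i → a}`. -/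
structure Messages (M : Model I A X) where
  toVar : (a : A) → (i : I) → X i → ℝ
  toFac : (i : I) → (a : A) → X i → ℝ

/-- Recompute one message.  The `mMF` are the fixed messages from the MF part and `ω a i` is the
scaling constant of the message `m^BP_{a → i}`. -/
def send (M : Model I A X) (mMF : (a : A) → (i : I) → X i → ℝ) (ω : A → I → ℝ) (s : M.Messages) :
    M.MsgName → M.Messages
  | Sum.inl (a, i) =>
    { s with
      toVar := fun a' i' x =>
        if a' = a ∧ i' = i then ω a' i' * M.sumProduct s.toFac a' i' x else s.toVar a' i' x }
  | Sum.inr (i, a) =>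
    { s with
      toFac := fun i' a' x =>
        if i' = i ∧ a' = a then M.extrinsic s.toVar mMF i' a' x else s.toFac i' a' x }

/-- Send the messages of the schedule `S` one after the other. -/
def passMessages (M : Model I A X) (mMF : (a : A) → (i : I) → X i → ℝ) (ω : A → I → ℝ)
    (S : List M.MsgName) : M.Messages :=
  S.foldl (M.send mMF ω) ⟨fun _ _ _ => 1, fun _ _ _ => 1⟩

/-- The BP step: with the messages of the MF part fixed, run the forward/backward algorithm in the
BP part and replace the beliefs of the BP part by the resulting (normalized) ones. -/
def bpStep (M : Model I A X) (S : List M.MsgName) (ω : A → I → ℝ) (b : M.Beliefs) : M.Beliefs :=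
  (fun i => if i ∈ M.IBP then
      normalize (M.incoming (M.passMessages (M.mfMessagesOf b) ω S).toVar (M.mfMessagesOf b) i)
    else b.1 i,
   fun a => normalize fun y =>
      M.f a.1 y * ∏ j, (M.passMessages (M.mfMessagesOf b) ω S).toFac j.1 a.1 (y j))

/-! ### Updates in the MF part and the whole algorithm -/

/-- The update of the belief `b_i` of a variable outside the BP part:
`b_i(x) = z_i ∏_{a ∈ N_MF(i)} m^MF_{a → i}(x)`. -/
def mfUpdate (M : Model I A X) (b : M.Beliefs) (i : I) : M.Beliefs :=
  (Function.update b.1 i (normalize fun x => ∏ a ∈ M.NMF i, M.mfMessagesOf b a i x), b.2)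

/-- The list contains every element of `I_MF \ I_BP` exactly once, and nothing else. -/
def IsMFOrder (M : Model I A X) (L : List I) : Prop :=
  L.Nodup ∧ ∀ i, i ∈ L ↔ i ∈ M.IMF \ M.IBP

/-- The successive updates of the beliefs `b_i`, in the order of the list. -/
def mfSweep (M : Model I A X) (L : List I) (b : M.Beliefs) : M.Beliefs :=
  L.foldl M.mfUpdate b

/-- The beliefs after `t` rounds of the algorithm; each round is a BP step followed by a sweep of
successive updates in the MF part.  The beliefs of the BP part in `b₀` have no influence on the
later rounds when each factor of the MF part has at most one variable in the BP part. -/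
def run (M : Model I A X) (S : ℕ → List M.MsgName) (ω : ℕ → A → I → ℝ) (L : ℕ → List I)
    (b₀ : M.Beliefs) : ℕ → M.Beliefs
  | 0 => b₀
  | t + 1 => M.mfSweep (L t) (M.bpStep (S t) (ω t) (run M S ω L b₀ t))

/-- The beliefs `b` satisfy the constraints and solve the combined message passing fixed-point
equations of BP and MF, for some messages and some positive normalization constants `z_i`, `z_a`
with `z_i = 1` for `i ∈ I_BP`. -/
def IsFixedPoint (M : Model I A X) (b : M.Beliefs) : Prop :=
  M.Feasible b ∧
  ∃ (mBP mMF : (a : A) → (i : I) → X i → ℝ) (n : (i : I) → A → X i → ℝ) (zv : I → ℝ) (zf : A → ℝ),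
    (∀ i, 0 < zv i) ∧ (∀ i ∈ M.IBP, zv i = 1) ∧ (∀ a ∈ M.bp, 0 < zf a) ∧
    (∀ (a : {a // a ∈ M.bp}) (y : M.Loc a.1),
      b.2 a y = zf a.1 * M.f a.1 y * ∏ j, n j.1 a.1 (y j)) ∧
    (∀ i x, b.1 i x = zv i * M.incoming mBP mMF i x) ∧
    (∀ a, ∀ i ∈ M.nbr a, ∀ x, n i a x = zv i * M.extrinsic mBP mMF i a x) ∧
    (∀ a ∈ M.bp, ∀ i ∈ M.nbr a, ∀ x, mBP a i x = zf a * M.sumProduct n a i x) ∧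
    (∀ a ∈ M.mf, ∀ i ∈ M.nbr a, ∀ x, mMF a i x = M.mfMessage n a i x)

/-- `b` with the number `b_i(x)` replaced by `s`. -/
def setVar (M : Model I A X) (b : M.Beliefs) (i : I) (x : X i) (s : ℝ) : M.Beliefs :=
  (Function.update b.1 i (Function.update (b.1 i) x s), b.2)

/-- `b` with the number `b_a(y)` replaced by `s`. -/
def setFac (M : Model I A X) (b : M.Beliefs) (a : {a // a ∈ M.bp}) (y : M.Loc a.1) (s : ℝ) :
    M.Beliefs :=
  (b.1, Function.update b.2 a (Function.update (b.2 a) y s))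

end Model

end BPMF

end

set_option linter.unusedSectionVars false

noncomputable section

namespace BPMF

variable {I A : Type*} {X : I → Type*} [Fintype I] [DecidableEq I] [Fintype A] [DecidableEq A]
  [∀ i, Fintype (X i)] [∀ i, DecidableEq (X i)]

/-! ### Peeling off the factors of a forest -/

theorem exists_subsingleton_neighbors_of_isAcyclic {V : Type*} [Finite V] [Nonempty V]
    {G : SimpleGraph V} (hG : G.IsAcyclic) :
    ∃ v, ∀ w w', G.Adj v w → G.Adj v w' → w = w' := by
  obtain ⟨u, v, p, hp, hmax⟩ := SimpleGraph.Walk.exists_isPath_forall_isPath_length_le_length G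
  have key : ∀ w, G.Adj v w → w = p.penultimate := fun w hw => by
    refine hG.eq_penultimate_of_adj_end hp hw ?_
    by_contra hs
    have := hmax _ _ _ (hp.concat hs hw)
    simp at this
  exact ⟨v, fun w w' hw hw' => (key w hw).trans (key w' hw').symm⟩

namespace Model

theorem bpGraph_adj (M : Model I A X) {i : I} {a : A} (ha : a ∈ M.bp) (hi : i ∈ M.nbr a) :
    M.bpGraph.Adj (Sum.inr a) (Sum.inl i) := by
  simp [bpGraph, ha, hi]

theorem exists_leaf (M : Model I A X) (h : M.bpGraph.IsAcyclic) {B : Finset A} (hB : B ⊆ M.bp)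
    (hne : B.Nonempty) :
    ∃ a ∈ B, (M.nbr a ∩ (B.erase a).biUnion M.nbr).card ≤ 1 := by
  by_contra! hcon
  let W : Set (I ⊕ A) := {v | Sum.elim
    (fun i => ∃ a ∈ B, ∃ c ∈ B, a ≠ c ∧ i ∈ M.nbr a ∧ i ∈ M.nbr c) (fun a => a ∈ B) v}
  obtain ⟨a₀, ha₀⟩ := hne
  have : Nonempty W := ⟨⟨Sum.inr a₀, ha₀⟩⟩
  obtain ⟨⟨v, hv⟩, hleaf⟩ := exists_subsingleton_neighbors_of_isAcyclic (h.induce W)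
  rcases v with i | a
  · obtain ⟨a, ha, c, hc, hac, hia, hic⟩ := hv
    have := hleaf ⟨Sum.inr a, ha⟩ ⟨Sum.inr c, hc⟩ (M.bpGraph_adj (hB ha) hia).symm
      (M.bpGraph_adj (hB hc) hic).symm
    exact hac (Sum.inr.inj (Subtype.ext_iff.1 this))
  · obtain ⟨i, hi, j, hj, hij⟩ := Finset.one_lt_card.1 (hcon a hv)
    have key : ∀ k ∈ M.nbr a ∩ (B.erase a).biUnion M.nbr, (Sum.inl k : I ⊕ A) ∈ W ∧
        M.bpGraph.Adj (Sum.inr a) (Sum.inl k) := fun k hk => by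
      simp only [Finset.mem_inter, Finset.mem_biUnion, Finset.mem_erase] at hk
      obtain ⟨hka, c, ⟨hca, hcB⟩, hkc⟩ := hk
      exact ⟨⟨a, hv, c, hcB, hca.symm, hka, hkc⟩, M.bpGraph_adj (hB hv) hka⟩
    have := hleaf ⟨Sum.inl i, (key i hi).1⟩ ⟨Sum.inl j, (key j hj).1⟩ (key i hi).2 (key j hj).2
    exact hij (Sum.inl.inj (Subtype.ext_iff.1 this))

theorem forest_induction (M : Model I A X) (h : M.bpGraph.IsAcyclic) {P : Finset A → Prop}
    (empty : P ∅)
    (insert : ∀ a B, a ∉ B → insert a B ⊆ M.bp → (M.nbr a ∩ B.biUnion M.nbr).card ≤ 1 →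
      P B → P (insert a B)) : P M.bp := by
  suffices ∀ B ⊆ M.bp, P B from this _ subset_rfl
  intro B
  induction B using Finset.strongInduction with
  | H B ih =>
    intro hB
    rcases B.eq_empty_or_nonempty with rfl | hne
    · exact empty
    · obtain ⟨a, ha, hcard⟩ := M.exists_leaf h hB hne
      have := insert a (B.erase a) (Finset.notMem_erase a B) (by rwa [Finset.insert_erase ha]) hcard
        (ih _ (Finset.erase_ssubset ha) ((Finset.erase_subset _ _).trans hB))
      rwa [Finset.insert_erase ha] at this

/-! ### Existence of a forward/backward schedule -/

theorem exists_isForwardBackward_of_rank (M : Model I A X) (r : M.MsgName → ℕ)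
    (hr : ∀ e d, M.IsBPMsg e → M.Needs e d → r d < r e) : ∃ S, M.IsForwardBackward S := by
  classical
  let le : M.MsgName → M.MsgName → Bool := fun e d => decide (r e ≤ r d)
  let S := (Finset.univ.filter M.IsBPMsg).toList.mergeSort le
  have hperm : S.Perm _ := List.mergeSort_perm _ _
  have hmem : ∀ e, e ∈ S ↔ M.IsBPMsg e := fun e => by simp [hperm.mem_iff]
  have hsort : S.Pairwise (fun e d => le e d) := List.pairwise_mergeSort
    (fun a b c hab hbc => by simp only [le, decide_eq_true_eq] at *; omega)
    (fun a b => by simp only [le, Bool.or_eq_true, decide_eq_true_eq]; omega) _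
  refine ⟨S, hperm.nodup_iff.2 (Finset.nodup_toList _), hmem, fun S₁ e S₂ hS d hd => ?_⟩
  have he : M.IsBPMsg e := (hmem e).1 (by simp [hS])
  have hlt := hr e d he hd
  have hdS : d ∈ S := by
    rw [hmem]
    rcases e with ⟨a, i⟩ | ⟨i, a⟩ <;> rcases d with ⟨c, j⟩ | ⟨j, c⟩
    · exact hd.elim
    · obtain ⟨rfl, hj, -⟩ := hd
      exact ⟨he.1, hj⟩
    · obtain ⟨rfl, hc, -⟩ := hd
      exact Finset.mem_filter.1 hc
    · exact hd.elim
  rw [hS, List.pairwise_append, List.pairwise_cons] at hsort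
  rw [hS, List.mem_append, List.mem_cons] at hdS
  rcases hdS with h | rfl | h
  · exact h
  · exact absurd hlt (lt_irrefl _)
  · have := hsort.2.1.1 d h
    simp only [le, decide_eq_true_eq] at this
    omega

/-- Messages to and from the new leaf `a` are scheduled before the old ones when they point
towards the old forest and after the old ones otherwise. -/
theorem exists_rank (M : Model I A X) (h : M.bpGraph.IsAcyclic) :
    ∃ r : M.MsgName → ℕ, ∀ e d, M.IsBPMsg e → M.Needs e d → r d < r e := by
  let In : Finset A → M.MsgName → Prop := fun B e =>
    Sum.elim (fun p => p.1 ∈ B) (fun p => p.2 ∈ B) e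
  suffices ∃ r : M.MsgName → ℕ, ∀ e d, M.IsBPMsg e → In M.bp e → In M.bp d →
      M.Needs e d → r d < r e by
    obtain ⟨r, hr⟩ := this
    refine ⟨r, fun e d he hd => ?_⟩
    rcases e with ⟨a, i⟩ | ⟨i, a⟩ <;> rcases d with ⟨c, j⟩ | ⟨j, c⟩
    · exact hd.elim
    · exact hr _ _ he he.1 (by obtain ⟨rfl, -⟩ := hd; exact he.1) hd
    · exact hr _ _ he he.1 (Finset.mem_filter.1 hd.2.1).1 hd
    · exact hd.elim
  refine M.forest_induction (P := fun B => ∃ r : M.MsgName → ℕ, ∀ e d, M.IsBPMsg e → In B e →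
    In B d → M.Needs e d → r d < r e) h ⟨fun _ => 0, ?_⟩ ?_
  · rintro (e | e) d - he
    · simp [In] at he
    · simp [In] at he
  · rintro a B haB - hcard ⟨r, hr⟩
    set V := B.biUnion M.nbr with hV
    have hmemV : ∀ c ∈ B, ∀ i ∈ M.nbr c, i ∈ V := fun c hc i hi => Finset.mem_biUnion.2 ⟨c, hc, hi⟩
    have huniq : ∀ i ∈ M.nbr a, i ∈ V → ∀ j ∈ M.nbr a, j ∈ V → i = j := fun i hi hi' j hj hj' =>
      Finset.card_le_one.1 hcard i (by simp [hi, hi']) j (by simp [hj, hj'])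
    obtain ⟨N, hN⟩ : ∃ N, ∀ e, r e ≤ N :=
      ⟨Finset.univ.sup r, fun e => Finset.le_sup (Finset.mem_univ e)⟩
    classical
    refine ⟨Sum.elim
      (fun p => if p.1 = a then (if p.2 ∈ V then 1 else N + 4) else r (Sum.inl p) + 2)
      (fun p => if p.2 = a then (if p.1 ∈ V then N + 3 else 0) else r (Sum.inr p) + 2), ?_⟩
    rintro (⟨a₁, i⟩ | ⟨i, a₁⟩) (⟨c, j⟩ | ⟨j, c⟩) he heB hdB hd
    · exact hd.elim
    · obtain ⟨rfl, hj, hji⟩ := id hd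
      simp only [Sum.elim_inl, Sum.elim_inr]
      by_cases hc : c = a
      · subst hc
        have := huniq i he.2
        simp only [if_true]
        by_cases hiV : i ∈ V
        · have hjV : j ∉ V := fun hjV => hji (huniq j hj hjV i he.2 hiV)
          simp [hiV, hjV]
        · simp only [hiV, if_false]
          split_ifs <;> omega
      · have := hr _ (Sum.inr (j, c)) he ((Finset.mem_insert.1 heB).resolve_left hc)
          ((Finset.mem_insert.1 hdB).resolve_left hc) hd
        simp only [hc, if_false]
        omega
    · obtain ⟨rfl, hc, hca⟩ := id hd
      have hjc := (Finset.mem_filter.1 hc).2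
      simp only [Sum.elim_inl, Sum.elim_inr]
      by_cases h1 : a₁ = a
      · subst h1
        have hcB : c ∈ B := (Finset.mem_insert.1 hdB).resolve_left hca
        simp only [hca, hmemV c hcB j hjc, if_true, if_false]
        have := hN (Sum.inl (c, j))
        omega
      · have h1B : a₁ ∈ B := (Finset.mem_insert.1 heB).resolve_left h1
        by_cases h2 : c = a
        · simp only [h1, h2, hmemV a₁ h1B j he.2, if_true, if_false]
          omega
        · have := hr _ (Sum.inl (c, j)) he h1B ((Finset.mem_insert.1 hdB).resolve_left h2) hd
          simp only [h1, h2, if_false]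
          omega
    · exact hd.elim

theorem exists_isForwardBackward (M : Model I A X) (h : M.bpGraph.IsAcyclic) :
    ∃ S, M.IsForwardBackward S :=
  let ⟨r, hr⟩ := M.exists_rank h
  M.exists_isForwardBackward_of_rank r hr

/-! ### The messages after a forward/backward schedule -/

theorem foldl_send_toVar (M : Model I A X) (mMF : (a : A) → (i : I) → X i → ℝ) (ω : A → I → ℝ)
    {a : A} {i : I} {L : List M.MsgName} (h : Sum.inl (a, i) ∉ L) (s : M.Messages) :
    (L.foldl (M.send mMF ω) s).toVar a i = s.toVar a i := by
  induction L generalizing s with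
  | nil => rfl
  | cons e L ih =>
    rw [List.mem_cons, not_or] at h
    rw [List.foldl_cons, ih h.2]
    rcases e with ⟨c, j⟩ | ⟨j, c⟩
    · have : ¬ (a = c ∧ i = j) := fun ⟨h1, h2⟩ => h.1 (by rw [h1, h2])
      funext x
      simp [send, this]
    · rfl

theorem foldl_send_toFac (M : Model I A X) (mMF : (a : A) → (i : I) → X i → ℝ) (ω : A → I → ℝ)
    {a : A} {i : I} {L : List M.MsgName} (h : Sum.inr (i, a) ∉ L) (s : M.Messages) :
    (L.foldl (M.send mMF ω) s).toFac i a = s.toFac i a := by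
  induction L generalizing s with
  | nil => rfl
  | cons e L ih =>
    rw [List.mem_cons, not_or] at h
    rw [List.foldl_cons, ih h.2]
    rcases e with ⟨c, j⟩ | ⟨j, c⟩
    · rfl
    · have : ¬ (i = j ∧ a = c) := fun ⟨h1, h2⟩ => h.1 (by rw [h1, h2])
      funext x
      simp [send, this]

theorem sumProduct_congr (M : Model I A X) {n n' : (i : I) → A → X i → ℝ} {a : A} {i : I}
    (h : ∀ j ∈ M.nbr a, j ≠ i → n j a = n' j a) (x : X i) :
    M.sumProduct n a i x = M.sumProduct n' a i x := by
  refine Finset.sum_congr rfl fun y _ => ?_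
  congr 1
  refine Finset.prod_congr rfl fun j hj => ?_
  rw [h j.1 j.2 (Finset.mem_filter.1 hj).2]

theorem extrinsic_congr (M : Model I A X) {m m' mMF : (a : A) → (i : I) → X i → ℝ} {a : A} {i : I}
    (h : ∀ c ∈ M.NBP i, c ≠ a → m c i = m' c i) (x : X i) :
    M.extrinsic m mMF i a x = M.extrinsic m' mMF i a x := by
  unfold extrinsic
  congr 1
  refine Finset.prod_congr rfl fun c hc => ?_
  rw [h c (Finset.mem_of_mem_erase hc) (Finset.ne_of_mem_erase hc)]

theorem passMessages_toVar (M : Model I A X) (mMF : (a : A) → (i : I) → X i → ℝ) (ω : A → I → ℝ)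
    {S : List M.MsgName} (hS : M.IsForwardBackward S) {a : A} {i : I} (ha : a ∈ M.bp)
    (hi : i ∈ M.nbr a) (x : X i) :
    (M.passMessages mMF ω S).toVar a i x =
      ω a i * M.sumProduct (M.passMessages mMF ω S).toFac a i x := by
  obtain ⟨S₁, S₂, h⟩ := List.append_of_mem ((hS.mem_iff (Sum.inl (a, i))).2 ⟨ha, hi⟩)
  have hnd := hS.nodup
  rw [h] at hnd
  have hnd' := List.nodup_append.1 hnd
  unfold passMessages
  rw [h, List.foldl_append]
  set s := List.foldl (M.send mMF ω) ⟨fun _ _ _ => 1, fun _ _ _ => 1⟩ S₁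
  rw [M.sumProduct_congr (n' := s.toFac) (fun j hj hji => M.foldl_send_toFac mMF ω (fun hmem =>
      hnd'.2.2 _ (hS.ordered _ _ _ h (Sum.inr (j, a)) ⟨rfl, hj, hji⟩) _ hmem rfl) s),
    List.foldl_cons, M.foldl_send_toVar mMF ω (List.nodup_cons.1 hnd'.2.1).1]
  simp [send]

theorem passMessages_toFac (M : Model I A X) (mMF : (a : A) → (i : I) → X i → ℝ) (ω : A → I → ℝ)
    {S : List M.MsgName} (hS : M.IsForwardBackward S) {a : A} {i : I} (ha : a ∈ M.bp)
    (hi : i ∈ M.nbr a) (x : X i) :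
    (M.passMessages mMF ω S).toFac i a x =
      M.extrinsic (M.passMessages mMF ω S).toVar mMF i a x := by
  obtain ⟨S₁, S₂, h⟩ := List.append_of_mem ((hS.mem_iff (Sum.inr (i, a))).2 ⟨ha, hi⟩)
  have hnd := hS.nodup
  rw [h] at hnd
  have hnd' := List.nodup_append.1 hnd
  unfold passMessages
  rw [h, List.foldl_append]
  set s := List.foldl (M.send mMF ω) ⟨fun _ _ _ => 1, fun _ _ _ => 1⟩ S₁
  rw [M.extrinsic_congr (m' := s.toVar) (fun c hc hca => M.foldl_send_toVar mMF ω (fun hmem =>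
      hnd'.2.2 _ (hS.ordered _ _ _ h (Sum.inl (c, i)) ⟨rfl, hc, hca⟩) _ hmem rfl) s),
    List.foldl_cons, M.foldl_send_toFac mMF ω (List.nodup_cons.1 hnd'.2.1).1]
  simp [send]

theorem IsForwardBackward.induction {M : Model I A X} {S : List M.MsgName}
    (hS : M.IsForwardBackward S) {P : M.MsgName → Prop}
    (h : ∀ e, M.IsBPMsg e → (∀ d, M.Needs e d → P d) → P e) : ∀ e, M.IsBPMsg e → P e := by
  have key : ∀ n, ∀ S₁ e S₂, S = S₁ ++ e :: S₂ → S₁.length = n → P e := by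
    intro n
    induction n using Nat.strong_induction_on with
    | _ n ih =>
      intro S₁ e S₂ hs hn
      refine h e ((hS.mem_iff e).1 (by simp [hs])) fun d hd => ?_
      obtain ⟨T₁, T₂, hT⟩ := List.append_of_mem (hS.ordered _ _ _ hs d hd)
      refine ih T₁.length ?_ T₁ d (T₂ ++ e :: S₂) ?_ rfl
      · rw [← hn, hT]
        simp
      · rw [hs, hT]
        simp
  intro e he
  obtain ⟨S₁, S₂, hs⟩ := List.append_of_mem ((hS.mem_iff e).2 he)
  exact key _ S₁ e S₂ hs rfl

/-- Sets of values each of which extends, for every factor of the BP part, to a local configuration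
in the support of the factor with all its entries in these sets. -/
def Supported (M : Model I A X) (G : (i : I) → Set (X i)) : Prop :=
  ∀ a ∈ M.bp, ∀ i : {i // i ∈ M.nbr a}, ∀ x ∈ G i.1,
    ∃ y : M.Loc a, y i = x ∧ (∀ j, y j ∈ G j.1) ∧ 0 < M.f a y

/-- Nonnegative solutions of the message update equations of the BP part which are positive on all
supported sets. -/
structure IsBPMessages (M : Model I A X) (mMF : (a : A) → (i : I) → X i → ℝ) (ω : A → I → ℝ)
    (s : M.Messages) : Prop where
  toVar_eq : ∀ a ∈ M.bp, ∀ i ∈ M.nbr a, ∀ x, s.toVar a i x = ω a i * M.sumProduct s.toFac a i x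
  toFac_eq : ∀ a ∈ M.bp, ∀ i ∈ M.nbr a, ∀ x, s.toFac i a x = M.extrinsic s.toVar mMF i a x
  toVar_nonneg : ∀ a ∈ M.bp, ∀ i ∈ M.nbr a, ∀ x, 0 ≤ s.toVar a i x
  toFac_nonneg : ∀ a ∈ M.bp, ∀ i ∈ M.nbr a, ∀ x, 0 ≤ s.toFac i a x
  toVar_pos : ∀ G, M.Supported G → ∀ a ∈ M.bp, ∀ i ∈ M.nbr a, ∀ x ∈ G i, 0 < s.toVar a i x
  toFac_pos : ∀ G, M.Supported G → ∀ a ∈ M.bp, ∀ i ∈ M.nbr a, ∀ x ∈ G i, 0 < s.toFac i a x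

theorem isBPMessages_passMessages (M : Model I A X) {mMF : (a : A) → (i : I) → X i → ℝ}
    {ω : A → I → ℝ} {S : List M.MsgName} (hS : M.IsForwardBackward S) (hω : ∀ a i, 0 < ω a i)
    (hm : ∀ a i x, 0 < mMF a i x) : M.IsBPMessages mMF ω (M.passMessages mMF ω S) := by
  set s := M.passMessages mMF ω S with hs
  have hV : ∀ a ∈ M.bp, ∀ i ∈ M.nbr a, ∀ x, s.toVar a i x = ω a i * M.sumProduct s.toFac a i x :=
    fun a ha i hi x => M.passMessages_toVar mMF ω hS ha hi x
  have hF : ∀ a ∈ M.bp, ∀ i ∈ M.nbr a, ∀ x, s.toFac i a x = M.extrinsic s.toVar mMF i a x :=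
    fun a ha i hi x => M.passMessages_toFac mMF ω hS ha hi x
  have key : ∀ G, M.Supported G → ∀ e, M.IsBPMsg e → Sum.elim
      (fun p : A × I => (∀ x, 0 ≤ s.toVar p.1 p.2 x) ∧ ∀ x ∈ G p.2, 0 < s.toVar p.1 p.2 x)
      (fun p : I × A => (∀ x, 0 ≤ s.toFac p.1 p.2 x) ∧ ∀ x ∈ G p.1, 0 < s.toFac p.1 p.2 x) e := by
    intro G hG
    refine hS.induction ?_
    rintro (⟨a, i⟩ | ⟨i, a⟩) ⟨ha, hi⟩ ih
    · have ih' : ∀ j ∈ M.nbr a, j ≠ i →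
          (∀ x, 0 ≤ s.toFac j a x) ∧ ∀ x ∈ G j, 0 < s.toFac j a x :=
        fun j hj hji => ih (Sum.inr (j, a)) ⟨rfl, hj, hji⟩
      have hterm : ∀ y : M.Loc a, 0 ≤ M.f a y *
          ∏ j : {j // j ∈ M.nbr a} with j.1 ≠ i, s.toFac j.1 a (y j) := fun y =>
        mul_nonneg (M.f_nonneg a ha y) (Finset.prod_nonneg fun j hj =>
          (ih' j.1 j.2 (Finset.mem_filter.1 hj).2).1 _)
      refine ⟨fun x => ?_, fun x hx => ?_⟩
      · refine (hV a ha i hi x).symm ▸ ?_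
        exact mul_nonneg (hω a i).le (Finset.sum_nonneg fun y _ => hterm y)
      · refine (hV a ha i hi x).symm ▸ ?_
        obtain ⟨y, hy, hyG, hf⟩ := hG a ha ⟨i, hi⟩ x hx
        refine mul_pos (hω a i) (Finset.sum_pos' (fun y _ => hterm y) ⟨y, ?_, ?_⟩)
        · exact Finset.mem_filter.2 ⟨Finset.mem_univ _, fun _ => hy⟩
        · exact mul_pos hf (Finset.prod_pos fun j hj =>
            (ih' j.1 j.2 (Finset.mem_filter.1 hj).2).2 _ (hyG j))
    · have ih' : ∀ c ∈ M.NBP i, c ≠ a →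
          (∀ x, 0 ≤ s.toVar c i x) ∧ ∀ x ∈ G i, 0 < s.toVar c i x :=
        fun c hc hca => ih (Sum.inl (c, i)) ⟨rfl, hc, hca⟩
      refine ⟨fun x => ?_, fun x hx => ?_⟩
      · refine (hF a ha i hi x).symm ▸ ?_
        exact mul_nonneg (Finset.prod_nonneg fun c hc =>
          (ih' c (Finset.mem_of_mem_erase hc) (Finset.ne_of_mem_erase hc)).1 x)
          (Finset.prod_nonneg fun c _ => (hm c i x).le)
      · refine (hF a ha i hi x).symm ▸ ?_
        exact mul_pos (Finset.prod_pos fun c hc =>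
          (ih' c (Finset.mem_of_mem_erase hc) (Finset.ne_of_mem_erase hc)).2 x hx)
          (Finset.prod_pos fun c _ => hm c i x)
  have hempty : M.Supported fun _ => ∅ := fun a _ i x hx => hx.elim
  exact ⟨hV, hF, fun a ha i hi => (key _ hempty (Sum.inl (a, i)) ⟨ha, hi⟩).1,
    fun a ha i hi => (key _ hempty (Sum.inr (i, a)) ⟨ha, hi⟩).1,
    fun G hG a ha i hi => (key G hG (Sum.inl (a, i)) ⟨ha, hi⟩).2,
    fun G hG a ha i hi => (key G hG (Sum.inr (i, a)) ⟨ha, hi⟩).2⟩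

theorem sum_fiber_eq_sumProduct (M : Model I A X) (n : (i : I) → A → X i → ℝ) (a : A)
    (i : {i // i ∈ M.nbr a}) (x : X i.1) :
    ∑ y : M.Loc a with y i = x, M.f a y * ∏ j, n j.1 a (y j) =
      n i.1 a x * M.sumProduct n a i.1 x := by
  have hfil : (Finset.univ.filter fun y : M.Loc a => ∀ h : i.1 ∈ M.nbr a, y ⟨i.1, h⟩ = x) =
      Finset.univ.filter fun y : M.Loc a => y i = x := by
    ext y
    simp [i.2]
  rw [sumProduct, hfil, Finset.mul_sum]
  refine Finset.sum_congr rfl fun y hy => ?_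
  obtain rfl := (Finset.mem_filter.1 hy).2
  have : (Finset.univ.filter fun j : {j // j ∈ M.nbr a} => j.1 ≠ i.1) = Finset.univ.erase i := by
    ext j
    rw [Finset.mem_filter, Finset.mem_erase, ne_eq, ne_eq, Subtype.ext_iff, and_comm]
  rw [this, ← Finset.mul_prod_erase Finset.univ _ (Finset.mem_univ i)]
  ring

theorem incoming_eq_mul_extrinsic (M : Model I A X) (mBP mMF : (a : A) → (i : I) → X i → ℝ) {i : I}
    {a : A} (ha : a ∈ M.bp) (hi : i ∈ M.nbr a) (x : X i) :
    M.incoming mBP mMF i x = mBP a i x * M.extrinsic mBP mMF i a x := by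
  have : a ∈ M.NBP i := Finset.mem_filter.2 ⟨ha, hi⟩
  rw [incoming, extrinsic, ← Finset.mul_prod_erase _ _ this, mul_assoc]

theorem exists_config_pos (M : Model I A X) :
    ∃ x : ∀ i, X i, ∀ a, 0 < M.f a (fun j => x j.1) := by
  have hf : ∀ a (y : M.Loc a), 0 ≤ M.f a y := fun a y => by
    by_cases ha : a ∈ M.bp
    · exact M.f_nonneg a ha y
    · exact (M.f_pos a ha y).le
  obtain ⟨x, -, hx⟩ := Finset.exists_ne_zero_of_sum_ne_zero
    (by rw [M.sum_eq_one]; exact one_ne_zero)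
  exact ⟨x, fun a => lt_of_le_of_ne (hf a _)
    (Finset.prod_ne_zero_iff.1 hx a (Finset.mem_univ a)).symm⟩

theorem normalize_nonneg {Y : Type*} [Fintype Y] {g : Y → ℝ} (hg : ∀ y, 0 ≤ g y) (y : Y) :
    0 ≤ normalize g y :=
  div_nonneg (hg y) (Finset.sum_nonneg fun y _ => hg y)

theorem sum_normalize {Y : Type*} [Fintype Y] {g : Y → ℝ} (hg : ∑ y, g y ≠ 0) :
    ∑ y, normalize g y = 1 := by
  simp only [normalize]
  rw [← Finset.sum_div, div_self hg]

theorem mfMessage_pos (M : Model I A X) (n : (i : I) → A → X i → ℝ) (a : A) (i : I) (x : X i) :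
    0 < M.mfMessage n a i x := Real.exp_pos _

theorem mem_IMF_sdiff_IBP (M : Model I A X) {i : I} : i ∈ M.IMF \ M.IBP ↔ i ∉ M.IBP := by
  rw [Finset.mem_sdiff, and_iff_right_iff_imp]
  intro hi
  obtain ⟨a, ha⟩ := M.covered i
  refine Finset.mem_biUnion.2 ⟨a, ?_, ha⟩
  rw [mf, Finset.mem_compl]
  exact fun hb => hi (Finset.mem_biUnion.2 ⟨a, hb, ha⟩)

/-- The beliefs of the BP part computed from given messages. -/
def beliefsOf (M : Model I A X) (mMF : (a : A) → (i : I) → X i → ℝ) (s : M.Messages)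
    (b : M.Beliefs) : M.Beliefs :=
  (fun i => if i ∈ M.IBP then normalize (M.incoming s.toVar mMF i) else b.1 i,
   fun a => normalize fun y => M.f a.1 y * ∏ j, s.toFac j.1 a.1 (y j))

namespace IsBPMessages

variable {M : Model I A X} {mMF : (a : A) → (i : I) → X i → ℝ} {ω : A → I → ℝ} {s : M.Messages}

theorem incoming_eq (hs : M.IsBPMessages mMF ω s) {a : A} {i : I} (ha : a ∈ M.bp)
    (hi : i ∈ M.nbr a) (x : X i) :
    M.incoming s.toVar mMF i x = s.toVar a i x * s.toFac i a x := by
  rw [hs.toFac_eq a ha i hi, M.incoming_eq_mul_extrinsic _ _ ha hi]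

theorem sum_fiber (hs : M.IsBPMessages mMF ω s) {a : A} (ha : a ∈ M.bp)
    (i : {i // i ∈ M.nbr a}) (x : X i.1) :
    ω a i.1 * ∑ y : M.Loc a with y i = x, M.f a y * ∏ j, s.toFac j.1 a (y j) =
      M.incoming s.toVar mMF i.1 x := by
  rw [M.sum_fiber_eq_sumProduct, hs.incoming_eq ha i.2, hs.toVar_eq a ha i.1 i.2]
  ring

theorem sum_fac (hs : M.IsBPMessages mMF ω s) {a : A} (ha : a ∈ M.bp) (i : {i // i ∈ M.nbr a}) :
    ω a i.1 * ∑ y : M.Loc a, M.f a y * ∏ j, s.toFac j.1 a (y j) =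
      ∑ x, M.incoming s.toVar mMF i.1 x := by
  rw [← Finset.sum_fiberwise Finset.univ (fun y : M.Loc a => y i), Finset.mul_sum]
  exact Finset.sum_congr rfl fun x _ => hs.sum_fiber ha i x

theorem fac_nonneg (hs : M.IsBPMessages mMF ω s) {a : A} (ha : a ∈ M.bp) (y : M.Loc a) :
    0 ≤ M.f a y * ∏ j, s.toFac j.1 a (y j) :=
  mul_nonneg (M.f_nonneg a ha y) (Finset.prod_nonneg fun j _ => hs.toFac_nonneg a ha j.1 j.2 _)

theorem sum_fac_pos (hs : M.IsBPMessages mMF ω s) {a : A} (ha : a ∈ M.bp) :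
    0 < ∑ y : M.Loc a, M.f a y * ∏ j, s.toFac j.1 a (y j) := by
  obtain ⟨x, hx⟩ := M.exists_config_pos
  have hG : M.Supported fun i => {x i} := fun a _ i v hv =>
    ⟨fun j => x j.1, Eq.symm hv, fun j => rfl, hx a⟩
  exact Finset.sum_pos' (fun y _ => hs.fac_nonneg ha y) ⟨fun j => x j.1, Finset.mem_univ _,
    mul_pos (hx a) (Finset.prod_pos fun j _ => hs.toFac_pos _ hG a ha j.1 j.2 _ rfl)⟩

theorem sum_incoming_pos (hs : M.IsBPMessages mMF ω s) (hω : ∀ a i, 0 < ω a i) {i : I}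
    (hi : i ∈ M.IBP) : 0 < ∑ x, M.incoming s.toVar mMF i x := by
  obtain ⟨a, ha, hia⟩ := Finset.mem_biUnion.1 hi
  rw [← hs.sum_fac ha ⟨i, hia⟩]
  exact mul_pos (hω a i) (hs.sum_fac_pos ha)

theorem incoming_nonneg (hs : M.IsBPMessages mMF ω s) {i : I} (hi : i ∈ M.IBP) (x : X i) :
    0 ≤ M.incoming s.toVar mMF i x := by
  obtain ⟨a, ha, hia⟩ := Finset.mem_biUnion.1 hi
  rw [hs.incoming_eq ha hia]
  exact mul_nonneg (hs.toVar_nonneg a ha i hia x) (hs.toFac_nonneg a ha i hia x)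

theorem feasible_beliefsOf (hs : M.IsBPMessages mMF ω s) (hω : ∀ a i, 0 < ω a i) {b : M.Beliefs}
    (hb : M.MFNormalized b) : M.Feasible (M.beliefsOf mMF s b) where
  var_nonneg i x := by
    by_cases hi : i ∈ M.IBP
    · simp only [beliefsOf, hi, if_true]
      exact normalize_nonneg (hs.incoming_nonneg hi) x
    · simp only [beliefsOf, hi, if_false]
      exact (hb i (M.mem_IMF_sdiff_IBP.2 hi)).1 x
  fac_nonneg a y := normalize_nonneg (hs.fac_nonneg a.2) y
  var_sum i hi := by
    simp only [beliefsOf, M.mem_IMF_sdiff_IBP.1 hi, if_false]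
    exact (hb i hi).2
  fac_sum a := sum_normalize (hs.sum_fac_pos a.2).ne'
  marginal a i x := by
    simp only [beliefsOf, M.mem_IBP a i, if_true, normalize]
    rw [← Finset.sum_div, ← hs.sum_fiber a.2 i x, ← hs.sum_fac a.2 i,
      mul_div_mul_left _ _ (hω _ _).ne']

theorem agreeOffBP_beliefsOf (M : Model I A X) (mMF : (a : A) → (i : I) → X i → ℝ)
    (s : M.Messages) (b : M.Beliefs) : M.AgreeOffBP b (M.beliefsOf mMF s b) := fun i hi => by
  simp [beliefsOf, M.mem_IMF_sdiff_IBP.1 hi]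

end IsBPMessages

/-- The beliefs of the BP part are a reparametrization of
`∏_{a ∈ A_BP} f_a(x_a) ∏_{i ∈ I_BP} g_i(x_i)`. -/
def IsReparametrization (M : Model I A X) (g : (i : I) → X i → ℝ) (b : M.Beliefs) : Prop :=
  ∃ (m : (a : A) → (i : I) → X i → ℝ) (κ : A → ℝ) (z : I → ℝ),
    (∀ a ∈ M.bp, 0 < κ a) ∧ (∀ i ∈ M.IBP, 0 < z i) ∧
    (∀ (a : {a // a ∈ M.bp}) (y : M.Loc a.1), b.2 a y * ∏ j, m a.1 j.1 (y j) =
      κ a.1 * M.f a.1 y * ∏ j : {j // j ∈ M.nbr a.1}, b.1 j.1 (y j)) ∧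
    (∀ i ∈ M.IBP, ∀ x, b.1 i x = z i * ((∏ a ∈ M.NBP i, m a i x) * g i x)) ∧
    ∀ G, M.Supported G → ∀ a ∈ M.bp, ∀ i ∈ M.nbr a, ∀ x ∈ G i, 0 < m a i x

theorem IsBPMessages.isReparametrization_beliefsOf {M : Model I A X}
    {mMF : (a : A) → (i : I) → X i → ℝ} {ω : A → I → ℝ} {s : M.Messages}
    (hs : M.IsBPMessages mMF ω s) (hω : ∀ a i, 0 < ω a i) (b : M.Beliefs) :
    M.IsReparametrization (fun i x => ∏ a ∈ M.NMF i, mMF a i x) (M.beliefsOf mMF s b) := by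
  refine ⟨s.toVar, fun a => (∏ j ∈ M.nbr a, ∑ x, M.incoming s.toVar mMF j x) /
    ∑ y : M.Loc a, M.f a y * ∏ j, s.toFac j.1 a (y j),
    fun i => (∑ x, M.incoming s.toVar mMF i x)⁻¹, fun a ha => ?_, fun i hi => ?_, fun a y => ?_,
    fun i hi x => ?_, hs.toVar_pos⟩
  · exact div_pos (Finset.prod_pos fun j hj =>
      hs.sum_incoming_pos hω (M.mem_IBP ⟨a, ha⟩ ⟨j, hj⟩)) (hs.sum_fac_pos ha)
  · exact inv_pos.2 (hs.sum_incoming_pos hω hi)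
  · have h1 : ∏ j : {j // j ∈ M.nbr a.1}, (M.beliefsOf mMF s b).1 j.1 (y j) =
        ((∏ j, s.toVar a.1 j.1 (y j)) * ∏ j, s.toFac j.1 a.1 (y j)) /
          ∏ j ∈ M.nbr a.1, ∑ x, M.incoming s.toVar mMF j x := by
      rw [← Finset.prod_coe_sort (M.nbr a.1), ← Finset.prod_mul_distrib, ← Finset.prod_div_distrib]
      refine Finset.prod_congr rfl fun j _ => ?_
      simp only [beliefsOf, M.mem_IBP a j, if_true, normalize]
      rw [hs.incoming_eq a.2 j.2]
    have h2 : ∏ j ∈ M.nbr a.1, ∑ x, M.incoming s.toVar mMF j x ≠ 0 :=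
      Finset.prod_ne_zero_iff.2 fun j hj => (hs.sum_incoming_pos hω (M.mem_IBP a ⟨j, hj⟩)).ne'
    rw [h1]
    simp only [beliefsOf, normalize]
    have h3 := (hs.sum_fac_pos a.2).ne'
    field_simp
  · simp only [beliefsOf, hi, if_true, normalize]
    rw [div_eq_inv_mul, incoming]
end Model

/-! ### Expectations with respect to product weights -/

section Product

variable {ι : Type*} [Fintype ι] [DecidableEq ι] {Y : ι → Type*} [∀ i, Fintype (Y i)]
  [∀ i, DecidableEq (Y i)]

/-- The expectation of `φ` under the product of the weights `p i`. -/
def prodExp (p : (i : ι) → Y i → ℝ) (φ : ((i : ι) → Y i) → ℝ) : ℝ :=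
  ∑ x, (∏ i, p i (x i)) * φ x

theorem sum_sum_swap (p : (i : ι) → Y i → ℝ) (S : Finset ι)
    (F : ((i : ι) → Y i) → ((i : ι) → Y i) → ℝ) :
    ∑ x, ∑ x', (∏ i, p i (x i)) * (∏ i, p i (x' i)) * F x x' =
      ∑ x, ∑ x', (∏ i, p i (x i)) * (∏ i, p i (x' i)) *
        F (S.piecewise x x') (S.piecewise x' x) := by
  rw [← Finset.sum_product', ← Finset.sum_product']
  refine Finset.sum_nbij' (fun q => (S.piecewise q.1 q.2, S.piecewise q.2 q.1))
    (fun q => (S.piecewise q.1 q.2, S.piecewise q.2 q.1)) (by simp) (by simp) ?_ ?_ ?_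
  · rintro ⟨x, x'⟩ -
    ext i <;> by_cases hi : i ∈ S <;> simp [hi]
  · rintro ⟨x, x'⟩ -
    ext i <;> by_cases hi : i ∈ S <;> simp [hi]
  · rintro ⟨x, x'⟩ -
    congr 1
    · rw [← Finset.prod_mul_distrib, ← Finset.prod_mul_distrib]
      refine Finset.prod_congr rfl fun i _ => ?_
      by_cases hi : i ∈ S <;> simp [hi, mul_comm]
    · congr 1 <;> ext i <;> by_cases hi : i ∈ S <;> simp [hi]

theorem prodExp_mul_prodExp (p : (i : ι) → Y i → ℝ) (φ ψ : ((i : ι) → Y i) → ℝ) :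
    prodExp p φ * prodExp p ψ =
      ∑ x, ∑ x', (∏ i, p i (x i)) * (∏ i, p i (x' i)) * (φ x * ψ x') := by
  rw [prodExp, prodExp, Finset.sum_mul_sum]
  refine Finset.sum_congr rfl fun x _ => Finset.sum_congr rfl fun x' _ => by ring

theorem sum_piFinset_prod (p : (i : ι) → Y i → ℝ) (t : (i : ι) → Finset (Y i)) :
    ∑ x ∈ Fintype.piFinset t, ∏ i, p i (x i) = ∏ i, ∑ v ∈ t i, p i v :=
  (Finset.prod_univ_sum t p).symm

theorem prodExp_one {p : (i : ι) → Y i → ℝ} (hp : ∀ i, ∑ v, p i v = 1) :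
    prodExp p (fun _ => 1) = 1 := by
  have := sum_piFinset_prod p fun _ => Finset.univ
  simpa [prodExp, hp] using this

theorem prodExp_single {p : (i : ι) → Y i → ℝ} (hp : ∀ i, ∑ v, p i v = 1) (j : ι) (v : Y j) :
    prodExp p (fun x => if x j = v then 1 else 0) = p j v := by
  have h1 : prodExp p (fun x => if x j = v then 1 else 0) =
      ∑ x ∈ Fintype.piFinset (Function.update (fun _ => Finset.univ) j {v}), ∏ i, p i (x i) := by
    have : Fintype.piFinset (Function.update (fun i => (Finset.univ : Finset (Y i))) j {v}) =
        Finset.univ.filter fun x => x j = v := by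
      ext x
      simp only [Fintype.mem_piFinset, Finset.mem_filter, Finset.mem_univ, true_and]
      constructor
      · intro h
        simpa using h j
      · rintro rfl i
        by_cases hi : i = j
        · subst hi
          simp
        · simp [hi]
    rw [this, Finset.sum_filter, prodExp]
    exact Finset.sum_congr rfl fun x _ => by simp
  rw [h1, sum_piFinset_prod, Finset.prod_eq_single j]
  · simp
  · intro i _ hi
    simp [hi, hp]
  · simp

theorem prodExp_sum_single (p : (i : ι) → Y i → ℝ) (φ : ((i : ι) → Y i) → ℝ) (j : ι) :
    prodExp p φ = ∑ v, prodExp p (fun x => φ x * if x j = v then 1 else 0) := by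
  simp only [prodExp]
  rw [Finset.sum_comm]
  refine Finset.sum_congr rfl fun x _ => ?_
  simp

theorem prodExp_mul_of_inter_card_le_one {p : (i : ι) → Y i → ℝ} (hp : ∀ i, ∑ v, p i v = 1)
    {φ ψ : ((i : ι) → Y i) → ℝ} {S T : Finset ι} (hφ : DependsOn φ S) (hψ : DependsOn ψ T)
    (hST : (S ∩ T).card ≤ 1) (hψ₁ : prodExp p ψ = 1)
    (hψj : ∀ j ∈ S ∩ T, ∀ v, prodExp p (fun x => ψ x * if x j = v then 1 else 0) = p j v) :
    prodExp p (fun x => φ x * ψ x) = prodExp p φ := by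
  have hpφ : ∀ x x', φ (S.piecewise x x') = φ x := fun x x' => hφ fun i hi => by
    simp [Finset.mem_coe.1 hi]
  rcases (S ∩ T).eq_empty_or_nonempty with h0 | ⟨j, hj⟩
  · have hpψ : ∀ x x', ψ (S.piecewise x' x) = ψ x := fun x x' => hψ fun i hi => by
      have : i ∉ S := fun hS => by
        have := Finset.mem_inter.2 ⟨hS, Finset.mem_coe.1 hi⟩
        simp [h0] at this
      simp [this]
    have h1 := prodExp_mul_prodExp p φ ψ
    rw [sum_sum_swap p S] at h1
    simp only [hpφ, hpψ] at h1
    have h2 := prodExp_mul_prodExp p (fun x => φ x * ψ x) fun _ => 1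
    simp only [mul_one] at h2
    rw [← h1, prodExp_one hp, hψ₁, mul_one, mul_one] at h2
    exact h2
  · have huniq : ∀ i ∈ S, i ∈ T → i = j := fun i hi hi' =>
      Finset.card_le_one.1 hST i (Finset.mem_inter.2 ⟨hi, hi'⟩) j hj
    rw [prodExp_sum_single p _ j, prodExp_sum_single p φ j]
    refine Finset.sum_congr rfl fun v _ => ?_
    by_cases hv : p j v = 0
    · have hz : ∀ χ : ((i : ι) → Y i) → ℝ,
          prodExp p (fun x => χ x * if x j = v then 1 else 0) = 0 := fun χ => by
        refine Finset.sum_eq_zero fun x _ => ?_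
        by_cases hx : x j = v
        · rw [Finset.prod_eq_zero (Finset.mem_univ j) (by rw [hx, hv]), zero_mul]
        · simp [hx]
      rw [hz, hz]
    · have h1 := prodExp_mul_prodExp p (fun x => φ x * if x j = v then 1 else 0)
        (fun x => ψ x * if x j = v then 1 else 0)
      have h2 := prodExp_mul_prodExp p (fun x => φ x * ψ x * if x j = v then 1 else 0)
        (fun x => if x j = v then 1 else 0)
      rw [sum_sum_swap p S] at h1
      rw [prodExp_single hp] at h2
      rw [hψj j hj] at h1
      have h3 : ∀ x x' : (i : ι) → Y i,
          (φ (S.piecewise x x') * if S.piecewise x x' j = v then 1 else 0) *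
            (ψ (S.piecewise x' x) * if S.piecewise x' x j = v then 1 else 0) =
          (φ x * ψ x * if x j = v then 1 else 0) * if x' j = v then 1 else 0 := fun x x' => by
        have hjS : j ∈ S := (Finset.mem_inter.1 hj).1
        rw [hpφ, Finset.piecewise_eq_of_mem _ _ _ hjS, Finset.piecewise_eq_of_mem _ _ _ hjS]
        by_cases h : x j = v <;> by_cases h' : x' j = v <;> simp only [h, h', if_true, if_false,
          mul_one, mul_zero, zero_mul]
        congr 1
        refine hψ fun i hi => ?_
        by_cases hiS : i ∈ S
        · obtain rfl := huniq i hiS hi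
          simp [hiS, h, h']
        · simp [hiS]
      simp only [h3] at h1
      exact mul_right_cancel₀ hv (h2.trans h1.symm)

/-- Gluing the conditional densities `r a` along a forest does not change the local expectations. -/
theorem prodExp_prod_insert {A : Type*} [DecidableEq A] {p : (i : ι) → Y i → ℝ}
    (hp : ∀ i, ∑ v, p i v = 1) {r : A → ((i : ι) → Y i) → ℝ} {N : A → Finset ι}
    (hr : ∀ a, DependsOn (r a) (N a)) {a : A} {B : Finset A} (haB : a ∉ B)
    (hr₁ : prodExp p (r a) = 1)
    (hrj : ∀ j ∈ N a, ∀ v, prodExp p (fun x => r a x * if x j = v then 1 else 0) = p j v)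
    (hcard : (N a ∩ B.biUnion N).card ≤ 1)
    (ih : prodExp p (fun x => ∏ c ∈ B, r c x) = 1 ∧
      (∀ j v, prodExp p (fun x => (∏ c ∈ B, r c x) * if x j = v then 1 else 0) = p j v) ∧
      ∀ c ∈ B, ∀ φ : ((i : ι) → Y i) → ℝ, DependsOn φ (N c) →
        prodExp p (fun x => (∏ c ∈ B, r c x) * φ x) = prodExp p (fun x => r c x * φ x)) :
    prodExp p (fun x => ∏ c ∈ insert a B, r c x) = 1 ∧
      (∀ j v, prodExp p (fun x => (∏ c ∈ insert a B, r c x) * if x j = v then 1 else 0) = p j v) ∧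
      ∀ c ∈ insert a B, ∀ φ : ((i : ι) → Y i) → ℝ, DependsOn φ (N c) →
        prodExp p (fun x => (∏ c ∈ insert a B, r c x) * φ x) =
          prodExp p (fun x => r c x * φ x) := by
  obtain ⟨ih1, ih2, ih3⟩ := ih
  have hR : DependsOn (fun x => ∏ c ∈ B, r c x) (B.biUnion N) := fun x x' h =>
    Finset.prod_congr rfl fun c hc => hr c fun i hi =>
      h i (Finset.mem_coe.2 (Finset.mem_biUnion.2 ⟨c, hc, hi⟩))
  have hcard' : (B.biUnion N ∩ N a).card ≤ 1 := by rwa [Finset.inter_comm]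
  simp only [Finset.prod_insert haB]
  have hleft : ∀ φ : ((i : ι) → Y i) → ℝ, DependsOn φ (N a) →
      prodExp p (fun x => r a x * (∏ c ∈ B, r c x) * φ x) = prodExp p (fun x => r a x * φ x) := by
    intro φ hφ
    rw [← prodExp_mul_of_inter_card_le_one hp (φ := fun x => r a x * φ x) (S := N a)
      (fun x x' h => by simp only [hr a h, hφ h]) hR hcard ih1 fun j _ v => ih2 j v]
    congr 1
    ext x
    ring
  refine ⟨?_, fun j v => ?_, fun c hc φ hφ => ?_⟩
  · have := hleft (fun _ => 1) fun _ _ _ => rfl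
    simpa [hr₁] using this
  · by_cases hj : j ∈ N a
    · rw [hleft _ fun x x' h => by rw [h j (Finset.mem_coe.2 hj)], hrj j hj]
    · have h := prodExp_mul_of_inter_card_le_one hp
        (φ := fun x => (∏ c ∈ B, r c x) * if x j = v then 1 else 0) (S := insert j (B.biUnion N))
        (T := N a) (fun x x' h => ?_) (hr a)
        (by rwa [Finset.insert_inter_of_notMem hj]) hr₁
        fun i hi v => hrj i (Finset.mem_inter.1 hi).2 v
      · rw [ih2] at h
        rw [← h]
        congr 1
        ext x
        ring
      · rw [Finset.coe_insert] at h
        simp only [hR fun i hi => h i (Set.mem_insert_of_mem _ hi), h j (Set.mem_insert _ _)]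
  · rcases Finset.mem_insert.1 hc with rfl | hcB
    · exact hleft φ hφ
    · have h := prodExp_mul_of_inter_card_le_one hp
        (φ := fun x => (∏ c ∈ B, r c x) * φ x) (S := B.biUnion N)
        (T := N a) (fun x x' h => ?_) (hr a) hcard' hr₁
        fun i hi v => hrj i (Finset.mem_inter.1 hi).2 v
      · rw [ih3 c hcB φ hφ] at h
        rw [← h]
        congr 1
        ext x
        ring
      · simp only [hR h, hφ fun i hi =>
          h i (Finset.mem_coe.2 (Finset.mem_biUnion.2 ⟨c, hcB, Finset.mem_coe.1 hi⟩))]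

end Product

namespace Model

/-! ### Feasible beliefs -/

namespace Feasible

variable {M : Model I A X} {b : M.Beliefs}

theorem sum_fac_mul (hb : M.Feasible b) (a : {a // a ∈ M.bp}) (i : {i // i ∈ M.nbr a.1})
    (g : X i.1 → ℝ) : ∑ y, b.2 a y * g (y i) = ∑ x, b.1 i.1 x * g x := by
  rw [← Finset.sum_fiberwise Finset.univ (fun y : M.Loc a.1 => y i)]
  refine Finset.sum_congr rfl fun x _ => ?_
  rw [hb.marginal a i x, Finset.sum_mul]
  exact Finset.sum_congr rfl fun y hy => by rw [(Finset.mem_filter.1 hy).2]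

theorem sum_var (hb : M.Feasible b) (i : I) : ∑ x, b.1 i x = 1 := by
  by_cases hi : i ∈ M.IBP
  · obtain ⟨a, ha, hia⟩ := Finset.mem_biUnion.1 hi
    have := hb.sum_fac_mul ⟨a, ha⟩ ⟨i, hia⟩ fun _ => 1
    simp only [mul_one] at this
    exact this.symm.trans (hb.fac_sum ⟨a, ha⟩)
  · exact hb.var_sum i (M.mem_IMF_sdiff_IBP.2 hi)

theorem fac_le_var (hb : M.Feasible b) (a : {a // a ∈ M.bp}) (y : M.Loc a.1)
    (i : {i // i ∈ M.nbr a.1}) : b.2 a y ≤ b.1 i.1 (y i) := by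
  rw [hb.marginal a i (y i)]
  exact Finset.single_le_sum (f := fun y => b.2 a y) (fun y _ => hb.fac_nonneg a y)
    (Finset.mem_filter.2 ⟨Finset.mem_univ y, rfl⟩)

theorem fac_eq_zero (hb : M.Feasible b) {a : {a // a ∈ M.bp}} {y : M.Loc a.1}
    (h : ∏ j : {j // j ∈ M.nbr a.1}, b.1 j.1 (y j) = 0) : b.2 a y = 0 := by
  obtain ⟨j, -, hj⟩ := Finset.prod_eq_zero_iff.1 h
  exact le_antisymm ((hb.fac_le_var a y j).trans hj.le) (hb.fac_nonneg a y)

theorem mfNormalized (hb : M.Feasible b) : M.MFNormalized b := fun i hi =>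
  ⟨hb.var_nonneg i, hb.var_sum i hi⟩

theorem var_le_one (hb : M.Feasible b) (i : I) (x : X i) : b.1 i x ≤ 1 :=
  (Finset.single_le_sum (f := b.1 i) (fun x _ => hb.var_nonneg i x) (Finset.mem_univ x)).trans_eq
    (hb.sum_var i)

theorem fac_le_one (hb : M.Feasible b) (a : {a // a ∈ M.bp}) (y : M.Loc a.1) : b.2 a y ≤ 1 :=
  (Finset.single_le_sum (f := b.2 a) (fun y _ => hb.fac_nonneg a y) (Finset.mem_univ y)).trans_eq
    (hb.fac_sum a)

end Feasible

/-! ### The joint distribution of the BP part -/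

@[to_additive]
theorem prod_edges {R : Type*} [CommMonoid R] (M : Model I A X)
    (h : A → {i // i ∈ M.IBP} → R) :
    ∏ a : {a // a ∈ M.bp}, ∏ j : {j // j ∈ M.nbr a.1}, h a.1 ⟨j.1, M.mem_IBP a j⟩ =
      ∏ i : {i // i ∈ M.IBP}, ∏ a ∈ M.NBP i.1, h a i := by
  simp only [NBP, Finset.prod_filter]
  rw [Finset.prod_comm, ← Finset.prod_coe_sort M.bp]
  refine Finset.prod_congr rfl fun a _ => ?_
  refine Fintype.prod_of_injective
    (fun j : {j // j ∈ M.nbr a.1} => (⟨j.1, M.mem_IBP a j⟩ : {i // i ∈ M.IBP}))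
    (fun j k hjk => Subtype.ext (by simpa using hjk)) _ _ (fun i hi => ?_) fun j => ?_
  · refine if_neg fun hia => hi ⟨⟨i.1, hia⟩, rfl⟩
  · simp [j.2]

theorem prodExp_local (M : Model I A X) {p : (i : {i // i ∈ M.IBP}) → X i.1 → ℝ}
    (hp : ∀ i, ∑ v, p i v = 1) (a : {a // a ∈ M.bp}) (φ : M.Loc a.1 → ℝ) :
    prodExp p (fun x => φ (BPConfig.local M x a)) =
      ∑ y : M.Loc a.1, (∏ j, p ⟨j.1, M.mem_IBP a j⟩ (y j)) * φ y := by
  rw [prodExp, ← Finset.sum_fiberwise Finset.univ (fun x => BPConfig.local M x a)]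
  refine Finset.sum_congr rfl fun y _ => ?_
  have h1 : (Finset.univ.filter fun x : M.BPConfig => BPConfig.local M x a = y) =
      Fintype.piFinset fun i : {i // i ∈ M.IBP} =>
        if h : i.1 ∈ M.nbr a.1 then ({y ⟨i.1, h⟩} : Finset (X i.1)) else Finset.univ := by
    ext x
    simp only [Finset.mem_filter, Finset.mem_univ, true_and, Fintype.mem_piFinset]
    constructor
    · rintro rfl i
      by_cases h : i.1 ∈ M.nbr a.1
      · simp [h, BPConfig.local]
      · simp [h]
    · intro h
      funext j
      have := h ⟨j.1, M.mem_IBP a j⟩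
      simp only [j.2, dif_pos, Finset.mem_singleton] at this
      exact this
  rw [Finset.sum_congr rfl fun x hx => by rw [(Finset.mem_filter.1 hx).2], ← Finset.sum_mul, h1,
    sum_piFinset_prod]
  congr 1
  symm
  refine Fintype.prod_of_injective
    (fun j : {j // j ∈ M.nbr a.1} => (⟨j.1, M.mem_IBP a j⟩ : {i // i ∈ M.IBP}))
    (fun j k hjk => Subtype.ext (by simpa using hjk)) _ _ (fun i hi => ?_) fun j => ?_
  · have : i.1 ∉ M.nbr a.1 := fun hia => hi ⟨⟨i.1, hia⟩, rfl⟩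
    simp [this, hp]
  · simp [j.2]

/-- The density of `b_a` with respect to the product of the beliefs `b_j`, `j ∈ N(a)`. -/
def ratio (M : Model I A X) (b : M.Beliefs) (a : A) (x : M.BPConfig) : ℝ :=
  if h : a ∈ M.bp then
    b.2 ⟨a, h⟩ (BPConfig.local M x ⟨a, h⟩) /
      ∏ j : {j // j ∈ M.nbr a}, b.1 j.1 (BPConfig.local M x ⟨a, h⟩ j)
  else 1

theorem dependsOn_ratio (M : Model I A X) (b : M.Beliefs) (a : A) :
    DependsOn (M.ratio b a)
      (Finset.univ.filter fun i : {i // i ∈ M.IBP} => i.1 ∈ M.nbr a : Finset _) := by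
  intro x x' h
  by_cases ha : a ∈ M.bp
  · have : BPConfig.local M x ⟨a, ha⟩ = BPConfig.local M x' ⟨a, ha⟩ := funext fun j =>
      h ⟨j.1, M.mem_IBP ⟨a, ha⟩ j⟩ (by simp [j.2])
    simp only [ratio, ha, dif_pos, this]
  · simp [ratio, ha]

namespace Feasible

variable {M : Model I A X} {b : M.Beliefs}

theorem prodExp_ratio_mul (hb : M.Feasible b) (a : {a // a ∈ M.bp}) (φ : M.Loc a.1 → ℝ) :
    prodExp (fun i : {i // i ∈ M.IBP} => b.1 i.1)
      (fun x => M.ratio b a.1 x * φ (BPConfig.local M x a)) = ∑ y, b.2 a y * φ y := by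
  have h : ∀ x, M.ratio b a.1 x * φ (BPConfig.local M x a) =
      (fun y => (b.2 a y / ∏ j : {j // j ∈ M.nbr a.1}, b.1 j.1 (y j)) * φ y)
        (BPConfig.local M x a) := fun x => by
    simp only [ratio, a.2, dif_pos]
  rw [funext h, M.prodExp_local (p := fun i : {i // i ∈ M.IBP} => b.1 i.1)
    (fun i => hb.sum_var i.1) a
    (fun y => (b.2 a y / ∏ j : {j // j ∈ M.nbr a.1}, b.1 j.1 (y j)) * φ y)]
  refine Finset.sum_congr rfl fun y _ => ?_
  by_cases h0 : ∏ j : {j // j ∈ M.nbr a.1}, b.1 j.1 (y j) = 0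
  · rw [h0, hb.fac_eq_zero h0]
    ring
  · field_simp

theorem joint_marginals (hb : M.Feasible b) (hc : M.bpGraph.IsAcyclic) :
    prodExp (fun i : {i // i ∈ M.IBP} => b.1 i.1) (fun x => ∏ c ∈ M.bp, M.ratio b c x) = 1 ∧
      (∀ (j : {i // i ∈ M.IBP}) v, prodExp (fun i : {i // i ∈ M.IBP} => b.1 i.1)
        (fun x => (∏ c ∈ M.bp, M.ratio b c x) * if x j = v then 1 else 0) = b.1 j.1 v) ∧
      ∀ (a : {a // a ∈ M.bp}) y, prodExp (fun i : {i // i ∈ M.IBP} => b.1 i.1)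
        (fun x => (∏ c ∈ M.bp, M.ratio b c x) * if BPConfig.local M x a = y then 1 else 0) =
          b.2 a y := by
  have hp : ∀ i : {i // i ∈ M.IBP}, ∑ v, b.1 i.1 v = 1 := fun i => hb.sum_var i.1
  let N : A → Finset {i // i ∈ M.IBP} := fun a => Finset.univ.filter fun i => i.1 ∈ M.nbr a
  have key := M.forest_induction (P := fun B =>
    prodExp (fun i : {i // i ∈ M.IBP} => b.1 i.1) (fun x => ∏ c ∈ B, M.ratio b c x) = 1 ∧
      (∀ (j : {i // i ∈ M.IBP}) v, prodExp (fun i : {i // i ∈ M.IBP} => b.1 i.1)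
        (fun x => (∏ c ∈ B, M.ratio b c x) * if x j = v then 1 else 0) = b.1 j.1 v) ∧
      ∀ c ∈ B, ∀ φ : M.BPConfig → ℝ, DependsOn φ (N c) →
        prodExp (fun i : {i // i ∈ M.IBP} => b.1 i.1)
          (fun x => (∏ c ∈ B, M.ratio b c x) * φ x) =
        prodExp (fun i : {i // i ∈ M.IBP} => b.1 i.1) (fun x => M.ratio b c x * φ x)) hc
    ⟨by simpa using prodExp_one hp, by simpa using prodExp_single hp, by simp⟩ ?_
  · refine ⟨key.1, key.2.1, fun a y => ?_⟩
    rw [key.2.2 a.1 a.2 (fun x => if BPConfig.local M x a = y then 1 else 0) ?_]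
    · rw [hb.prodExp_ratio_mul a (fun y' => if y' = y then 1 else 0)]
      simp
    · intro x x' h
      have : BPConfig.local M x a = BPConfig.local M x' a := funext fun j =>
        h ⟨j.1, M.mem_IBP a j⟩ (by simp [N, j.2])
      simp only [this]
  · intro a B haB hB hcard ih
    have ha : a ∈ M.bp := hB (Finset.mem_insert_self a B)
    refine prodExp_prod_insert hp (M.dependsOn_ratio b) haB ?_ ?_ ?_ ih
    · have := hb.prodExp_ratio_mul ⟨a, ha⟩ fun _ => 1
      simp only [mul_one] at this
      exact this.trans (hb.fac_sum ⟨a, ha⟩)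
    · intro j hj v
      have hja : j.1 ∈ M.nbr a := (Finset.mem_filter.1 hj).2
      have := hb.prodExp_ratio_mul ⟨a, ha⟩ fun y => if y ⟨j.1, hja⟩ = v then 1 else 0
      rw [hb.sum_fac_mul ⟨a, ha⟩ ⟨j.1, hja⟩ fun x => if x = v then 1 else 0] at this
      refine this.trans ?_
      simp
    · refine le_trans ?_ hcard
      rw [← Finset.card_map (Function.Embedding.subtype _)]
      refine Finset.card_le_card fun i hi => ?_
      obtain ⟨i, hi', rfl⟩ := Finset.mem_map.1 hi
      obtain ⟨hia, hiB⟩ := Finset.mem_inter.1 hi'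
      obtain ⟨c, hc, hic⟩ := Finset.mem_biUnion.1 hiB
      exact Finset.mem_inter.2 ⟨(Finset.mem_filter.1 hia).2,
        Finset.mem_biUnion.2 ⟨c, hc, (Finset.mem_filter.1 hic).2⟩⟩

end Feasible

theorem normalize_eq_of_forall_eq_mul {Y : Type*} [Fintype Y] {g q : Y → ℝ} {C : ℝ}
    (h : ∀ y, q y = C * g y) (hq : ∑ y, q y = 1) : normalize g = q := by
  have h1 : C * ∑ y, g y = 1 := by rw [← hq, Finset.mul_sum]; simp [h]
  funext y
  have h2 : ∑ y, g y ≠ 0 := fun h0 => by simp [h0] at h1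
  rw [normalize, h y, div_eq_iff h2]
  linear_combination (-g y) * h1

/-- The unnormalized joint weight of the BP part. -/
def bpWeight (M : Model I A X) (g : (i : I) → X i → ℝ) (x : M.BPConfig) : ℝ :=
  (∏ a : {a // a ∈ M.bp}, M.f a.1 (BPConfig.local M x a)) * ∏ i : {i // i ∈ M.IBP}, g i.1 (x i)

theorem IsReparametrization.normalize_bpWeight {M : Model I A X} {g : (i : I) → X i → ℝ}
    {b : M.Beliefs} (h : M.IsReparametrization g b) (hb : M.Feasible b)
    (hg : ∀ i x, 0 < g i x) (hc : M.bpGraph.IsAcyclic) :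
    normalize (M.bpWeight g) = fun x =>
      (∏ i : {i // i ∈ M.IBP}, b.1 i.1 (x i)) * ∏ c ∈ M.bp, M.ratio b c x := by
  obtain ⟨m, κ, z, hκ, hz, hfac, hvar, hpos⟩ := h
  refine normalize_eq_of_forall_eq_mul
    (C := (∏ a : {a // a ∈ M.bp}, κ a.1) * ∏ i : {i // i ∈ M.IBP}, z i.1) (fun x => ?_)
    (hb.joint_marginals hc).1
  by_cases h0 : ∏ i : {i // i ∈ M.IBP}, b.1 i.1 (x i) = 0
  · rw [h0, zero_mul]
    suffices ∏ a : {a // a ∈ M.bp}, M.f a.1 (BPConfig.local M x a) = 0 by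
      rw [bpWeight, this]
      ring
    by_contra hne
    obtain ⟨i, -, hi⟩ := Finset.prod_eq_zero_iff.1 h0
    have hG : M.Supported fun i => {v | ∃ h : i ∈ M.IBP, v = x ⟨i, h⟩} := by
      rintro a ha j v ⟨hj, rfl⟩
      exact ⟨BPConfig.local M x ⟨a, ha⟩, rfl, fun k => ⟨M.mem_IBP ⟨a, ha⟩ k, rfl⟩,
        lt_of_le_of_ne (M.f_nonneg a ha _)
          (Finset.prod_ne_zero_iff.1 hne ⟨a, ha⟩ (Finset.mem_univ _)).symm⟩
    have : 0 < b.1 i.1 (x i) := by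
      rw [hvar i.1 i.2]
      exact mul_pos (hz i.1 i.2) (mul_pos (Finset.prod_pos fun a ha =>
        hpos _ hG a (Finset.mem_filter.1 ha).1 i.1 (Finset.mem_filter.1 ha).2 _ ⟨i.2, rfl⟩)
        (hg _ _))
    exact this.ne' hi
  · have hb0 : ∀ i : {i // i ∈ M.IBP}, b.1 i.1 (x i) ≠ 0 := fun i =>
      Finset.prod_ne_zero_iff.1 h0 i (Finset.mem_univ i)
    have hm0 : ∀ i : {i // i ∈ M.IBP}, ∏ a ∈ M.NBP i.1, m a i.1 (x i) ≠ 0 := fun i hi =>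
      hb0 i (by rw [hvar i.1 i.2, hi]; ring)
    have hr : ∀ a : {a // a ∈ M.bp}, M.ratio b a.1 x = κ a.1 * M.f a.1 (BPConfig.local M x a) /
        ∏ j : {j // j ∈ M.nbr a.1}, m a.1 j.1 (x ⟨j.1, M.mem_IBP a j⟩) := fun a => by
      simp only [ratio, a.2, dif_pos]
      rw [div_eq_div_iff]
      · exact hfac a (BPConfig.local M x a)
      · exact Finset.prod_ne_zero_iff.2 fun j _ => hb0 ⟨j.1, M.mem_IBP a j⟩
      · exact Finset.prod_ne_zero_iff.2 fun j _ => Finset.prod_ne_zero_iff.1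
          (hm0 ⟨j.1, M.mem_IBP a j⟩) a.1 (Finset.mem_filter.2 ⟨a.2, j.2⟩)
    rw [← Finset.prod_coe_sort M.bp]
    simp only [hr]
    rw [Finset.prod_div_distrib, M.prod_edges fun a i => m a i.1 (x i),
      Finset.prod_congr rfl fun i _ => hvar i.1 i.2 (x i), Finset.prod_mul_distrib,
      Finset.prod_mul_distrib, Finset.prod_mul_distrib, bpWeight]
    have := Finset.prod_ne_zero_iff.2 fun i (_ : i ∈ Finset.univ) => hm0 i
    field_simp

theorem bpPmf_eq (M : Model I A X) (m : (a : A) → (i : I) → X i → ℝ) :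
    M.bpPmf m = normalize (M.bpWeight fun i x => ∏ a ∈ M.NMF i, m a i x) := rfl

theorem IsReparametrization.marginals {M : Model I A X} {m : (a : A) → (i : I) → X i → ℝ}
    {b : M.Beliefs} (h : M.IsReparametrization (fun i x => ∏ a ∈ M.NMF i, m a i x) b)
    (hb : M.Feasible b) (hm : ∀ a i x, 0 < m a i x) (hc : M.bpGraph.IsAcyclic) :
    (∀ (i : {i // i ∈ M.IBP}) (v : X i.1), b.1 i.1 v =
      ∑ x : M.BPConfig with x i = v, M.bpPmf m x) ∧
    ∀ (a : {a // a ∈ M.bp}) (y : M.Loc a.1), b.2 a y =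
      ∑ x : M.BPConfig with BPConfig.local M x a = y, M.bpPmf m x := by
  obtain ⟨-, h1, h2⟩ := hb.joint_marginals hc
  rw [bpPmf_eq, h.normalize_bpWeight hb (fun i x => Finset.prod_pos fun a _ => hm a i x) hc]
  refine ⟨fun i v => ?_, fun a y => ?_⟩
  · rw [← h1 i v, prodExp, Finset.sum_filter]
    exact Finset.sum_congr rfl fun x _ => by split_ifs <;> ring
  · rw [← h2 a y, prodExp, Finset.sum_filter]
    exact Finset.sum_congr rfl fun x _ => by split_ifs <;> ring

end Model

/-! ### Relative entropy -/

theorem sq_sub_div_four_le {p q : ℝ} (hp : 0 ≤ p) (hp₁ : p ≤ 1) (hq : 0 ≤ q) (hq₁ : q ≤ 1)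
    (h : q = 0 → p = 0) : (p - q) ^ 2 / 4 ≤ p * Real.log (p / q) - p + q := by
  rcases hp.eq_or_lt with rfl | hp0
  · simp only [zero_mul]
    nlinarith
  · have hq0 : 0 < q := lt_of_le_of_ne hq fun h0 => hp0.ne' (h h0.symm)
    obtain ⟨a, ha, rfl⟩ : ∃ a, 0 < a ∧ a ^ 2 = p := ⟨√p, Real.sqrt_pos.2 hp0, Real.sq_sqrt hp⟩
    obtain ⟨b, hb, rfl⟩ : ∃ b, 0 < b ∧ b ^ 2 = q := ⟨√q, Real.sqrt_pos.2 hq0, Real.sq_sqrt hq⟩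
    have hlog : 1 - b / a ≤ Real.log (a / b) := by
      have := Real.one_sub_inv_le_log_of_pos (div_pos ha hb)
      rwa [inv_div] at this
    have hlog' : a ^ 2 * Real.log (a ^ 2 / b ^ 2) = 2 * (a ^ 2 * Real.log (a / b)) := by
      rw [← div_pow, Real.log_pow]
      push_cast
      ring
    have h1 : a ^ 2 - a * b ≤ a ^ 2 * Real.log (a / b) := by
      have := mul_le_mul_of_nonneg_left hlog (sq_nonneg a)
      have h2 : a ^ 2 * (1 - b / a) = a ^ 2 - a * b := by field_simp
      linarith
    have ha1 : a ≤ 1 := by nlinarith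
    have hb1 : b ≤ 1 := by nlinarith
    have h3 : (a ^ 2 - b ^ 2) ^ 2 / 4 ≤ (a - b) ^ 2 := by
      have h4 : (a ^ 2 - b ^ 2) ^ 2 = (a - b) ^ 2 * (a + b) ^ 2 := by ring
      have h5 : (a + b) ^ 2 ≤ 4 := by nlinarith
      rw [h4]
      nlinarith [sq_nonneg (a - b)]
    rw [hlog']
    nlinarith

/-- The relative entropy `∑ p ln (p / q)`. -/
def relEntropy {Y : Type*} [Fintype Y] (p q : Y → ℝ) : ℝ := ∑ y, p y * Real.log (p y / q y)

/-- A probability mass function. -/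
def IsPmf {Y : Type*} [Fintype Y] (p : Y → ℝ) : Prop := (∀ y, 0 ≤ p y) ∧ ∑ y, p y = 1

theorem IsPmf.le_one {Y : Type*} [Fintype Y] {p : Y → ℝ} (hp : IsPmf p) (y : Y) : p y ≤ 1 :=
  (Finset.single_le_sum (fun y _ => hp.1 y) (Finset.mem_univ y)).trans_eq hp.2

section

variable {Y : Type*} [Fintype Y] {p q : Y → ℝ}

theorem sum_sq_sub_le_relEntropy (hp : IsPmf p) (hq : IsPmf q) (h : ∀ y, q y = 0 → p y = 0) :
    ∑ y, (p y - q y) ^ 2 / 4 ≤ relEntropy p q := by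
  have : ∑ y, (p y * Real.log (p y / q y) - p y + q y) = relEntropy p q := by
    rw [Finset.sum_add_distrib, Finset.sum_sub_distrib, hp.2, hq.2, relEntropy]
    ring
  rw [← this]
  exact Finset.sum_le_sum fun y _ =>
    sq_sub_div_four_le (hp.1 y) (hp.le_one y) (hq.1 y) (hq.le_one y) (h y)

theorem sq_sub_le_relEntropy (hp : IsPmf p) (hq : IsPmf q) (h : ∀ y, q y = 0 → p y = 0) (y : Y) :
    (p y - q y) ^ 2 ≤ 4 * relEntropy p q := by
  have h1 := Finset.single_le_sum (f := fun y => (p y - q y) ^ 2 / 4) (fun y _ => by positivity)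
    (Finset.mem_univ y)
  have h2 := h1.trans (sum_sq_sub_le_relEntropy hp hq h)
  linarith

theorem relEntropy_nonneg (hp : IsPmf p) (hq : IsPmf q) (h : ∀ y, q y = 0 → p y = 0) :
    0 ≤ relEntropy p q :=
  (Finset.sum_nonneg fun y _ => by positivity).trans (sum_sq_sub_le_relEntropy hp hq h)

/-- The log-sum inequality. -/
theorem log_sum_le (s : Finset Y) (hp : ∀ y, 0 ≤ p y) (hq : ∀ y, 0 ≤ q y)
    (h : ∀ y, q y = 0 → p y = 0) :
    (∑ y ∈ s, p y) * Real.log ((∑ y ∈ s, p y) / ∑ y ∈ s, q y) ≤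
      ∑ y ∈ s, p y * Real.log (p y / q y) := by
  set P := ∑ y ∈ s, p y with hP
  set Q := ∑ y ∈ s, q y with hQ
  have hP0 : 0 ≤ P := Finset.sum_nonneg fun y _ => hp y
  have hQ0 : 0 ≤ Q := Finset.sum_nonneg fun y _ => hq y
  have key : ∀ y ∈ s, p y * Real.log (P / Q) + p y - q y * (P / Q) ≤
      p y * Real.log (p y / q y) := by
    intro y hy
    rcases (hp y).eq_or_lt with h0 | h0
    · rw [← h0]
      have := mul_nonneg (hq y) (div_nonneg hP0 hQ0)
      simp only [zero_mul]
      linarith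
    · have hq0 : 0 < q y := lt_of_le_of_ne (hq y) fun h1 => h0.ne' (h y h1.symm)
      have hPp : 0 < P := h0.trans_le (Finset.single_le_sum (fun y _ => hp y) hy)
      have hQp : 0 < Q := hq0.trans_le (Finset.single_le_sum (fun y _ => hq y) hy)
      have h1 := Real.one_sub_inv_le_log_of_pos (div_pos (div_pos h0 hq0) (div_pos hPp hQp))
      rw [Real.log_div (div_pos h0 hq0).ne' (div_pos hPp hQp).ne'] at h1
      have h2 := mul_le_mul_of_nonneg_left h1 h0.le
      have h3 : p y * (1 - (p y / q y / (P / Q))⁻¹) = p y - q y * (P / Q) := by field_simp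
      linarith
  have h1 := Finset.sum_le_sum key
  rw [Finset.sum_sub_distrib, Finset.sum_add_distrib, ← Finset.sum_mul, ← Finset.sum_mul, ← hP,
    ← hQ] at h1
  have h2 : Q * (P / Q) ≤ P := by
    by_cases hQz : Q = 0
    · simp [hQz, hP0]
    · rw [mul_div_cancel₀ _ hQz]
  linarith

end

namespace Model

/-- `c` vanishes wherever `b` does, in the beliefs of the factors. -/
def FacAC (M : Model I A X) (c b : M.Beliefs) : Prop := ∀ a y, b.2 a y = 0 → c.2 a y = 0

namespace Feasible

variable {M : Model I A X} {b c : M.Beliefs}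

theorem isPmf_var (hb : M.Feasible b) (i : I) : IsPmf (b.1 i) := ⟨hb.var_nonneg i, hb.sum_var i⟩

theorem isPmf_fac (hb : M.Feasible b) (a : {a // a ∈ M.bp}) : IsPmf (b.2 a) :=
  ⟨hb.fac_nonneg a, hb.fac_sum a⟩

theorem var_eq_zero (hc : M.Feasible c) (hb : M.Feasible b) (h : M.FacAC c b) {i : I}
    (hi : i ∈ M.IBP) (x : X i) (hx : b.1 i x = 0) : c.1 i x = 0 := by
  obtain ⟨a, ha, hia⟩ := Finset.mem_biUnion.1 hi
  rw [hb.marginal ⟨a, ha⟩ ⟨i, hia⟩, Finset.sum_eq_zero_iff_of_nonneg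
    fun y _ => hb.fac_nonneg _ y] at hx
  rw [hc.marginal ⟨a, ha⟩ ⟨i, hia⟩]
  exact Finset.sum_eq_zero fun y hy => h _ y (hx y hy)

theorem relEntropy_var_le (hc : M.Feasible c) (hb : M.Feasible b) (h : M.FacAC c b)
    (a : {a // a ∈ M.bp}) (i : {i // i ∈ M.nbr a.1}) :
    relEntropy (c.1 i.1) (b.1 i.1) ≤ relEntropy (c.2 a) (b.2 a) := by
  unfold relEntropy
  rw [← Finset.sum_fiberwise Finset.univ (fun y : M.Loc a.1 => y i)]
  refine Finset.sum_le_sum fun x _ => ?_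
  rw [hc.marginal a i x, hb.marginal a i x]
  exact log_sum_le _ (hc.fac_nonneg a) (hb.fac_nonneg a) (h a)

end Feasible

theorem sum_biUnion_nbr (M : Model I A X) (K : I → ℝ) :
    ∑ a ∈ M.bp, ∑ i ∈ M.nbr a, K i = ∑ i ∈ M.IBP, ((M.NBP i).card : ℝ) * K i := by
  rw [Finset.sum_comm' (t' := M.IBP) (s' := M.NBP)]
  · exact Finset.sum_congr rfl fun i _ => by rw [Finset.sum_const, nsmul_eq_mul]
  · intro a i
    simp only [IBP, NBP, Finset.mem_biUnion, Finset.mem_filter]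
    exact ⟨fun h => ⟨h, a, h⟩, fun h => h.1⟩

theorem forest_sum_bound (M : Model I A X) (hc : M.bpGraph.IsAcyclic) {KA : A → ℝ} {KI : I → ℝ}
    (hA : ∀ a ∈ M.bp, 0 ≤ KA a)
    (hIA : ∀ a ∈ M.bp, ∀ i ∈ M.nbr a, KI i ≤ KA a) :
    0 ≤ ∑ a ∈ M.bp, KA a - ∑ i ∈ M.IBP, (((M.NBP i).card : ℝ) - 1) * KI i ∧
    ∀ a ∈ M.bp, KA a ≤ M.bp.card *
      (∑ a ∈ M.bp, KA a - ∑ i ∈ M.IBP, (((M.NBP i).card : ℝ) - 1) * KI i) := by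
  have key := M.forest_induction (P := fun B => 0 ≤ ∑ i ∈ B.biUnion M.nbr, KI i +
      ∑ a ∈ B, (KA a - ∑ j ∈ M.nbr a, KI j) ∧ ∀ a ∈ B, KA a ≤ B.card *
        (∑ i ∈ B.biUnion M.nbr, KI i + ∑ a ∈ B, (KA a - ∑ j ∈ M.nbr a, KI j))) hc (by simp) ?_
  · have h1 : ∑ i ∈ M.bp.biUnion M.nbr, KI i + ∑ a ∈ M.bp, (KA a - ∑ j ∈ M.nbr a, KI j) =
        ∑ a ∈ M.bp, KA a - ∑ i ∈ M.IBP, (((M.NBP i).card : ℝ) - 1) * KI i := by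
      rw [Finset.sum_sub_distrib, M.sum_biUnion_nbr]
      simp only [sub_mul, one_mul, Finset.sum_sub_distrib]
      rw [IBP]
      ring
    rwa [h1] at key
  · intro a B haB hB hcard ⟨ih0, ih⟩
    have ha : a ∈ M.bp := hB (Finset.mem_insert_self a B)
    rw [Finset.sum_insert haB, Finset.biUnion_insert, Finset.card_insert_of_notMem haB]
    have hU := Finset.sum_union_inter (s₁ := M.nbr a) (s₂ := B.biUnion M.nbr) (f := KI)
    set T := ∑ i ∈ B.biUnion M.nbr, KI i + ∑ a ∈ B, (KA a - ∑ j ∈ M.nbr a, KI j) with hT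
    set D := ∑ i ∈ M.nbr a ∩ B.biUnion M.nbr, KI i with hD
    have hT' : ∑ i ∈ M.nbr a ∪ B.biUnion M.nbr, KI i +
        (KA a - ∑ j ∈ M.nbr a, KI j + ∑ a ∈ B, (KA a - ∑ j ∈ M.nbr a, KI j)) =
        T + (KA a - D) := by linarith
    rw [hT']
    have hDa : D ≤ KA a ∧ D ≤ B.card * T := by
      rcases (M.nbr a ∩ B.biUnion M.nbr).eq_empty_or_nonempty with h0 | ⟨j, hj⟩
      · rw [hD, h0, Finset.sum_empty]
        exact ⟨hA a ha, by positivity⟩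
      · have h1 : M.nbr a ∩ B.biUnion M.nbr = {j} := Finset.eq_singleton_iff_unique_mem.2
          ⟨hj, fun i hi => Finset.card_le_one.1 hcard i hi j hj⟩
        obtain ⟨hja, hjB⟩ := Finset.mem_inter.1 hj
        obtain ⟨c, hc, hjc⟩ := Finset.mem_biUnion.1 hjB
        rw [hD, h1, Finset.sum_singleton]
        exact ⟨hIA a ha j hja, (hIA c (hB (Finset.mem_insert_of_mem hc)) j hjc).trans (ih c hc)⟩
    have hstep : (B.card : ℝ) * T ≤ B.card * (T + (KA a - D)) :=
      mul_le_mul_of_nonneg_left (by linarith [hDa.1]) (Nat.cast_nonneg _)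
    push_cast
    refine ⟨by linarith [hDa.1], fun c hcB => ?_⟩
    rcases Finset.mem_insert.1 hcB with rfl | hcB
    · linarith [hDa.2]
    · linarith [ih c hcB, hDa.1]

/-- The difference of the values of the Bethe free energy at `c` and at its minimizer `b`. -/
def betheGap (M : Model I A X) (c b : M.Beliefs) : ℝ :=
  ∑ a, relEntropy (c.2 a) (b.2 a) -
    ∑ i ∈ M.IBP, (((M.NBP i).card : ℝ) - 1) * relEntropy (c.1 i) (b.1 i)

namespace Feasible

variable {M : Model I A X} {b c : M.Beliefs}

theorem betheGap_bound (hc : M.Feasible c) (hb : M.Feasible b) (h : M.FacAC c b)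
    (hac : M.bpGraph.IsAcyclic) :
    0 ≤ M.betheGap c b ∧
      ∀ a, relEntropy (c.2 a) (b.2 a) ≤ M.bp.card * M.betheGap c b := by
  have hA : ∀ a, 0 ≤ relEntropy (c.2 a) (b.2 a) := fun a =>
    relEntropy_nonneg (hc.isPmf_fac a) (hb.isPmf_fac a) (h a)
  obtain ⟨h1, h2⟩ := M.forest_sum_bound hac
    (KA := fun a => if ha : a ∈ M.bp then relEntropy (c.2 ⟨a, ha⟩) (b.2 ⟨a, ha⟩) else 0)
    (KI := fun i => relEntropy (c.1 i) (b.1 i)) (fun a ha => by simp only [ha, dif_pos, hA])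
    (fun a ha i hi => by
      simp only [ha, dif_pos]
      exact hc.relEntropy_var_le hb h ⟨a, ha⟩ ⟨i, hi⟩)
  have h3 : ∑ a ∈ M.bp,
      (if ha : a ∈ M.bp then relEntropy (c.2 ⟨a, ha⟩) (b.2 ⟨a, ha⟩) else 0) =
      ∑ a : {a // a ∈ M.bp}, relEntropy (c.2 a) (b.2 a) := by
    rw [← Finset.sum_coe_sort]
    exact Finset.sum_congr rfl fun a _ => by simp only [a.2, dif_pos]
  rw [h3] at h1 h2
  refine ⟨h1, fun a => ?_⟩
  have := h2 a.1 a.2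
  simp only [a.2, dif_pos] at this
  exact this

theorem sq_sub_fac_le (hc : M.Feasible c) (hb : M.Feasible b) (h : M.FacAC c b)
    (hac : M.bpGraph.IsAcyclic) (a : {a // a ∈ M.bp}) (y : M.Loc a.1) :
    (c.2 a y - b.2 a y) ^ 2 ≤ 4 * (M.bp.card * M.betheGap c b) :=
  (sq_sub_le_relEntropy (hc.isPmf_fac a) (hb.isPmf_fac a) (h a) y).trans
    (by linarith [(hc.betheGap_bound hb h hac).2 a])

theorem sq_sub_var_le (hc : M.Feasible c) (hb : M.Feasible b) (h : M.FacAC c b)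
    (hac : M.bpGraph.IsAcyclic) {i : I} (hi : i ∈ M.IBP) (x : X i) :
    (c.1 i x - b.1 i x) ^ 2 ≤ 4 * (M.bp.card * M.betheGap c b) := by
  obtain ⟨a, ha, hia⟩ := Finset.mem_biUnion.1 hi
  refine (sq_sub_le_relEntropy (hc.isPmf_var i) (hb.isPmf_var i)
    (hc.var_eq_zero hb h hi) x).trans ?_
  linarith [(hc.betheGap_bound hb h hac).2 ⟨a, ha⟩, hc.relEntropy_var_le hb h ⟨a, ha⟩ ⟨i, hia⟩]

theorem eq_of_betheGap_le_zero (hc : M.Feasible c) (hb : M.Feasible b) (h : M.FacAC c b)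
    (hac : M.bpGraph.IsAcyclic) (hoff : M.AgreeOffBP c b) (h0 : M.betheGap c b ≤ 0) : c = b := by
  have h0' : 4 * (M.bp.card * M.betheGap c b) ≤ 0 := by
    have := mul_nonneg (Nat.cast_nonneg (α := ℝ) M.bp.card) (neg_nonneg.2 h0)
    linarith
  have hz : ∀ u v : ℝ, (u - v) ^ 2 ≤ 0 → u = v := fun u v huv => sub_eq_zero.1
    (pow_eq_zero_iff two_ne_zero |>.1 (le_antisymm huv (sq_nonneg _)))
  refine Prod.ext (funext fun i => ?_) (funext fun a => funext fun y =>
    hz _ _ ((hc.sq_sub_fac_le hb h hac a y).trans h0'))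
  by_cases hi : i ∈ M.IBP
  · exact funext fun x => hz _ _ ((hc.sq_sub_var_le hb h hac hi x).trans h0')
  · exact hoff i (M.mem_IMF_sdiff_IBP.2 hi)

end Feasible

end Model

theorem ereal_coe_sum {Y : Type*} (s : Finset Y) (g : Y → ℝ) :
    ((∑ y ∈ s, g y : ℝ) : EReal) = ∑ y ∈ s, (g y : EReal) := by
  classical
  induction s using Finset.induction_on with
  | empty => simp
  | insert a s ha ih => rw [Finset.sum_insert ha, Finset.sum_insert ha, EReal.coe_add, ih]

theorem ereal_sum_ne_bot {Y : Type*} {s : Finset Y} {g : Y → EReal} (h : ∀ y ∈ s, g y ≠ ⊥) :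
    ∑ y ∈ s, g y ≠ ⊥ := by
  classical
  induction s using Finset.induction_on with
  | empty => simp
  | insert a s ha ih =>
    rw [Finset.sum_insert ha]
    exact EReal.add_ne_bot_iff.2 ⟨h a (Finset.mem_insert_self a s),
      ih fun y hy => h y (Finset.mem_insert_of_mem hy)⟩

theorem ereal_sum_eq_top {Y : Type*} {s : Finset Y} {g : Y → EReal} (h : ∀ y ∈ s, g y ≠ ⊥)
    {y : Y} (hy : y ∈ s) (hg : g y = ⊤) : ∑ y ∈ s, g y = ⊤ := by
  classical
  rw [← Finset.add_sum_erase _ _ hy, hg]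
  exact EReal.top_add_of_ne_bot (ereal_sum_ne_bot fun z hz => h z (Finset.mem_of_mem_erase hz))

theorem relEntropy_self {Y : Type*} [Fintype Y] (p : Y → ℝ) : relEntropy p p = 0 :=
  Finset.sum_eq_zero fun y _ => by by_cases h : p y = 0 <;> simp [h]

namespace Model

theorem klTerm_ne_bot (u v : ℝ) : klTerm u v ≠ ⊥ := by
  unfold klTerm
  split_ifs
  · exact top_ne_bot
  · exact EReal.coe_ne_bot _

/-! ### Real-valued free energies -/

/-- No configuration forbidden by a factor has positive belief. -/
def Dominated (M : Model I A X) (b : M.Beliefs) : Prop :=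
  ∀ (a : {a // a ∈ M.bp}) (y : M.Loc a.1), M.f a.1 y = 0 → b.2 a y ≤ 0

/-- The first term of the free energies. -/
def facEnergy (M : Model I A X) (b : M.Beliefs) : ℝ :=
  ∑ a : {a // a ∈ M.bp}, ∑ y : M.Loc a.1, b.2 a y * Real.log (b.2 a y / M.f a.1 y)

/-- The contribution of the factor `a` of the MF part to the free energy. -/
def mfEnergy (M : Model I A X) (b : M.Beliefs) (a : A) : ℝ :=
  ∑ y : M.Loc a, (∏ j, b.1 j.1 (y j)) * Real.log (M.f a y)

/-- The free energy of dominated beliefs. -/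
def freeEnergyReal (M : Model I A X) (b : M.Beliefs) : ℝ :=
  M.facEnergy b + (- ∑ a ∈ M.mf, M.mfEnergy b a
    - ∑ i, (((M.NBP i).card : ℝ) - 1) * ∑ x, b.1 i x * Real.log (b.1 i x))

/-- The Bethe free energy of dominated beliefs. -/
def betheReal (M : Model I A X) (m : (a : A) → (i : I) → X i → ℝ) (b : M.Beliefs) : ℝ :=
  M.facEnergy b +
    (- ∑ i ∈ M.IBP ∩ M.IMF, ∑ a ∈ M.NMF i, ∑ x, b.1 i x * Real.log (m a i x)
      - ∑ i ∈ M.IBP, (((M.NBP i).card : ℝ) - 1) * ∑ x, b.1 i x * Real.log (b.1 i x))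

theorem Dominated.sum_klTerm {M : Model I A X} {b : M.Beliefs} (h : M.Dominated b) :
    ∑ a : {a // a ∈ M.bp}, ∑ y : M.Loc a.1, klTerm (b.2 a y) (M.f a.1 y) =
      (M.facEnergy b : EReal) := by
  rw [facEnergy, ereal_coe_sum]
  refine Finset.sum_congr rfl fun a _ => ?_
  rw [ereal_coe_sum]
  refine Finset.sum_congr rfl fun y _ => ?_
  rw [klTerm, if_neg]
  exact fun h0 => (h a y h0.1).not_gt h0.2

theorem sum_klTerm_eq_top (M : Model I A X) {b : M.Beliefs} (h : ¬ M.Dominated b) :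
    ∑ a : {a // a ∈ M.bp}, ∑ y : M.Loc a.1, klTerm (b.2 a y) (M.f a.1 y) = ⊤ := by
  simp only [Dominated, not_forall, not_le] at h
  obtain ⟨a, y, h0, hpos⟩ := h
  refine ereal_sum_eq_top (fun a _ => ereal_sum_ne_bot fun y _ => klTerm_ne_bot _ _)
    (Finset.mem_univ a) (ereal_sum_eq_top (fun y _ => klTerm_ne_bot _ _) (Finset.mem_univ y) ?_)
  rw [klTerm, if_pos ⟨h0, hpos⟩]

theorem Dominated.freeEnergy_eq {M : Model I A X} {b : M.Beliefs} (h : M.Dominated b) :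
    M.freeEnergy b = (M.freeEnergyReal b : EReal) := by
  rw [freeEnergy, h.sum_klTerm, ← EReal.coe_add]
  rfl

theorem freeEnergy_eq_top (M : Model I A X) {b : M.Beliefs} (h : ¬ M.Dominated b) :
    M.freeEnergy b = ⊤ := by
  rw [freeEnergy, M.sum_klTerm_eq_top h, EReal.top_add_coe]

theorem Dominated.betheFreeEnergy_eq {M : Model I A X} {b : M.Beliefs} (h : M.Dominated b)
    (m : (a : A) → (i : I) → X i → ℝ) :
    M.betheFreeEnergy m b = (M.betheReal m b : EReal) := by
  rw [betheFreeEnergy, h.sum_klTerm, ← EReal.coe_add]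
  rfl

theorem betheFreeEnergy_eq_top (M : Model I A X) {b : M.Beliefs} (h : ¬ M.Dominated b)
    (m : (a : A) → (i : I) → X i → ℝ) : M.betheFreeEnergy m b = ⊤ := by
  rw [betheFreeEnergy, M.sum_klTerm_eq_top h, EReal.top_add_coe]

/-! ### The messages of the MF part -/

theorem log_mfMessagesOf (M : Model I A X) (b : M.Beliefs) (a : A) (i : {i // i ∈ M.nbr a})
    (x : X i.1) : Real.log (M.mfMessagesOf b a i.1 x) = ∑ y : M.Loc a with y i = x,
      (∏ j ∈ Finset.univ.erase i, b.1 j.1 (y j)) * Real.log (M.f a y) := by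
  have hfil : (Finset.univ.filter fun y : M.Loc a => ∀ h : i.1 ∈ M.nbr a, y ⟨i.1, h⟩ = x) =
      Finset.univ.filter fun y : M.Loc a => y i = x := by
    ext y
    simp [i.2]
  have : (Finset.univ.filter fun j : {j // j ∈ M.nbr a} => j.1 ≠ i.1) = Finset.univ.erase i := by
    ext j
    rw [Finset.mem_filter, Finset.mem_erase, ne_eq, ne_eq, Subtype.ext_iff, and_comm]
  rw [mfMessagesOf, mfMessage, Real.log_exp, hfil, this]

theorem mfMessagesOf_pos (M : Model I A X) (b : M.Beliefs) (a : A) (i : I) (x : X i) :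
    0 < M.mfMessagesOf b a i x := M.mfMessage_pos _ a i x

theorem mfEnergy_eq_sum_log (M : Model I A X) (b : M.Beliefs) (a : A) (i : {i // i ∈ M.nbr a}) :
    M.mfEnergy b a = ∑ x, b.1 i.1 x * Real.log (M.mfMessagesOf b a i.1 x) := by
  rw [mfEnergy, ← Finset.sum_fiberwise Finset.univ (fun y : M.Loc a => y i)]
  refine Finset.sum_congr rfl fun x _ => ?_
  rw [log_mfMessagesOf, Finset.mul_sum]
  refine Finset.sum_congr rfl fun y hy => ?_
  rw [← Finset.mul_prod_erase Finset.univ _ (Finset.mem_univ i), (Finset.mem_filter.1 hy).2]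
  ring

theorem mfMessage_congr (M : Model I A X) {n n' : (i : I) → A → X i → ℝ} {a : A} {i : I}
    (h : ∀ j ∈ M.nbr a, j ≠ i → n j a = n' j a) : M.mfMessage n a i = M.mfMessage n' a i := by
  funext x
  unfold mfMessage
  congr 1
  refine Finset.sum_congr rfl fun y _ => ?_
  congr 1
  refine Finset.prod_congr rfl fun j hj => ?_
  rw [h j.1 j.2 (Finset.mem_filter.1 hj).2]

theorem mfEnergy_congr (M : Model I A X) {b c : M.Beliefs} {a : A}
    (h : ∀ j ∈ M.nbr a, b.1 j = c.1 j) : M.mfEnergy b a = M.mfEnergy c a := by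
  refine Finset.sum_congr rfl fun y _ => ?_
  congr 1
  exact Finset.prod_congr rfl fun j _ => by rw [h j.1 j.2]

theorem AgreeOffBP.eq {M : Model I A X} {b c : M.Beliefs} (h : M.AgreeOffBP b c) {i : I}
    (hi : i ∉ M.IBP) : b.1 i = c.1 i := h i (M.mem_IMF_sdiff_IBP.2 hi)

theorem AgreeOffBP.mfMessagesOf_eq {M : Model I A X} {b c : M.Beliefs} (h : M.AgreeOffBP b c)
    (hone : ∀ a ∈ M.mf, (M.nbr a ∩ M.IBP).card ≤ 1) {a : A} (ha : a ∈ M.mf) {i : I}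
    (hi : i ∈ M.nbr a) (hiB : i ∈ M.IBP) : M.mfMessagesOf b a i = M.mfMessagesOf c a i :=
  M.mfMessage_congr fun j hj hji => h.eq fun hjB => hji <|
    Finset.card_le_one.1 (hone a ha) j (Finset.mem_inter.2 ⟨hj, hjB⟩) i
      (Finset.mem_inter.2 ⟨hi, hiB⟩)

theorem sum_mf_nbr_inter (M : Model I A X) (h : A → I → ℝ) :
    ∑ a ∈ M.mf, ∑ i ∈ M.nbr a ∩ M.IBP, h a i = ∑ i ∈ M.IBP ∩ M.IMF, ∑ a ∈ M.NMF i, h a i := by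
  refine Finset.sum_comm' fun a i => ?_
  simp only [IMF, NMF, Finset.mem_inter, Finset.mem_biUnion, Finset.mem_filter]
  exact ⟨fun h => ⟨⟨h.1, h.2.1⟩, h.2.2, a, h.1, h.2.1⟩, fun h => ⟨h.1.1, h.1.2, h.2.1⟩⟩

/-- The part of the free energy which depends only on the beliefs outside the BP part. -/
def offset (M : Model I A X) (b : M.Beliefs) : ℝ :=
  - (∑ a ∈ M.mf, if (M.nbr a ∩ M.IBP) = ∅ then M.mfEnergy b a else 0)
    - ∑ i ∈ M.IBPᶜ, (((M.NBP i).card : ℝ) - 1) * ∑ x, b.1 i x * Real.log (b.1 i x)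

theorem AgreeOffBP.freeEnergyReal_eq {M : Model I A X} {b c : M.Beliefs} (h : M.AgreeOffBP b c)
    (hone : ∀ a ∈ M.mf, (M.nbr a ∩ M.IBP).card ≤ 1) :
    M.freeEnergyReal c = M.betheReal (M.mfMessagesOf b) c + M.offset b := by
  have h1 : ∑ a ∈ M.mf, M.mfEnergy c a =
      (∑ i ∈ M.IBP ∩ M.IMF, ∑ a ∈ M.NMF i, ∑ x, c.1 i x * Real.log (M.mfMessagesOf b a i x)) +
        ∑ a ∈ M.mf, if (M.nbr a ∩ M.IBP) = ∅ then M.mfEnergy b a else 0 := by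
    rw [← M.sum_mf_nbr_inter fun a i => ∑ x, c.1 i x * Real.log (M.mfMessagesOf b a i x),
      ← Finset.sum_add_distrib]
    refine Finset.sum_congr rfl fun a ha => ?_
    rcases (M.nbr a ∩ M.IBP).eq_empty_or_nonempty with h0 | ⟨i, hi⟩
    · rw [if_pos h0, h0, Finset.sum_empty, zero_add]
      refine M.mfEnergy_congr fun j hj => (h.eq fun hjB => ?_).symm
      have := Finset.mem_inter.2 ⟨hj, hjB⟩
      simp [h0] at this
    · have h1 : M.nbr a ∩ M.IBP = {i} := Finset.eq_singleton_iff_unique_mem.2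
        ⟨hi, fun j hj => Finset.card_le_one.1 (hone a ha) j hj i hi⟩
      obtain ⟨hia, hiB⟩ := Finset.mem_inter.1 hi
      rw [if_neg (Finset.ne_empty_of_mem hi), h1, Finset.sum_singleton, add_zero,
        h.mfMessagesOf_eq hone ha hia hiB, M.mfEnergy_eq_sum_log c a ⟨i, hia⟩]
  have h2 : ∑ i, (((M.NBP i).card : ℝ) - 1) * ∑ x, c.1 i x * Real.log (c.1 i x) =
      ∑ i ∈ M.IBP, (((M.NBP i).card : ℝ) - 1) * (∑ x, c.1 i x * Real.log (c.1 i x)) +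
      ∑ i ∈ M.IBPᶜ, (((M.NBP i).card : ℝ) - 1) * ∑ x, b.1 i x * Real.log (b.1 i x) := by
    rw [← Finset.sum_add_sum_compl M.IBP]
    congr 1
    exact Finset.sum_congr rfl fun i hi => by rw [h.eq (Finset.mem_compl.1 hi)]
  rw [freeEnergyReal, h1, h2, betheReal, offset]
  ring

/-! ### The Bethe free energy and its minimizer -/

theorem Feasible.supported {M : Model I A X} {c : M.Beliefs} (hc : M.Feasible c)
    (hd : M.Dominated c) : M.Supported fun i => {x | 0 < c.1 i x} := by
  intro a ha i x hx
  rw [Set.mem_ofPred_eq, hc.marginal ⟨a, ha⟩ i x] at hx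
  obtain ⟨y, hy, hy0⟩ := Finset.exists_ne_zero_of_sum_ne_zero hx.ne'
  have hpos : 0 < c.2 ⟨a, ha⟩ y := lt_of_le_of_ne (hc.fac_nonneg _ y) (Ne.symm hy0)
  exact ⟨y, (Finset.mem_filter.1 hy).2, fun j => hpos.trans_le (hc.fac_le_var ⟨a, ha⟩ y j),
    lt_of_le_of_ne (M.f_nonneg a ha y) fun h0 => (hd ⟨a, ha⟩ y h0.symm).not_gt hpos⟩

section Reparametrization

variable {M : Model I A X} {g : (i : I) → X i → ℝ} {b c : M.Beliefs}

theorem IsReparametrization.facAC (h : M.IsReparametrization g b) (hg : ∀ i x, 0 < g i x)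
    (hc : M.Feasible c) (hd : M.Dominated c) : M.FacAC c b := by
  obtain ⟨m, κ, z, hκ, hz, hfac, hvar, hpos⟩ := h
  intro a y hy
  by_contra hne
  have hcy : 0 < c.2 a y := lt_of_le_of_ne (hc.fac_nonneg a y) (Ne.symm hne)
  have hf : 0 < M.f a.1 y := lt_of_le_of_ne (M.f_nonneg a.1 a.2 y) fun h0 =>
    (hd a y h0.symm).not_gt hcy
  have hb : 0 < ∏ j : {j // j ∈ M.nbr a.1}, b.1 j.1 (y j) := Finset.prod_pos fun j _ => by
    rw [hvar j.1 (M.mem_IBP a j)]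
    exact mul_pos (hz _ (M.mem_IBP a j)) (mul_pos (Finset.prod_pos fun c' hc' =>
      hpos _ (hc.supported hd) c' (Finset.mem_filter.1 hc').1 j.1 (Finset.mem_filter.1 hc').2 _
        (hcy.trans_le (hc.fac_le_var a y j))) (hg _ _))
  have := hfac a y
  rw [hy, zero_mul] at this
  exact (mul_pos (mul_pos (hκ a.1 a.2) hf) hb).ne this

theorem IsReparametrization.dominated (h : M.IsReparametrization g b) (hb : M.Feasible b) :
    M.Dominated b := by
  obtain ⟨m, κ, z, hκ, hz, hfac, hvar, hpos⟩ := h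
  intro a y hy
  by_contra! hne
  have h1 := hfac a y
  rw [hy, mul_zero, zero_mul] at h1
  have h2 := (mul_eq_zero.1 h1).resolve_left hne.ne'
  obtain ⟨j, -, hj⟩ := Finset.prod_eq_zero_iff.1 h2
  have h3 := hvar j.1 (M.mem_IBP a j) (y j)
  rw [Finset.prod_eq_zero (show a.1 ∈ M.NBP j.1 from Finset.mem_filter.2 ⟨a.2, j.2⟩) hj,
    zero_mul, mul_zero] at h3
  linarith [hb.fac_le_var a y j]

theorem IsReparametrization.exists_facEnergy_eq (h : M.IsReparametrization g b)
    (hb : M.Feasible b) (hg : ∀ i x, 0 < g i x) : ∃ K : ℝ, ∀ c, M.Feasible c → M.Dominated c →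
    M.facEnergy c - ∑ i ∈ M.IBP, ∑ x, c.1 i x * Real.log (g i x)
      - ∑ i ∈ M.IBP, (((M.NBP i).card : ℝ) - 1) * ∑ x, c.1 i x * Real.log (c.1 i x) =
    M.betheGap c b + K := by
  have hr := h
  obtain ⟨m, κ, z, hκ, hz, hfac, hvar, hpos⟩ := h
  refine ⟨∑ a : {a // a ∈ M.bp}, Real.log (κ a.1) + ∑ i ∈ M.IBP, Real.log (z i),
    fun c hc hd => ?_⟩
  have hac := hr.facAC hg hc hd
  have hmpos := hpos _ (hc.supported hd)
  have hbpos : ∀ i ∈ M.IBP, ∀ x, 0 < c.1 i x → 0 < b.1 i x := fun i hi x hx =>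
    lt_of_le_of_ne (hb.var_nonneg i x) fun h0 => hx.ne' (hc.var_eq_zero hb hac hi x h0.symm)
  have hA : ∀ a : {a // a ∈ M.bp}, relEntropy (c.2 a) (b.2 a) =
      ∑ y : M.Loc a.1, c.2 a y * Real.log (c.2 a y / M.f a.1 y) - Real.log (κ a.1) -
        ∑ j : {j // j ∈ M.nbr a.1}, ∑ x, c.1 j.1 x *
          (Real.log (b.1 j.1 x) - Real.log (m a.1 j.1 x)) := fun a => by
    have h1 : Real.log (κ a.1) = ∑ y, c.2 a y * Real.log (κ a.1) := by
      rw [← Finset.sum_mul, hc.fac_sum, one_mul]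
    rw [Finset.sum_congr rfl fun j _ => (hc.sum_fac_mul a j fun x =>
      (Real.log (b.1 j.1 x) - Real.log (m a.1 j.1 x))).symm, Finset.sum_comm, h1,
      ← Finset.sum_sub_distrib, ← Finset.sum_sub_distrib]
    refine Finset.sum_congr rfl fun y _ => ?_
    rcases (hc.fac_nonneg a y).eq_or_lt with h0 | h0
    · simp [← h0]
    · have hcj : ∀ j : {j // j ∈ M.nbr a.1}, 0 < c.1 j.1 (y j) := fun j =>
        h0.trans_le (hc.fac_le_var a y j)
      have hf : M.f a.1 y ≠ 0 := fun hf => (hd a y hf).not_gt h0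
      have hby : b.2 a y ≠ 0 := fun hby => h0.ne' (hac a y hby)
      have hm : ∏ j : {j // j ∈ M.nbr a.1}, m a.1 j.1 (y j) ≠ 0 := Finset.prod_ne_zero_iff.2
        fun j _ => (hmpos a.1 a.2 j.1 j.2 _ (hcj j)).ne'
      have hbj : ∏ j : {j // j ∈ M.nbr a.1}, b.1 j.1 (y j) ≠ 0 := Finset.prod_ne_zero_iff.2
        fun j _ => (hbpos j.1 (M.mem_IBP a j) _ (hcj j)).ne'
      have hlog := congrArg Real.log (hfac a y)
      rw [Real.log_mul hby hm, Real.log_mul (mul_ne_zero (hκ a.1 a.2).ne' hf) hbj,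
        Real.log_mul (hκ a.1 a.2).ne' hf, Real.log_prod (Finset.prod_ne_zero_iff.1 hm),
        Real.log_prod (Finset.prod_ne_zero_iff.1 hbj)] at hlog
      rw [← Finset.mul_sum, Finset.sum_sub_distrib, Real.log_div h0.ne' hby,
        Real.log_div h0.ne' hf]
      linear_combination (-c.2 a y) * hlog
  have hI : ∀ i ∈ M.IBP, ∑ a ∈ M.NBP i, ∑ x, c.1 i x *
      (Real.log (b.1 i x) - Real.log (m a i x)) =
      (((M.NBP i).card : ℝ) - 1) * (∑ x, c.1 i x * Real.log (b.1 i x)) + Real.log (z i) +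
        ∑ x, c.1 i x * Real.log (g i x) := fun i hi => by
    have h1 : Real.log (z i) = ∑ x, c.1 i x * Real.log (z i) := by
      rw [← Finset.sum_mul, hc.sum_var, one_mul]
    rw [h1, Finset.sum_comm, Finset.mul_sum, ← Finset.sum_add_distrib, ← Finset.sum_add_distrib]
    refine Finset.sum_congr rfl fun x _ => ?_
    rw [← Finset.mul_sum, Finset.sum_sub_distrib, Finset.sum_const, nsmul_eq_mul]
    rcases (hc.var_nonneg i x).eq_or_lt with h0 | h0
    · simp [← h0]
    · have hm : ∏ a ∈ M.NBP i, m a i x ≠ 0 := Finset.prod_ne_zero_iff.2 fun a ha =>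
        (hmpos a (Finset.mem_filter.1 ha).1 i (Finset.mem_filter.1 ha).2 x h0).ne'
      have hlog := congrArg Real.log (hvar i hi x)
      rw [Real.log_mul (hz i hi).ne' (mul_ne_zero hm (hg i x).ne'),
        Real.log_mul hm (hg i x).ne', Real.log_prod (Finset.prod_ne_zero_iff.1 hm)] at hlog
      linear_combination c.1 i x * hlog
  have hE : ∀ i ∈ M.IBP, relEntropy (c.1 i) (b.1 i) =
      ∑ x, c.1 i x * Real.log (c.1 i x) - ∑ x, c.1 i x * Real.log (b.1 i x) := fun i hi => by
    rw [← Finset.sum_sub_distrib]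
    refine Finset.sum_congr rfl fun x _ => ?_
    rcases (hc.var_nonneg i x).eq_or_lt with h0 | h0
    · simp [← h0]
    · rw [Real.log_div h0.ne' (hbpos i hi x h0).ne']
      ring
  have hedge := M.sum_edges fun a (i : {i // i ∈ M.IBP}) => ∑ x, c.1 i.1 x *
    (Real.log (b.1 i.1 x) - Real.log (m a i.1 x))
  rw [Finset.sum_coe_sort M.IBP fun i => ∑ a ∈ M.NBP i, ∑ x, c.1 i x *
    (Real.log (b.1 i x) - Real.log (m a i x)), Finset.sum_congr rfl hI] at hedge
  rw [betheGap, Finset.sum_congr rfl fun a _ => hA a,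
    Finset.sum_congr rfl fun i hi => congrArg _ (hE i hi), Finset.sum_sub_distrib,
    Finset.sum_sub_distrib, hedge]
  simp only [mul_sub, Finset.sum_sub_distrib, Finset.sum_add_distrib]
  rw [facEnergy]
  ring

end Reparametrization

theorem betheGap_self (M : Model I A X) (b : M.Beliefs) : M.betheGap b b = 0 := by
  simp only [betheGap, relEntropy_self, mul_zero, Finset.sum_const_zero, sub_zero]

theorem IsReparametrization.betheReal_eq {M : Model I A X} {m : (a : A) → (i : I) → X i → ℝ}
    {b : M.Beliefs} (h : M.IsReparametrization (fun i x => ∏ a ∈ M.NMF i, m a i x) b)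
    (hb : M.Feasible b) (hm : ∀ a i x, 0 < m a i x) {c : M.Beliefs} (hc : M.Feasible c)
    (hd : M.Dominated c) : M.betheReal m c = M.betheGap c b + M.betheReal m b := by
  have hg : ∀ i x, 0 < ∏ a ∈ M.NMF i, m a i x := fun i x => Finset.prod_pos fun a _ => hm a i x
  obtain ⟨K, hK⟩ := h.exists_facEnergy_eq hb hg
  have key : ∀ c, M.Feasible c → M.Dominated c → M.betheReal m c = M.betheGap c b + K := by
    intro c hc hd
    rw [← hK c hc hd, betheReal]
    have : ∑ i ∈ M.IBP, ∑ x, c.1 i x * Real.log (∏ a ∈ M.NMF i, m a i x) =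
        ∑ i ∈ M.IBP ∩ M.IMF, ∑ a ∈ M.NMF i, ∑ x, c.1 i x * Real.log (m a i x) := by
      have h1 : ∀ i, ∑ x, c.1 i x * Real.log (∏ a ∈ M.NMF i, m a i x) =
          ∑ a ∈ M.NMF i, ∑ x, c.1 i x * Real.log (m a i x) := fun i => by
        rw [Finset.sum_comm]
        refine Finset.sum_congr rfl fun x _ => ?_
        rw [Real.log_prod fun a _ => (hm a i x).ne', Finset.mul_sum]
      rw [Finset.sum_congr rfl fun i _ => h1 i]
      symm
      refine Finset.sum_subset Finset.inter_subset_left fun i hi hi' => ?_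
      refine Finset.sum_eq_zero fun a ha => (hi' (Finset.mem_inter.2 ⟨hi, ?_⟩)).elim
      exact Finset.mem_biUnion.2 ⟨a, (Finset.mem_filter.1 ha).1, (Finset.mem_filter.1 ha).2⟩
    rw [this]
    ring
  rw [key c hc hd, key b hb (h.dominated hb), betheGap_self]
  ring

/-! ### The BP step -/

section BPStep

variable {M : Model I A X} {S : List M.MsgName} {ω : A → I → ℝ}

theorem feasible_bpStep (hS : M.IsForwardBackward S) (hω : ∀ a i, 0 < ω a i) {b : M.Beliefs}
    (hb : M.MFNormalized b) : M.Feasible (M.bpStep S ω b) :=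
  (M.isBPMessages_passMessages hS hω (M.mfMessagesOf_pos b)).feasible_beliefsOf hω hb

theorem agreeOffBP_bpStep (b : M.Beliefs) : M.AgreeOffBP b (M.bpStep S ω b) :=
  IsBPMessages.agreeOffBP_beliefsOf M _ _ b

theorem isReparametrization_bpStep (hS : M.IsForwardBackward S) (hω : ∀ a i, 0 < ω a i)
    (b : M.Beliefs) : M.IsReparametrization
      (fun i x => ∏ a ∈ M.NMF i, M.mfMessagesOf b a i x) (M.bpStep S ω b) :=
  (M.isBPMessages_passMessages hS hω (M.mfMessagesOf_pos b)).isReparametrization_beliefsOf hω b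

theorem dominated_bpStep (hS : M.IsForwardBackward S) (hω : ∀ a i, 0 < ω a i) {b : M.Beliefs}
    (hb : M.MFNormalized b) : M.Dominated (M.bpStep S ω b) :=
  (isReparametrization_bpStep hS hω b).dominated (feasible_bpStep hS hω hb)

theorem facAC_bpStep (hS : M.IsForwardBackward S) (hω : ∀ a i, 0 < ω a i) (b : M.Beliefs)
    {c : M.Beliefs} (hc : M.Feasible c) (hd : M.Dominated c) : M.FacAC c (M.bpStep S ω b) :=
  (isReparametrization_bpStep hS hω b).facAC
    (fun i x => Finset.prod_pos fun a _ => M.mfMessagesOf_pos b a i x) hc hd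

theorem marginals_bpStep (hS : M.IsForwardBackward S) (hω : ∀ a i, 0 < ω a i) {b : M.Beliefs}
    (hb : M.MFNormalized b) (hac : M.bpGraph.IsAcyclic) :
    (∀ (i : {i // i ∈ M.IBP}) (v : X i.1), (M.bpStep S ω b).1 i.1 v =
      ∑ x : M.BPConfig with x i = v, M.bpPmf (M.mfMessagesOf b) x) ∧
    ∀ (a : {a // a ∈ M.bp}) (y : M.Loc a.1), (M.bpStep S ω b).2 a y =
      ∑ x : M.BPConfig with BPConfig.local M x a = y, M.bpPmf (M.mfMessagesOf b) x :=
  (isReparametrization_bpStep hS hω b).marginals (feasible_bpStep hS hω hb)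
    (M.mfMessagesOf_pos b) hac

theorem betheReal_eq_bpStep (hS : M.IsForwardBackward S) (hω : ∀ a i, 0 < ω a i) {b : M.Beliefs}
    (hb : M.MFNormalized b) {c : M.Beliefs} (hc : M.Feasible c) (hd : M.Dominated c) :
    M.betheReal (M.mfMessagesOf b) c =
      M.betheGap c (M.bpStep S ω b) + M.betheReal (M.mfMessagesOf b) (M.bpStep S ω b) :=
  (isReparametrization_bpStep hS hω b).betheReal_eq (feasible_bpStep hS hω hb)
    (M.mfMessagesOf_pos b) hc hd

theorem freeEnergyReal_eq_bpStep (hS : M.IsForwardBackward S) (hω : ∀ a i, 0 < ω a i)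
    (hone : ∀ a ∈ M.mf, (M.nbr a ∩ M.IBP).card ≤ 1) {b : M.Beliefs} (hb : M.MFNormalized b)
    {c : M.Beliefs} (hc : M.Feasible c) (hd : M.Dominated c) (hbc : M.AgreeOffBP b c) :
    M.freeEnergyReal c =
      M.betheGap c (M.bpStep S ω b) + M.freeEnergyReal (M.bpStep S ω b) := by
  rw [hbc.freeEnergyReal_eq hone, (agreeOffBP_bpStep b).freeEnergyReal_eq hone,
    betheReal_eq_bpStep hS hω hb hc hd]
  ring

theorem bpStep_minimizes (hS : M.IsForwardBackward S) (hω : ∀ a i, 0 < ω a i)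
    (hac : M.bpGraph.IsAcyclic) (hone : ∀ a ∈ M.mf, (M.nbr a ∩ M.IBP).card ≤ 1) {b : M.Beliefs}
    (hb : M.MFNormalized b) {c : M.Beliefs} (hc : M.Feasible c) (hbc : M.AgreeOffBP b c) :
    M.betheFreeEnergy (M.mfMessagesOf b) (M.bpStep S ω b) ≤
      M.betheFreeEnergy (M.mfMessagesOf b) c ∧
    (M.betheFreeEnergy (M.mfMessagesOf b) c =
      M.betheFreeEnergy (M.mfMessagesOf b) (M.bpStep S ω b) → c = M.bpStep S ω b) ∧
    M.freeEnergy (M.bpStep S ω b) ≤ M.freeEnergy c ∧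
    (M.freeEnergy c = M.freeEnergy (M.bpStep S ω b) → c = M.bpStep S ω b) := by
  have hd' := dominated_bpStep hS hω hb
  have hf' := feasible_bpStep hS hω hb
  rw [hd'.betheFreeEnergy_eq, hd'.freeEnergy_eq]
  by_cases hd : M.Dominated c
  · have hoff : M.AgreeOffBP c (M.bpStep S ω b) := fun i hi =>
      (hbc i hi).symm.trans (agreeOffBP_bpStep b i hi)
    have hfac := facAC_bpStep hS hω b hc hd
    have hgap := (hc.betheGap_bound hf' hfac hac).1
    have huniq := hc.eq_of_betheGap_le_zero hf' hfac hac hoff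
    rw [hd.betheFreeEnergy_eq, hd.freeEnergy_eq, betheReal_eq_bpStep hS hω hb hc hd,
      freeEnergyReal_eq_bpStep hS hω hone hb hc hd hbc]
    simp only [EReal.coe_le_coe_iff, EReal.coe_eq_coe_iff]
    exact ⟨by linarith, fun h => huniq (by linarith), by linarith, fun h => huniq (by linarith)⟩
  · rw [M.betheFreeEnergy_eq_top hd, M.freeEnergy_eq_top hd]
    exact ⟨le_top, fun h => (EReal.coe_ne_top _ h.symm).elim, le_top,
      fun h => (EReal.coe_ne_top _ h.symm).elim⟩

end BPStep

/-! ### Partial derivatives -/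

theorem setVar_apply (M : Model I A X) (c : M.Beliefs) (i : I) (x : X i) (i' : I) (x' : X i') :
    (∀ s, (M.setVar c i x s).1 i' x' = c.1 i' x') ∨
      c.1 i' x' = c.1 i x ∧ ∀ s, (M.setVar c i x s).1 i' x' = s := by
  by_cases hi : i' = i
  · subst hi
    by_cases hx : x' = x
    · subst hx
      exact Or.inr ⟨rfl, fun s => by simp [setVar]⟩
    · exact Or.inl fun s => by simp [setVar, hx]
  · exact Or.inl fun s => by simp [setVar, hi]

theorem setFac_apply (M : Model I A X) (c : M.Beliefs) (a : {a // a ∈ M.bp}) (y : M.Loc a.1)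
    (a' : {a // a ∈ M.bp}) (y' : M.Loc a'.1) :
    (∀ s, (M.setFac c a y s).2 a' y' = c.2 a' y') ∨
      (c.2 a' y' = c.2 a y ∧ M.f a'.1 y' = M.f a.1 y ∧ ∀ s, (M.setFac c a y s).2 a' y' = s) := by
  by_cases ha : a' = a
  · subst ha
    by_cases hy : y' = y
    · subst hy
      exact Or.inr ⟨rfl, rfl, fun s => by simp [setFac]⟩
    · exact Or.inl fun s => by simp [setFac, hy]
  · exact Or.inl fun s => by simp [setFac, ha]

theorem setFac_fst (M : Model I A X) (c : M.Beliefs) (a : {a // a ∈ M.bp}) (y : M.Loc a.1)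
    (s : ℝ) : (M.setFac c a y s).1 = c.1 := rfl

theorem differentiableAt_betheReal_setVar (M : Model I A X) (m : (a : A) → (i : I) → X i → ℝ)
    {c : M.Beliefs} {i : I} {x : X i} (hx : 0 < c.1 i x) :
    DifferentiableAt ℝ (fun s => M.betheReal m (M.setVar c i x s)) (c.1 i x) := by
  have h1 : ∀ i' x', DifferentiableAt ℝ (fun s => (M.setVar c i x s).1 i' x') (c.1 i x) := by
    intro i' x'
    rcases M.setVar_apply c i x i' x' with h | ⟨-, h⟩ <;> simp only [h] <;> fun_prop
  have h2 : ∀ i' x', DifferentiableAt ℝ (fun s => (M.setVar c i x s).1 i' x' *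
      Real.log ((M.setVar c i x s).1 i' x')) (c.1 i x) := by
    intro i' x'
    rcases M.setVar_apply c i x i' x' with h | ⟨-, h⟩ <;> simp only [h]
    · fun_prop
    · exact differentiableAt_id.mul (Real.differentiableAt_log hx.ne')
  unfold betheReal
  refine (differentiableAt_const (M.facEnergy c)).add (DifferentiableAt.sub
    (DifferentiableAt.fun_neg (DifferentiableAt.fun_sum fun i' _ =>
      DifferentiableAt.fun_sum fun a _ => DifferentiableAt.fun_sum fun x' _ => (h1 i' x').mul_const _)) ?_)
  exact DifferentiableAt.fun_sum fun i' _ => DifferentiableAt.const_mul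
    (DifferentiableAt.fun_sum fun x' _ => h2 i' x') _

theorem differentiableAt_betheReal_setFac (M : Model I A X) (m : (a : A) → (i : I) → X i → ℝ)
    {c : M.Beliefs} {a : {a // a ∈ M.bp}} {y : M.Loc a.1} (hy : 0 < c.2 a y)
    (hf : M.f a.1 y ≠ 0) :
    DifferentiableAt ℝ (fun s => M.betheReal m (M.setFac c a y s)) (c.2 a y) := by
  unfold betheReal
  simp only [setFac_fst]
  refine DifferentiableAt.add (DifferentiableAt.fun_sum fun a' _ =>
    DifferentiableAt.fun_sum fun y' _ => ?_)
    (differentiableAt_const _)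
  rcases M.setFac_apply c a y a' y' with h | ⟨-, hf', h⟩ <;> simp only [h]
  · fun_prop
  · rw [hf']
    exact differentiableAt_id.mul ((differentiableAt_id.div_const _).log (div_ne_zero hy.ne' hf))

theorem hasDerivAt_freeEnergy_of_line {M : Model I A X}
    (hone : ∀ a ∈ M.mf, (M.nbr a ∩ M.IBP).card ≤ 1) {b : M.Beliefs} {γ : ℝ → M.Beliefs} {s₀ : ℝ}
    (hγ : ∀ s, M.AgreeOffBP b (γ s)) (hd : ∀ s, M.Dominated (γ s))
    (hdiff : DifferentiableAt ℝ (fun s => M.betheReal (M.mfMessagesOf b) (γ s)) s₀) :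
    ∃ d : ℝ, HasDerivAt (fun s => (M.freeEnergy (γ s)).toReal) d s₀ ∧
      HasDerivAt (fun s => (M.betheFreeEnergy (M.mfMessagesOf b) (γ s)).toReal) d s₀ := by
  refine ⟨deriv (fun s => M.betheReal (M.mfMessagesOf b) (γ s)) s₀, ?_, ?_⟩
  · simp only [fun s => (hd s).freeEnergy_eq, EReal.toReal_coe,
      fun s => (hγ s).freeEnergyReal_eq hone]
    exact hdiff.hasDerivAt.add_const _
  · simp only [fun s => (hd s).betheFreeEnergy_eq (M.mfMessagesOf b), EReal.toReal_coe]
    exact hdiff.hasDerivAt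

theorem dominated_of_freeEnergy_ne_top (M : Model I A X) {c : M.Beliefs}
    (h : M.freeEnergy c ≠ ⊤) : M.Dominated c :=
  not_not.1 fun hd => h (M.freeEnergy_eq_top hd)

theorem exists_hasDerivAt_setVar {M : Model I A X}
    (hone : ∀ a ∈ M.mf, (M.nbr a ∩ M.IBP).card ≤ 1) {b c : M.Beliefs} (hbc : M.AgreeOffBP b c)
    (hd : M.Dominated c) {i : I} (hi : i ∈ M.IBP) {x : X i} (hx : 0 < c.1 i x) :
    ∃ d : ℝ, HasDerivAt (fun s => (M.freeEnergy (M.setVar c i x s)).toReal) d (c.1 i x) ∧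
      HasDerivAt (fun s => (M.betheFreeEnergy (M.mfMessagesOf b) (M.setVar c i x s)).toReal)
        d (c.1 i x) := by
  refine hasDerivAt_freeEnergy_of_line hone (fun s j hj => ?_) (fun s => hd)
    (M.differentiableAt_betheReal_setVar _ hx)
  have : j ≠ i := fun h => (M.mem_IMF_sdiff_IBP.1 hj) (h ▸ hi)
  rw [hbc j hj]
  simp [setVar, this]

theorem exists_hasDerivAt_setFac {M : Model I A X}
    (hone : ∀ a ∈ M.mf, (M.nbr a ∩ M.IBP).card ≤ 1) {b c : M.Beliefs} (hbc : M.AgreeOffBP b c)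
    (hd : M.Dominated c) {a : {a // a ∈ M.bp}} {y : M.Loc a.1} (hy : 0 < c.2 a y) :
    ∃ d : ℝ, HasDerivAt (fun s => (M.freeEnergy (M.setFac c a y s)).toReal) d (c.2 a y) ∧
      HasDerivAt (fun s => (M.betheFreeEnergy (M.mfMessagesOf b) (M.setFac c a y s)).toReal)
        d (c.2 a y) := by
  have hf : M.f a.1 y ≠ 0 := fun hf => (hd a y hf).not_gt hy
  refine hasDerivAt_freeEnergy_of_line hone (fun s => hbc) (fun s a' y' h0 => ?_)
    (M.differentiableAt_betheReal_setFac _ hy hf)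
  rcases M.setFac_apply c a y a' y' with h | ⟨-, hf', -⟩
  · rw [h]
    exact hd a' y' h0
  · exact (hf (hf' ▸ h0)).elim

/-! ### Updates in the MF part -/

/-- The new belief of the MF update at `i`. -/
def mfBelief (M : Model I A X) (b : M.Beliefs) (i : I) : X i → ℝ :=
  normalize fun x => ∏ a ∈ M.NMF i, M.mfMessagesOf b a i x

theorem mfUpdate_eq (M : Model I A X) (b : M.Beliefs) (i : I) :
    M.mfUpdate b i = (Function.update b.1 i (M.mfBelief b i), b.2) := rfl

theorem sum_prod_mfMessagesOf_pos (M : Model I A X) (b : M.Beliefs) (i : I) :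
    0 < ∑ x, ∏ a ∈ M.NMF i, M.mfMessagesOf b a i x := by
  obtain ⟨x, -⟩ := M.exists_config_pos
  exact Finset.sum_pos (fun x _ => Finset.prod_pos fun a _ => M.mfMessagesOf_pos b a i x)
    ⟨x i, Finset.mem_univ _⟩

theorem mfBelief_pos (M : Model I A X) (b : M.Beliefs) (i : I) (x : X i) :
    0 < M.mfBelief b i x :=
  div_pos (Finset.prod_pos fun a _ => M.mfMessagesOf_pos b a i x) (M.sum_prod_mfMessagesOf_pos b i)

theorem isPmf_mfBelief (M : Model I A X) (b : M.Beliefs) (i : I) : IsPmf (M.mfBelief b i) :=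
  ⟨fun x => (M.mfBelief_pos b i x).le, sum_normalize (M.sum_prod_mfMessagesOf_pos b i).ne'⟩

theorem Feasible.update {M : Model I A X} {b : M.Beliefs} (hb : M.Feasible b) {i : I}
    (hi : i ∉ M.IBP) {q : X i → ℝ} (hq : IsPmf q) :
    M.Feasible (Function.update b.1 i q, b.2) where
  var_nonneg j x := by
    by_cases hj : j = i
    · subst hj
      simpa using hq.1 x
    · simpa [hj] using hb.var_nonneg j x
  fac_nonneg := hb.fac_nonneg
  var_sum j hj := by
    by_cases hj' : j = i
    · subst hj'
      simpa using hq.2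
    · simpa [hj'] using hb.var_sum j hj
  fac_sum := hb.fac_sum
  marginal a j x := by
    have hj : j.1 ≠ i := fun h => hi (h ▸ M.mem_IBP a j)
    simpa [hj] using hb.marginal a j x

theorem feasible_mfUpdate {M : Model I A X} {b : M.Beliefs} (hb : M.Feasible b) {i : I}
    (hi : i ∉ M.IBP) : M.Feasible (M.mfUpdate b i) :=
  hb.update hi (M.isPmf_mfBelief b i)

theorem exists_freeEnergyReal_update_eq (M : Model I A X) (b : M.Beliefs) {i : I}
    (hi : i ∉ M.IBP) : ∃ K : ℝ, ∀ q : X i → ℝ, IsPmf q →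
      M.freeEnergyReal (Function.update b.1 i q, b.2) = relEntropy q (M.mfBelief b i) + K := by
  have hNBP : M.NBP i = ∅ := Finset.eq_empty_of_forall_notMem fun a ha =>
    hi (Finset.mem_biUnion.2 ⟨a, (Finset.mem_filter.1 ha).1, (Finset.mem_filter.1 ha).2⟩)
  refine ⟨M.facEnergy b - (∑ a ∈ M.mf, if i ∈ M.nbr a then 0 else M.mfEnergy b a) -
    ∑ j ∈ Finset.univ.erase i, (((M.NBP j).card : ℝ) - 1) * (∑ x, b.1 j x * Real.log (b.1 j x)) -
    Real.log (∑ x, ∏ a ∈ M.NMF i, M.mfMessagesOf b a i x), fun q hq => ?_⟩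
  have h1 : ∑ a ∈ M.mf, M.mfEnergy (Function.update b.1 i q, b.2) a =
      ∑ x, q x * Real.log (∏ a ∈ M.NMF i, M.mfMessagesOf b a i x) +
        ∑ a ∈ M.mf, if i ∈ M.nbr a then 0 else M.mfEnergy b a := by
    have h2 : ∑ x, q x * Real.log (∏ a ∈ M.NMF i, M.mfMessagesOf b a i x) =
        ∑ a ∈ M.mf, if i ∈ M.nbr a then ∑ x, q x * Real.log (M.mfMessagesOf b a i x) else 0 := by
      rw [← Finset.sum_filter, Finset.sum_comm]
      refine Finset.sum_congr rfl fun x _ => ?_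
      rw [Real.log_prod fun a _ => (M.mfMessagesOf_pos b a i x).ne', Finset.mul_sum]
      rfl
    rw [h2, ← Finset.sum_add_distrib]
    refine Finset.sum_congr rfl fun a _ => ?_
    by_cases hia : i ∈ M.nbr a
    · rw [if_pos hia, if_pos hia, add_zero,
        M.mfEnergy_eq_sum_log (Function.update b.1 i q, b.2) a ⟨i, hia⟩]
      have h3 : M.mfMessagesOf (Function.update b.1 i q, b.2) a i = M.mfMessagesOf b a i :=
        M.mfMessage_congr fun j _ hji => by simp [hji]
      simp [h3]
    · rw [if_neg hia, if_neg hia, zero_add]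
      refine M.mfEnergy_congr fun j hj => ?_
      have : j ≠ i := fun h => hia (h ▸ hj)
      simp [this]
  have h4 : relEntropy q (M.mfBelief b i) = ∑ x, q x * Real.log (q x) -
      ∑ x, q x * Real.log (∏ a ∈ M.NMF i, M.mfMessagesOf b a i x) +
        Real.log (∑ x, ∏ a ∈ M.NMF i, M.mfMessagesOf b a i x) := by
    have h5 : Real.log (∑ x, ∏ a ∈ M.NMF i, M.mfMessagesOf b a i x) =
        ∑ x, q x * Real.log (∑ x, ∏ a ∈ M.NMF i, M.mfMessagesOf b a i x) := by
      rw [← Finset.sum_mul, hq.2, one_mul]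
    rw [h5, ← Finset.sum_sub_distrib, ← Finset.sum_add_distrib]
    refine Finset.sum_congr rfl fun x _ => ?_
    rcases (hq.1 x).eq_or_lt with h0 | h0
    · simp [← h0]
    · rw [Real.log_div h0.ne' (M.mfBelief_pos b i x).ne', mfBelief, normalize,
        Real.log_div (Finset.prod_pos fun a _ => M.mfMessagesOf_pos b a i x).ne'
          (M.sum_prod_mfMessagesOf_pos b i).ne']
      ring
  have h6 : ∑ j, (((M.NBP j).card : ℝ) - 1) * ∑ x, (Function.update b.1 i q) j x *
      Real.log ((Function.update b.1 i q) j x) = - ∑ x, q x * Real.log (q x) +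
      ∑ j ∈ Finset.univ.erase i, (((M.NBP j).card : ℝ) - 1) *
        ∑ x, b.1 j x * Real.log (b.1 j x) := by
    rw [← Finset.add_sum_erase _ _ (Finset.mem_univ i)]
    congr 1
    · simp [hNBP]
    · refine Finset.sum_congr rfl fun j hj => ?_
      simp [Finset.ne_of_mem_erase hj]
  have h7 : M.facEnergy (Function.update b.1 i q, b.2) = M.facEnergy b := rfl
  rw [freeEnergyReal, h1, h4, h7, h6]
  ring

theorem freeEnergyReal_update (M : Model I A X) (b : M.Beliefs) {i : I} (hi : i ∉ M.IBP)
    {q : X i → ℝ} (hq : IsPmf q) : M.freeEnergyReal (Function.update b.1 i q, b.2) =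
      relEntropy q (M.mfBelief b i) + M.freeEnergyReal (M.mfUpdate b i) := by
  obtain ⟨K, hK⟩ := M.exists_freeEnergyReal_update_eq b hi
  rw [hK q hq, mfUpdate_eq, hK _ (M.isPmf_mfBelief b i), relEntropy_self]
  ring

theorem freeEnergy_mfUpdate_le (M : Model I A X) (b : M.Beliefs) {i : I} (hi : i ∉ M.IBP)
    {q : X i → ℝ} (hq : IsPmf q) :
    M.freeEnergy (M.mfUpdate b i) ≤ M.freeEnergy (Function.update b.1 i q, b.2) := by
  by_cases hd : M.Dominated b
  · rw [Dominated.freeEnergy_eq (show M.Dominated (M.mfUpdate b i) from hd),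
      Dominated.freeEnergy_eq (show M.Dominated (Function.update b.1 i q, b.2) from hd),
      M.freeEnergyReal_update b hi hq, EReal.coe_le_coe_iff]
    have := relEntropy_nonneg hq (M.isPmf_mfBelief b i)
      fun x hx => ((M.mfBelief_pos b i x).ne' hx).elim
    linarith
  · rw [M.freeEnergy_eq_top (b := (Function.update b.1 i q, b.2)) hd]
    exact le_top

theorem freeEnergyReal_eq_mfUpdate {M : Model I A X} {b : M.Beliefs} (hb : M.Feasible b) {i : I}
    (hi : i ∉ M.IBP) : M.freeEnergyReal b =
      relEntropy (b.1 i) (M.mfBelief b i) + M.freeEnergyReal (M.mfUpdate b i) := by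
  rw [← M.freeEnergyReal_update b hi (hb.isPmf_var i), Function.update_eq_self]

theorem freeEnergy_mfUpdate_le_self {M : Model I A X} {b : M.Beliefs} (hb : M.Feasible b) {i : I}
    (hi : i ∉ M.IBP) : M.freeEnergy (M.mfUpdate b i) ≤ M.freeEnergy b := by
  have := M.freeEnergy_mfUpdate_le b hi (hb.isPmf_var i)
  rwa [Function.update_eq_self] at this

/-! ### Continuity of the updates -/

theorem continuous_mfMessagesOf (M : Model I A X) (a : A) (i : I) (x : X i) :
    Continuous fun b : M.Beliefs => M.mfMessagesOf b a i x := by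
  unfold mfMessagesOf mfMessage
  fun_prop

theorem sum_bpWeight_pos (M : Model I A X) {g : (i : I) → X i → ℝ} (hg : ∀ i x, 0 < g i x) :
    0 < ∑ x, M.bpWeight g x := by
  obtain ⟨x, hx⟩ := M.exists_config_pos
  refine Finset.sum_pos' (fun x _ => mul_nonneg (Finset.prod_nonneg fun a _ =>
    M.f_nonneg a.1 a.2 _) (Finset.prod_nonneg fun i _ => (hg _ _).le))
    ⟨fun i => x i.1, Finset.mem_univ _, mul_pos (Finset.prod_pos fun a _ => hx a.1)
      (Finset.prod_pos fun i _ => hg _ _)⟩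

theorem continuous_bpPmf (M : Model I A X) (x : M.BPConfig) :
    Continuous fun b : M.Beliefs => M.bpPmf (M.mfMessagesOf b) x := by
  have hw : ∀ x, Continuous fun b : M.Beliefs =>
      M.bpWeight (fun i x => ∏ a ∈ M.NMF i, M.mfMessagesOf b a i x) x := fun x => by
    unfold bpWeight
    exact continuous_const.mul (continuous_finsetProd _ fun i _ =>
      continuous_finsetProd _ fun a _ => M.continuous_mfMessagesOf a i.1 (x i))
  simp only [bpPmf_eq, normalize]
  exact (hw x).div (continuous_finsetSum _ fun x _ => hw x) fun b =>
    (M.sum_bpWeight_pos fun i x => Finset.prod_pos fun a _ => M.mfMessagesOf_pos b a i x).ne'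

/-- The beliefs `b` with those of the BP part replaced by the marginals of the joint distribution of
the BP part. -/
def bpMarginals (M : Model I A X) (b : M.Beliefs) : M.Beliefs :=
  (fun i v => if h : i ∈ M.IBP then
      ∑ x : M.BPConfig with x ⟨i, h⟩ = v, M.bpPmf (M.mfMessagesOf b) x
    else b.1 i v,
   fun a y => ∑ x : M.BPConfig with BPConfig.local M x a = y, M.bpPmf (M.mfMessagesOf b) x)

theorem continuous_bpMarginals (M : Model I A X) : Continuous M.bpMarginals := by
  refine Continuous.prodMk (continuous_pi fun i => continuous_pi fun v => ?_)
    (continuous_pi fun a => continuous_pi fun y =>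
      continuous_finsetSum _ fun x _ => M.continuous_bpPmf x)
  by_cases h : i ∈ M.IBP
  · simp only [h, dif_pos]
    exact continuous_finsetSum _ fun x _ => M.continuous_bpPmf x
  · simp only [h, dif_neg, not_false_eq_true]
    fun_prop

theorem bpStep_eq_bpMarginals {M : Model I A X} {S : List M.MsgName} {ω : A → I → ℝ}
    (hS : M.IsForwardBackward S) (hω : ∀ a i, 0 < ω a i) (hac : M.bpGraph.IsAcyclic)
    {b : M.Beliefs} (hb : M.MFNormalized b) : M.bpStep S ω b = M.bpMarginals b := by
  obtain ⟨h1, h2⟩ := marginals_bpStep hS hω hb hac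
  refine Prod.ext (funext fun i => funext fun v => ?_) (funext fun a => funext fun y => h2 a y)
  by_cases h : i ∈ M.IBP
  · rw [h1 ⟨i, h⟩ v]
    simp only [bpMarginals, h, dif_pos]
  · rw [← (agreeOffBP_bpStep (S := S) (ω := ω) b).eq h]
    simp only [bpMarginals, h, dif_neg, not_false_eq_true]

theorem continuous_mfUpdate (M : Model I A X) (i : I) : Continuous fun b => M.mfUpdate b i := by
  have hw : ∀ x, Continuous fun b : M.Beliefs => ∏ a ∈ M.NMF i, M.mfMessagesOf b a i x := fun x =>
    continuous_finsetProd _ fun a _ => M.continuous_mfMessagesOf a i x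
  refine Continuous.prodMk (Continuous.update continuous_fst i (continuous_pi fun x => ?_))
    continuous_snd
  exact (hw x).div (continuous_finsetSum _ fun x _ => hw x) fun b =>
    (M.sum_prod_mfMessagesOf_pos b i).ne'

theorem continuous_mul_log_div (v : ℝ) : Continuous fun u : ℝ => u * Real.log (u / v) := by
  by_cases hv : v = 0
  · simp [hv, continuous_const]
  · have : (fun u : ℝ => u * Real.log (u / v)) = fun u => u * Real.log u - u * Real.log v := by
      funext u
      by_cases hu : u = 0
      · simp [hu]
      · rw [Real.log_div hu hv, mul_sub]
    rw [this]
    exact Real.continuous_mul_log.sub (continuous_id.mul continuous_const)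

theorem continuous_freeEnergyReal (M : Model I A X) : Continuous M.freeEnergyReal := by
  have h1 : ∀ i x, Continuous fun b : M.Beliefs => b.1 i x := fun i x => by fun_prop
  have h2 : ∀ (a : {a // a ∈ M.bp}) y, Continuous fun b : M.Beliefs => b.2 a y :=
    fun a y => by fun_prop
  refine Continuous.add (continuous_finsetSum _ fun a _ => continuous_finsetSum _ fun y _ =>
    (continuous_mul_log_div (M.f a.1 y)).comp (h2 a y)) (Continuous.sub ?_ ?_)
  · exact (continuous_finsetSum _ fun a _ => continuous_finsetSum _ fun y _ =>
      (continuous_finsetProd _ fun j _ => h1 j.1 (y j)).mul continuous_const).neg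
  · exact continuous_finsetSum _ fun i _ => continuous_const.mul
      (continuous_finsetSum _ fun x _ => Real.continuous_mul_log.comp (h1 i x))

theorem isClosed_feasible (M : Model I A X) : IsClosed {b | M.Feasible b} := by
  have h1 : ∀ i x, Continuous fun b : M.Beliefs => b.1 i x := fun i x => by fun_prop
  have h2 : ∀ (a : {a // a ∈ M.bp}) y, Continuous fun b : M.Beliefs => b.2 a y :=
    fun a y => by fun_prop
  have heq : {b | M.Feasible b} = {b | (∀ i x, 0 ≤ b.1 i x) ∧ (∀ a y, 0 ≤ b.2 a y) ∧
      (∀ i, i ∈ M.IMF \ M.IBP → ∑ x, b.1 i x = 1) ∧ (∀ a, ∑ y, b.2 a y = 1) ∧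
      ∀ (a : {a // a ∈ M.bp}) (i : {i // i ∈ M.nbr a.1}) (x : X i.1),
        b.1 i.1 x = ∑ y : M.Loc a.1 with y i = x, b.2 a y} := by
    ext b
    exact ⟨fun h => ⟨h.1, h.2, h.3, h.4, h.5⟩, fun h => ⟨h.1, h.2.1, h.2.2.1, h.2.2.2.1, h.2.2.2.2⟩⟩
  rw [heq]
  simp only [Set.ofPred_and, Set.ofPred_forall]
  refine IsClosed.inter ?_ (IsClosed.inter ?_ (IsClosed.inter ?_ (IsClosed.inter ?_ ?_)))
  · exact isClosed_iInter fun i => isClosed_iInter fun x => isClosed_le continuous_const (h1 i x)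
  · exact isClosed_iInter fun a => isClosed_iInter fun y => isClosed_le continuous_const (h2 a y)
  · exact isClosed_iInter fun i => isClosed_iInter fun _ =>
      isClosed_eq (continuous_finsetSum _ fun x _ => h1 i x) continuous_const
  · exact isClosed_iInter fun a =>
      isClosed_eq (continuous_finsetSum _ fun y _ => h2 a y) continuous_const
  · exact isClosed_iInter fun a => isClosed_iInter fun i => isClosed_iInter fun x =>
      isClosed_eq (h1 i.1 x) (continuous_finsetSum _ fun y _ => h2 a y)

theorem isCompact_feasible (M : Model I A X) : IsCompact {b | M.Feasible b} :=
  (isCompact_Icc (a := (0 : M.Beliefs)) (b := 1)).of_isClosed_subset M.isClosed_feasible fun _ hb =>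
    ⟨⟨fun i x => hb.var_nonneg i x, fun a y => hb.fac_nonneg a y⟩,
      ⟨fun i x => hb.var_le_one i x, fun a y => hb.fac_le_one a y⟩⟩

/-! ### Fixed points -/

theorem sumProduct_smul (M : Model I A X) {n n' : (i : I) → A → X i → ℝ} {a : A} {γ : I → ℝ}
    (h : ∀ j ∈ M.nbr a, ∀ x, n j a x = γ j * n' j a x) (i : I) (x : X i) :
    M.sumProduct n a i x =
      (∏ j : {j // j ∈ M.nbr a} with j.1 ≠ i, γ j.1) * M.sumProduct n' a i x := by
  rw [sumProduct, sumProduct, Finset.mul_sum]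
  refine Finset.sum_congr rfl fun y _ => ?_
  rw [Finset.prod_congr rfl fun j _ => h j.1 j.2 (y j), Finset.prod_mul_distrib]
  ring

theorem isFixedPoint_of_bpStep_eq {M : Model I A X} {S : List M.MsgName} {ω : A → I → ℝ}
    (hS : M.IsForwardBackward S) (hω : ∀ a i, 0 < ω a i) {b : M.Beliefs} (hb : M.Feasible b)
    (hBP : M.bpStep S ω b = b) (hMF : ∀ i, i ∉ M.IBP → M.mfUpdate b i = b) :
    M.IsFixedPoint b := by
  have hs := M.isBPMessages_passMessages hS hω (M.mfMessagesOf_pos b)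
  have hNBP : ∀ i, i ∉ M.IBP → M.NBP i = ∅ := fun i hi => Finset.eq_empty_of_forall_notMem
    fun a ha => hi (Finset.mem_biUnion.2
      ⟨a, (Finset.mem_filter.1 ha).1, (Finset.mem_filter.1 ha).2⟩)
  have hvar : ∀ i ∈ M.IBP, ∀ x, b.1 i x = M.incoming
      (M.passMessages (M.mfMessagesOf b) ω S).toVar (M.mfMessagesOf b) i x /
        ∑ x, M.incoming (M.passMessages (M.mfMessagesOf b) ω S).toVar (M.mfMessagesOf b) i x := by
    intro i hi x
    have := congrFun (congrFun (congrArg Prod.fst hBP) i) x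
    simp only [bpStep, hi, if_true, normalize] at this
    exact this.symm
  have hfac : ∀ (a : {a // a ∈ M.bp}) y, b.2 a y =
      (M.f a.1 y * ∏ j, (M.passMessages (M.mfMessagesOf b) ω S).toFac j.1 a.1 (y j)) /
        ∑ y : M.Loc a.1,
          M.f a.1 y * ∏ j, (M.passMessages (M.mfMessagesOf b) ω S).toFac j.1 a.1 (y j) :=
    fun a y => (congrFun (congrFun (congrArg Prod.snd hBP) a) y).symm
  set s := M.passMessages (M.mfMessagesOf b) ω S
  set mMF := M.mfMessagesOf b with hmMF
  let Z : I → ℝ := fun i => ∑ x, M.incoming s.toVar mMF i x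
  let α : I → ℝ := fun i => ((Z i)⁻¹) ^ (((M.NBP i).card : ℝ)⁻¹)
  let m : (a : A) → (i : I) → X i → ℝ := fun a i x => α i * s.toVar a i x
  let zv : I → ℝ := fun i => if i ∈ M.IBP then 1 else (∑ x, ∏ a ∈ M.NMF i, mMF a i x)⁻¹
  let n : (i : I) → A → X i → ℝ := fun i a x => zv i * M.extrinsic m mMF i a x
  let zf : A → ℝ := fun a => (∑ y : M.Loc a, M.f a y * ∏ j, n j.1 a (y j))⁻¹
  have hZ : ∀ i ∈ M.IBP, 0 < Z i := fun i hi => hs.sum_incoming_pos hω hi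
  have hα : ∀ i ∈ M.IBP, 0 < α i := fun i hi => Real.rpow_pos_of_pos (inv_pos.2 (hZ i hi)) _
  have hzv : ∀ i ∈ M.IBP, zv i = 1 := fun i hi => if_pos hi
  have hαpow : ∀ i ∈ M.IBP, α i ^ (M.NBP i).card = (Z i)⁻¹ := fun i hi => by
    obtain ⟨a, ha, hia⟩ := Finset.mem_biUnion.1 hi
    exact Real.rpow_inv_natCast_pow (inv_pos.2 (hZ i hi)).le
      (Finset.card_ne_zero_of_mem (Finset.mem_filter.2 ⟨ha, hia⟩))
  have hin : ∀ i x, b.1 i x = zv i * M.incoming m mMF i x := fun i x => by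
    by_cases hi : i ∈ M.IBP
    · have h1 : M.incoming m mMF i x = α i ^ (M.NBP i).card * M.incoming s.toVar mMF i x := by
        simp only [incoming, m]
        rw [Finset.prod_mul_distrib, Finset.prod_const, mul_assoc]
      rw [hzv i hi, one_mul, hvar i hi, h1, hαpow i hi, div_eq_inv_mul]
    · have := congrFun (congrFun (congrArg Prod.fst (hMF i hi)) i) x
      simp only [mfUpdate, Function.update_self, normalize] at this
      simp only [zv, hi, if_false, incoming, hNBP i hi, Finset.prod_empty, one_mul]
      rw [← this, div_eq_inv_mul]
  have hn : ∀ a ∈ M.bp, ∀ j ∈ M.nbr a, ∀ x,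
      n j a x = α j ^ ((M.NBP j).erase a).card * s.toFac j a x := fun a ha j hj x => by
    simp only [n]
    rw [hzv j (M.mem_IBP ⟨a, ha⟩ ⟨j, hj⟩), one_mul, hs.toFac_eq a ha j hj, extrinsic,
      Finset.prod_mul_distrib, Finset.prod_const, mul_assoc]
    rfl
  have hfn : ∀ a ∈ M.bp, ∀ y : M.Loc a, M.f a y * ∏ j, n j.1 a (y j) =
      (∏ j : {j // j ∈ M.nbr a}, α j.1 ^ ((M.NBP j.1).erase a).card) *
        (M.f a y * ∏ j, s.toFac j.1 a (y j)) := fun a ha y => by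
    rw [Finset.prod_congr rfl fun j _ => hn a ha j.1 j.2 (y j), Finset.prod_mul_distrib]
    ring
  have hCpos : ∀ a ∈ M.bp, 0 < ∏ j : {j // j ∈ M.nbr a}, α j.1 ^ ((M.NBP j.1).erase a).card :=
    fun a ha => Finset.prod_pos fun j _ => pow_pos (hα _ (M.mem_IBP ⟨a, ha⟩ j)) _
  have hzf : ∀ a ∈ M.bp, 0 < zf a := fun a ha => by
    refine inv_pos.2 ?_
    rw [Finset.sum_congr rfl fun y _ => hfn a ha y, ← Finset.mul_sum]
    exact mul_pos (hCpos a ha) (hs.sum_fac_pos ha)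
  refine ⟨hb, m, mMF, n, zv, zf, fun i => ?_, hzv, hzf, fun a y => ?_, hin,
    fun a i _ x => rfl, fun a ha i hi x => ?_, fun a ha i hi x => ?_⟩
  · by_cases hi : i ∈ M.IBP
    · simp [hzv i hi]
    · simp only [zv, hi, if_false]
      exact inv_pos.2 (M.sum_prod_mfMessagesOf_pos b i)
  · simp only [zf]
    rw [mul_assoc, Finset.sum_congr rfl fun y _ => hfn a.1 a.2 y, ← Finset.mul_sum,
      hfn a.1 a.2, hfac a y]
    have h1 := (hCpos a.1 a.2).ne'
    have h2 := (hs.sum_fac_pos a.2).ne'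
    field_simp
  · obtain ⟨c, hc⟩ : ∃ c : ℝ, ∀ x, m a i x = c * M.sumProduct n a i x := by
      have hβ : (∏ j : {j // j ∈ M.nbr a} with j.1 ≠ i, α j.1 ^ ((M.NBP j.1).erase a).card) ≠ 0 :=
        (Finset.prod_pos fun j _ => pow_pos (hα _ (M.mem_IBP ⟨a, ha⟩ j)) _).ne'
      refine ⟨α i * ω a i / ∏ j : {j // j ∈ M.nbr a} with j.1 ≠ i,
        α j.1 ^ ((M.NBP j.1).erase a).card, fun x => ?_⟩
      rw [M.sumProduct_smul (γ := fun j => α j ^ ((M.NBP j).erase a).card) (hn a ha)]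
      simp only [m]
      rw [hs.toVar_eq a ha i hi]
      field_simp
    have h1 : ∀ x, b.1 i x = c * ∑ y : M.Loc a with y ⟨i, hi⟩ = x, M.f a y * ∏ j, n j.1 a (y j) :=
      fun x => by
        rw [M.sum_fiber_eq_sumProduct n a ⟨i, hi⟩ x, hin,
          M.incoming_eq_mul_extrinsic m mMF ha hi, hc x]
        simp only [n]
        ring
    have h2 : 1 = c * ∑ y : M.Loc a, M.f a y * ∏ j, n j.1 a (y j) := by
      rw [← hb.sum_var i, ← Finset.sum_fiberwise Finset.univ (fun y : M.Loc a => y ⟨i, hi⟩),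
        Finset.mul_sum]
      exact Finset.sum_congr rfl fun x _ => h1 x
    rw [hc x]
    congr 1
    exact eq_inv_of_mul_eq_one_left h2.symm
  · rw [hmMF, mfMessagesOf, M.mfMessage_congr (n' := n)]
    intro j hj _
    funext x
    have : a ∉ M.NBP j := fun h => (Finset.mem_compl.1 ha) (Finset.mem_filter.1 h).1
    simp only [n, extrinsic, Finset.erase_eq_of_notMem this]
    exact hin j x

end Model

/-! ### Asymptotically regular sequences in compact sets -/

section Regular

variable {E : Type*} [PseudoMetricSpace E] {u : ℕ → E} {K Z : Set E}

theorem tendsto_infDist_of_mapClusterPt (hK : IsCompact K) (hu : ∀ᶠ t in atTop, u t ∈ K)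
    (hZ : ∀ x, MapClusterPt x atTop u → x ∈ Z) :
    Tendsto (fun t => Metric.infDist (u t) Z) atTop (𝓝 0) := by
  rw [Metric.tendsto_nhds]
  intro ε hε
  by_contra hcon
  have hfreq : ∃ᶠ t in atTop, u t ∈ K ∩ {x | ε ≤ Metric.infDist x Z} := by
    refine ((not_eventually.1 hcon).and_eventually hu).mono fun t ht => ⟨ht.2, ?_⟩
    have := not_lt.1 ht.1
    rwa [Real.dist_0_eq_abs, abs_of_nonneg Metric.infDist_nonneg] at this
  obtain ⟨x, hx, hcl⟩ := (hK.inter_right (isClosed_le continuous_const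
    (Metric.continuous_infDist_pt Z))).exists_mapClusterPt_of_frequently hfreq
  have h0 := Metric.infDist_zero_of_mem (hZ x hcl)
  have : ε ≤ Metric.infDist x Z := hx.2
  linarith

theorem tendsto_of_isolated_mapClusterPt
    (hreg : Tendsto (fun t => dist (u (t + 1)) (u t)) atTop (𝓝 0))
    (hinf : Tendsto (fun t => Metric.infDist (u t) Z) atTop (𝓝 0)) {x : E} (hxZ : x ∈ Z)
    (hx : MapClusterPt x atTop u) (hiso : ∃ ε > 0, ∀ y ∈ Z, dist y x < ε → y = x) :
    Tendsto u atTop (𝓝 x) := by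
  obtain ⟨ε, hε, hiso⟩ := hiso
  rw [Metric.tendsto_atTop]
  intro η hη
  set δ := min ε η with hδ
  have hδ0 : 0 < δ := lt_min hε hη
  obtain ⟨T, hT⟩ := eventually_atTop.1
    ((hreg.eventually_lt_const (show 0 < δ / 4 by linarith)).and
      (hinf.eventually_lt_const (show 0 < δ / 4 by linarith)))
  obtain ⟨t₀, hball, ht₀⟩ := ((hx.frequently
    (Metric.ball_mem_nhds x (show 0 < δ / 2 by linarith))).and_eventually
      (eventually_ge_atTop T)).exists
  refine ⟨t₀, fun t ht => ?_⟩
  suffices dist (u t) x < δ / 2 by linarith [min_le_right ε η]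
  induction t, ht using Nat.le_induction with
  | base => exact hball
  | succ t ht ih =>
    have h1 := (hT t (ht₀.trans ht)).1
    obtain ⟨z, hz, hz'⟩ := (Metric.infDist_lt_iff ⟨x, hxZ⟩).1 (hT (t + 1) (by omega)).2
    have h2 : dist z x ≤ dist (u (t + 1)) z + (dist (u (t + 1)) (u t) + dist (u t) x) := by
      have h3 := dist_triangle z (u (t + 1)) x
      have h4 := dist_triangle (u (t + 1)) (u t) x
      rw [dist_comm z (u (t + 1))] at h3
      linarith
    have h3 : z = x := hiso z hz (by linarith [min_le_left ε η])
    rw [h3] at hz'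
    linarith

end Regular

namespace Model

/-! ### Decrease of the free energy in one round -/

theorem dist_beliefs_le_sqrt (M : Model I A X) {b c : M.Beliefs} {R : ℝ}
    (h1 : ∀ i x, (b.1 i x - c.1 i x) ^ 2 ≤ R) (h2 : ∀ a y, (b.2 a y - c.2 a y) ^ 2 ≤ R) :
    dist b c ≤ √R := by
  rw [Prod.dist_eq, max_le_iff, dist_pi_le_iff (Real.sqrt_nonneg R),
    dist_pi_le_iff (Real.sqrt_nonneg R)]
  exact ⟨fun i => (dist_pi_le_iff (Real.sqrt_nonneg R)).2 fun x => Real.abs_le_sqrt (h1 i x),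
    fun a => (dist_pi_le_iff (Real.sqrt_nonneg R)).2 fun y => Real.abs_le_sqrt (h2 a y)⟩

/-- The constant in the bound of the squared length of a step by the decrease of the free energy. -/
def stepConst (M : Model I A X) : ℝ := 4 * M.bp.card + 4

theorem stepConst_pos (M : Model I A X) : 0 < M.stepConst := by
  unfold stepConst
  positivity

theorem freeEnergyReal_bpStep_le_and_dist {M : Model I A X} {S : List M.MsgName}
    {ω : A → I → ℝ} (hS : M.IsForwardBackward S) (hω : ∀ a i, 0 < ω a i)
    (hac : M.bpGraph.IsAcyclic) (hone : ∀ a ∈ M.mf, (M.nbr a ∩ M.IBP).card ≤ 1) {b : M.Beliefs}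
    (hb : M.Feasible b) (hd : M.Dominated b) :
    M.freeEnergyReal (M.bpStep S ω b) ≤ M.freeEnergyReal b ∧
      dist b (M.bpStep S ω b) ≤
        √(M.stepConst * (M.freeEnergyReal b - M.freeEnergyReal (M.bpStep S ω b))) := by
  have hgap := freeEnergyReal_eq_bpStep hS hω hone hb.mfNormalized hb hd fun _ _ => rfl
  have hf := feasible_bpStep hS hω hb.mfNormalized
  have hfac := facAC_bpStep hS hω b hb hd
  have h0 := (hb.betheGap_bound hf hfac hac).1
  have hgap' : M.freeEnergyReal b - M.freeEnergyReal (M.bpStep S ω b) =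
      M.betheGap b (M.bpStep S ω b) := by rw [hgap]; ring
  rw [hgap']
  have hR : 4 * (M.bp.card * M.betheGap b (M.bpStep S ω b)) ≤
      M.stepConst * M.betheGap b (M.bpStep S ω b) := by
    unfold stepConst
    linarith
  refine ⟨by linarith, M.dist_beliefs_le_sqrt (fun i x => ?_) fun a y =>
    (hb.sq_sub_fac_le hf hfac hac a y).trans hR⟩
  by_cases hi : i ∈ M.IBP
  · exact (hb.sq_sub_var_le hf hfac hac hi x).trans hR
  · rw [(agreeOffBP_bpStep (S := S) (ω := ω) b).eq hi]
    simpa using mul_nonneg M.stepConst_pos.le h0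

theorem freeEnergyReal_mfUpdate_le_and_dist {M : Model I A X} {b : M.Beliefs} (hb : M.Feasible b)
    {i : I} (hi : i ∉ M.IBP) :
    M.freeEnergyReal (M.mfUpdate b i) ≤ M.freeEnergyReal b ∧
      dist b (M.mfUpdate b i) ≤
        √(M.stepConst * (M.freeEnergyReal b - M.freeEnergyReal (M.mfUpdate b i))) := by
  have hgap : M.freeEnergyReal b - M.freeEnergyReal (M.mfUpdate b i) =
      relEntropy (b.1 i) (M.mfBelief b i) := by rw [freeEnergyReal_eq_mfUpdate hb hi]; ring
  have hne : ∀ x, M.mfBelief b i x = 0 → b.1 i x = 0 := fun x hx =>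
    ((M.mfBelief_pos b i x).ne' hx).elim
  have h0 := relEntropy_nonneg (hb.isPmf_var i) (M.isPmf_mfBelief b i) hne
  rw [hgap]
  have hR : 4 * relEntropy (b.1 i) (M.mfBelief b i) ≤
      M.stepConst * relEntropy (b.1 i) (M.mfBelief b i) := by
    unfold stepConst
    have : (0 : ℝ) ≤ 4 * M.bp.card * relEntropy (b.1 i) (M.mfBelief b i) := by positivity
    linarith
  have hR0 : 0 ≤ M.stepConst * relEntropy (b.1 i) (M.mfBelief b i) :=
    mul_nonneg M.stepConst_pos.le h0
  refine ⟨by linarith, M.dist_beliefs_le_sqrt (fun j x => ?_) fun a y => by simpa [mfUpdate_eq]⟩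
  by_cases hj : j = i
  · subst hj
    simp only [mfUpdate_eq, Function.update_self]
    exact (sq_sub_le_relEntropy (hb.isPmf_var j) (M.isPmf_mfBelief b j) hne x).trans hR
  · simpa [mfUpdate_eq, hj]

theorem mfSweep_append (M : Model I A X) (L₁ L₂ : List I) (b : M.Beliefs) :
    M.mfSweep (L₁ ++ L₂) b = M.mfSweep L₂ (M.mfSweep L₁ b) := List.foldl_append

theorem mfSweep_snd (M : Model I A X) (L : List I) (b : M.Beliefs) : (M.mfSweep L b).2 = b.2 := by
  induction L generalizing b with
  | nil => rfl
  | cons i L ih => exact ih (M.mfUpdate b i)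

theorem dominated_mfSweep {M : Model I A X} {b : M.Beliefs} (hd : M.Dominated b) (L : List I) :
    M.Dominated (M.mfSweep L b) := by
  unfold Dominated
  rw [mfSweep_snd]
  exact hd

theorem mfSweep_spec {M : Model I A X} {L : List I} (hL : ∀ i ∈ L, i ∉ M.IBP) {b : M.Beliefs}
    (hb : M.Feasible b) : M.Feasible (M.mfSweep L b) ∧
      M.freeEnergyReal (M.mfSweep L b) ≤ M.freeEnergyReal b ∧
      dist b (M.mfSweep L b) ≤ L.length *
        √(M.stepConst * (M.freeEnergyReal b - M.freeEnergyReal (M.mfSweep L b))) := by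
  induction L using List.reverseRecOn with
  | nil => exact ⟨hb, le_rfl, by simp [mfSweep]⟩
  | append_singleton L i ih =>
    obtain ⟨h1, h2, h3⟩ := ih fun j hj => hL j (List.mem_append_left _ hj)
    have hi : i ∉ M.IBP := hL i (by simp)
    have heq : M.mfSweep (L ++ [i]) b = M.mfUpdate (M.mfSweep L b) i := M.mfSweep_append L [i] b
    obtain ⟨h4, h5⟩ := freeEnergyReal_mfUpdate_le_and_dist h1 hi
    rw [heq]
    refine ⟨feasible_mfUpdate h1 hi, h4.trans h2, (dist_triangle _ (M.mfSweep L b) _).trans ?_⟩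
    rw [List.length_append, List.length_singleton]
    push_cast
    rw [add_mul, one_mul]
    have hC := M.stepConst_pos.le
    gcongr ?_ + ?_
    · refine h3.trans ?_
      gcongr
    · refine h5.trans ?_
      gcongr

/-- One round of the algorithm: the decrease of the free energy bounds the distance to the new
beliefs, and the beliefs before and after each of the updates. -/
theorem round_spec {M : Model I A X} {S : List M.MsgName} {ω : A → I → ℝ} {L : List I}
    (hS : M.IsForwardBackward S) (hω : ∀ a i, 0 < ω a i) (hL : M.IsMFOrder L)
    (hac : M.bpGraph.IsAcyclic) (hone : ∀ a ∈ M.mf, (M.nbr a ∩ M.IBP).card ≤ 1) {b : M.Beliefs}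
    (hb : M.Feasible b) (hd : M.Dominated b) {R : ℝ}
    (hR : R = √(M.stepConst *
      (M.freeEnergyReal b - M.freeEnergyReal (M.mfSweep L (M.bpStep S ω b))))) :
    M.freeEnergyReal (M.mfSweep L (M.bpStep S ω b)) ≤ M.freeEnergyReal b ∧
    dist b (M.mfSweep L (M.bpStep S ω b)) ≤ (1 + Fintype.card I) * R ∧
    dist b (M.bpStep S ω b) ≤ R ∧
    ∀ i, i ∉ M.IBP → ∃ c, dist b c ≤ (1 + Fintype.card I) * R ∧ dist c (M.mfUpdate c i) ≤ R := by
  set c := M.bpStep S ω b with hc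
  have hcf : M.Feasible c := feasible_bpStep hS hω hb.mfNormalized
  have hLoff : ∀ i ∈ L, i ∉ M.IBP := fun i hi => M.mem_IMF_sdiff_IBP.1 ((hL.2 i).1 hi)
  obtain ⟨h1, h2⟩ := freeEnergyReal_bpStep_le_and_dist hS hω hac hone hb hd
  have hC := M.stepConst_pos.le
  have hR0 : 0 ≤ R := hR ▸ Real.sqrt_nonneg _
  have hprefix : ∀ L₁ L₂, L = L₁ ++ L₂ → M.Feasible (M.mfSweep L₁ c) ∧
      M.freeEnergyReal (M.mfSweep L c) ≤ M.freeEnergyReal (M.mfSweep L₁ c) ∧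
      M.freeEnergyReal (M.mfSweep L₁ c) ≤ M.freeEnergyReal c ∧
      dist b (M.mfSweep L₁ c) ≤ (1 + Fintype.card I) * R := by
    intro L₁ L₂ hL₁₂
    obtain ⟨h3, h4, h5⟩ := mfSweep_spec (L := L₁) (fun i hi => hLoff i (by simp [hL₁₂, hi])) hcf
    obtain ⟨-, h6, -⟩ := mfSweep_spec (L := L₂) (fun i hi => hLoff i (by simp [hL₁₂, hi])) h3
    rw [← M.mfSweep_append, ← hL₁₂] at h6
    refine ⟨h3, h6, h4, (dist_triangle _ c _).trans ?_⟩
    rw [add_mul, one_mul, hR]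
    have hlen : L₁.length ≤ Fintype.card I := List.Nodup.length_le_card
      (List.nodup_append.1 (hL₁₂ ▸ hL.1)).1
    have hlen' : (L₁.length : ℝ) ≤ Fintype.card I := by exact_mod_cast hlen
    gcongr ?_ + ?_
    · refine h2.trans (Real.sqrt_le_sqrt (mul_le_mul_of_nonneg_left ?_ hC))
      linarith
    · refine h5.trans (mul_le_mul hlen' (Real.sqrt_le_sqrt (mul_le_mul_of_nonneg_left ?_ hC))
        (Real.sqrt_nonneg _) (Nat.cast_nonneg _))
      linarith
  obtain ⟨-, -, h3, h4⟩ := hprefix L [] (by simp)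
  refine ⟨h3.trans h1, h4, h2.trans ?_, fun i hi => ?_⟩
  · rw [hR]
    refine Real.sqrt_le_sqrt (mul_le_mul_of_nonneg_left ?_ hC)
    linarith
  · obtain ⟨L₁, L₂, hL₁₂⟩ := List.append_of_mem ((hL.2 i).2 (M.mem_IMF_sdiff_IBP.2 hi))
    obtain ⟨h5, -, h7, h8⟩ := hprefix L₁ (i :: L₂) hL₁₂
    obtain ⟨-, h9, -, -⟩ := hprefix (L₁ ++ [i]) L₂ (by simp [hL₁₂])
    have heq : M.mfSweep (L₁ ++ [i]) c = M.mfUpdate (M.mfSweep L₁ c) i := M.mfSweep_append L₁ [i] c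
    rw [heq] at h9
    refine ⟨_, h8, (freeEnergyReal_mfUpdate_le_and_dist h5 hi).2.trans ?_⟩
    rw [hR]
    refine Real.sqrt_le_sqrt (mul_le_mul_of_nonneg_left ?_ hC)
    linarith

/-! ### Convergence of the algorithm -/

section Run

variable {M : Model I A X} {S : ℕ → List M.MsgName} {ω : ℕ → A → I → ℝ} {L : ℕ → List I}
  {b₀ : M.Beliefs}

theorem feasible_dominated_round {S : List M.MsgName} {ω : A → I → ℝ} {L : List I}
    (hS : M.IsForwardBackward S) (hω : ∀ a i, 0 < ω a i) (hL : M.IsMFOrder L) {b : M.Beliefs}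
    (hb : M.MFNormalized b) : M.Feasible (M.mfSweep L (M.bpStep S ω b)) ∧
      M.Dominated (M.mfSweep L (M.bpStep S ω b)) :=
  ⟨(mfSweep_spec (fun i hi => M.mem_IMF_sdiff_IBP.1 ((hL.2 i).1 hi))
    (feasible_bpStep hS hω hb)).1, dominated_mfSweep (dominated_bpStep hS hω hb) L⟩

theorem feasible_dominated_run (hS : ∀ t, M.IsForwardBackward (S t)) (hω : ∀ t a i, 0 < ω t a i)
    (hL : ∀ t, M.IsMFOrder (L t)) (hb₀ : M.MFNormalized b₀) (t : ℕ) :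
    M.Feasible (M.run S ω L b₀ (t + 1)) ∧ M.Dominated (M.run S ω L b₀ (t + 1)) := by
  induction t with
  | zero => exact feasible_dominated_round (hS 0) (hω 0) (hL 0) hb₀
  | succ t ih =>
    exact feasible_dominated_round (hS (t + 1)) (hω (t + 1)) (hL (t + 1)) ih.1.mfNormalized

theorem freeEnergy_mfSweep_le {L : List I} (hL : ∀ i ∈ L, i ∉ M.IBP) {b : M.Beliefs}
    (hb : M.Feasible b) : M.freeEnergy (M.mfSweep L b) ≤ M.freeEnergy b := by
  by_cases hd : M.Dominated b
  · rw [hd.freeEnergy_eq, (dominated_mfSweep hd L).freeEnergy_eq, EReal.coe_le_coe_iff]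
    exact (mfSweep_spec hL hb).2.1
  · rw [M.freeEnergy_eq_top hd]
    exact le_top

theorem exists_tendsto_freeEnergyReal_run (hac : M.bpGraph.IsAcyclic)
    (hone : ∀ a ∈ M.mf, (M.nbr a ∩ M.IBP).card ≤ 1)
    (hS : ∀ t, M.IsForwardBackward (S t)) (hω : ∀ t a i, 0 < ω t a i)
    (hL : ∀ t, M.IsMFOrder (L t)) (hb₀ : M.MFNormalized b₀) :
    ∃ F : ℝ, Tendsto (fun t => M.freeEnergyReal (M.run S ω L b₀ t)) atTop (𝓝 F) := by
  have hrun := feasible_dominated_run hS hω hL hb₀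
  have hanti : Antitone fun t => M.freeEnergyReal (M.run S ω L b₀ (t + 1)) :=
    antitone_nat_of_succ_le fun t => (round_spec (hS (t + 1)) (hω (t + 1)) (hL (t + 1)) hac hone
      (hrun t).1 (hrun t).2 rfl).1
  have hbdd : BddBelow (Set.range fun t => M.freeEnergyReal (M.run S ω L b₀ (t + 1))) := by
    refine (M.isCompact_feasible.bddBelow_image M.continuous_freeEnergyReal.continuousOn).mono ?_
    rintro _ ⟨t, rfl⟩
    exact ⟨_, (hrun t).1, rfl⟩
  exact ⟨_, (tendsto_add_atTop_iff_nat 1).1 (tendsto_atTop_ciInf hanti hbdd)⟩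

/-- The square root of the rescaled decrease of the free energy in round `t`. -/
def stepBound (M : Model I A X) (S : ℕ → List M.MsgName) (ω : ℕ → A → I → ℝ) (L : ℕ → List I)
    (b₀ : M.Beliefs) (t : ℕ) : ℝ :=
  √(M.stepConst *
    (M.freeEnergyReal (M.run S ω L b₀ t) - M.freeEnergyReal (M.run S ω L b₀ (t + 1))))

theorem tendsto_stepBound (hac : M.bpGraph.IsAcyclic)
    (hone : ∀ a ∈ M.mf, (M.nbr a ∩ M.IBP).card ≤ 1)
    (hS : ∀ t, M.IsForwardBackward (S t)) (hω : ∀ t a i, 0 < ω t a i)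
    (hL : ∀ t, M.IsMFOrder (L t)) (hb₀ : M.MFNormalized b₀) :
    Tendsto (M.stepBound S ω L b₀) atTop (𝓝 0) := by
  obtain ⟨F, hF⟩ := exists_tendsto_freeEnergyReal_run hac hone hS hω hL hb₀
  have := ((hF.sub (hF.comp (tendsto_add_atTop_nat 1))).const_mul M.stepConst).sqrt
  rw [sub_self, mul_zero, Real.sqrt_zero] at this
  exact this

theorem tendsto_dist_run (hac : M.bpGraph.IsAcyclic)
    (hone : ∀ a ∈ M.mf, (M.nbr a ∩ M.IBP).card ≤ 1)
    (hS : ∀ t, M.IsForwardBackward (S t)) (hω : ∀ t a i, 0 < ω t a i)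
    (hL : ∀ t, M.IsMFOrder (L t)) (hb₀ : M.MFNormalized b₀) :
    Tendsto (fun t => dist (M.run S ω L b₀ (t + 1)) (M.run S ω L b₀ t)) atTop (𝓝 0) := by
  have hrun := feasible_dominated_run hS hω hL hb₀
  have hlim := (tendsto_stepBound hac hone hS hω hL hb₀).const_mul (1 + (Fintype.card I : ℝ))
  rw [mul_zero] at hlim
  refine squeeze_zero' (Eventually.of_forall fun t => dist_nonneg) ?_ hlim
  filter_upwards [eventually_ge_atTop 1] with t ht
  obtain ⟨t, rfl⟩ := Nat.exists_eq_add_of_le' ht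
  rw [dist_comm]
  exact (round_spec (hS (t + 1)) (hω (t + 1)) (hL (t + 1)) hac hone
    (hrun t).1 (hrun t).2 rfl).2.1

theorem isFixedPoint_of_mapClusterPt_run (hac : M.bpGraph.IsAcyclic)
    (hone : ∀ a ∈ M.mf, (M.nbr a ∩ M.IBP).card ≤ 1)
    (hS : ∀ t, M.IsForwardBackward (S t)) (hω : ∀ t a i, 0 < ω t a i)
    (hL : ∀ t, M.IsMFOrder (L t)) (hb₀ : M.MFNormalized b₀) {b : M.Beliefs}
    (hb : MapClusterPt b atTop (M.run S ω L b₀)) : M.IsFixedPoint b := by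
  have hrun := feasible_dominated_run hS hω hL hb₀
  obtain ⟨U, hU, hlim⟩ := mapClusterPt_iff_ultrafilter.1 hb
  have hev : ∀ᶠ t in (U : Filter ℕ), 1 ≤ t := hU (eventually_ge_atTop 1)
  have hbound : Tendsto (M.stepBound S ω L b₀) U (𝓝 0) :=
    (tendsto_stepBound hac hone hS hω hL hb₀).mono_left hU
  have hbound' : Tendsto (fun t => (1 + (Fintype.card I : ℝ)) * M.stepBound S ω L b₀ t) U
      (𝓝 0) := by
    simpa using hbound.const_mul (1 + (Fintype.card I : ℝ))
  have hfeas : M.Feasible b := by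
    refine M.isClosed_feasible.mem_of_tendsto hlim ?_
    filter_upwards [hev] with t ht
    obtain ⟨t, rfl⟩ := Nat.exists_eq_add_of_le' ht
    exact (hrun t).1
  have hround : ∀ᶠ t in (U : Filter ℕ),
      dist (M.run S ω L b₀ t) (M.bpMarginals (M.run S ω L b₀ t)) ≤ M.stepBound S ω L b₀ t ∧
      ∀ i, i ∉ M.IBP → ∃ c,
        dist (M.run S ω L b₀ t) c ≤ (1 + Fintype.card I) * M.stepBound S ω L b₀ t ∧
        dist c (M.mfUpdate c i) ≤ M.stepBound S ω L b₀ t := by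
    filter_upwards [hev] with t ht
    obtain ⟨t, rfl⟩ := Nat.exists_eq_add_of_le' ht
    rw [← bpStep_eq_bpMarginals (hS (t + 1)) (hω (t + 1)) hac (hrun t).1.mfNormalized]
    exact (round_spec (hS (t + 1)) (hω (t + 1)) (hL (t + 1)) hac hone
      (hrun t).1 (hrun t).2 rfl).2.2
  have hlimit : ∀ {v w : ℕ → M.Beliefs} {x y : M.Beliefs}, Tendsto v U (𝓝 x) →
      Tendsto w U (𝓝 y) → Tendsto (fun t => dist (v t) (w t)) U (𝓝 0) → x = y :=
    fun hv hw hvw => dist_eq_zero.1 (tendsto_nhds_unique (hv.dist hw) hvw)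
  refine isFixedPoint_of_bpStep_eq (hS 0) (hω 0) hfeas ?_ fun i hi => ?_
  · rw [bpStep_eq_bpMarginals (hS 0) (hω 0) hac hfeas.mfNormalized]
    refine (hlimit hlim ((M.continuous_bpMarginals.tendsto b).comp hlim) ?_).symm
    exact squeeze_zero' (Eventually.of_forall fun t => dist_nonneg)
      (hround.mono fun t ht => ht.1) hbound
  · have hex : ∀ t, ∃ c : M.Beliefs, t ∈ {t | ∀ i, i ∉ M.IBP → ∃ c,
        dist (M.run S ω L b₀ t) c ≤ (1 + Fintype.card I) * M.stepBound S ω L b₀ t ∧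
        dist c (M.mfUpdate c i) ≤ M.stepBound S ω L b₀ t} →
        dist (M.run S ω L b₀ t) c ≤ (1 + Fintype.card I) * M.stepBound S ω L b₀ t ∧
        dist c (M.mfUpdate c i) ≤ M.stepBound S ω L b₀ t := fun t => by
      by_cases h : t ∈ {t | ∀ i, i ∉ M.IBP → ∃ c,
        dist (M.run S ω L b₀ t) c ≤ (1 + Fintype.card I) * M.stepBound S ω L b₀ t ∧
        dist c (M.mfUpdate c i) ≤ M.stepBound S ω L b₀ t}
      · obtain ⟨c, hc⟩ := h i hi
        exact ⟨c, fun _ => hc⟩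
      · exact ⟨b, fun h' => (h h').elim⟩
    choose c hc using hex
    have hcb : Tendsto c U (𝓝 b) := by
      rw [tendsto_iff_dist_tendsto_zero] at hlim ⊢
      have hsum := hbound'.add hlim
      rw [add_zero] at hsum
      refine squeeze_zero' (Eventually.of_forall fun t => dist_nonneg) (hround.mono fun t ht => ?_)
        hsum
      have h1 := (hc t ht.2).1
      have h2 := dist_triangle_left (c t) b (M.run S ω L b₀ t)
      linarith
    refine (hlimit hcb (((M.continuous_mfUpdate i).tendsto b).comp hcb) ?_).symm
    exact squeeze_zero' (Eventually.of_forall fun t => dist_nonneg)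
      (hround.mono fun t ht => (hc t ht.2).2) hbound

end Run

end Model

end BPMF

end

theorem mainTheorem4 {I A : Type*} {X : I → Type*} [Fintype I] [DecidableEq I] [Fintype A]
    [DecidableEq A] [∀ i, Fintype (X i)] [∀ i, DecidableEq (X i)] (M : BPMF.Model I A X)
    (hcycle : M.bpGraph.IsAcyclic) (hone : ∀ a ∈ M.mf, (M.nbr a ∩ M.IBP).card ≤ 1) :
    -- the forward/backward algorithm can be scheduled in the BP part
    (∃ S, M.IsForwardBackward S) ∧
    -- the BP step
    (∀ (S : List M.MsgName) (ω : A → I → ℝ) (b : M.Beliefs), M.IsForwardBackward S →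
      (∀ a i, 0 < ω a i) → M.MFNormalized b →
      -- it produces beliefs that satisfy the constraints
      M.Feasible (M.bpStep S ω b) ∧ M.AgreeOffBP b (M.bpStep S ω b) ∧
      -- namely the marginals of the BP part with the fixed messages from the MF part
      (∀ (i : {i // i ∈ M.IBP}) (v : X i.1), (M.bpStep S ω b).1 i.1 v =
        ∑ x : M.BPConfig with x i = v, M.bpPmf (M.mfMessagesOf b) x) ∧
      (∀ (a : {a // a ∈ M.bp}) (y : M.Loc a.1), (M.bpStep S ω b).2 a y =
        ∑ x : M.BPConfig with BPMF.Model.BPConfig.local M x a = y,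
          M.bpPmf (M.mfMessagesOf b) x) ∧
      -- these are the unique minimizers of the Bethe free energy and of the combined free energy
      (∀ c, M.Feasible c → M.AgreeOffBP b c →
        M.betheFreeEnergy (M.mfMessagesOf b) (M.bpStep S ω b) ≤
          M.betheFreeEnergy (M.mfMessagesOf b) c ∧
        (M.betheFreeEnergy (M.mfMessagesOf b) c =
          M.betheFreeEnergy (M.mfMessagesOf b) (M.bpStep S ω b) → c = M.bpStep S ω b) ∧
        M.freeEnergy (M.bpStep S ω b) ≤ M.freeEnergy c ∧
        (M.freeEnergy c = M.freeEnergy (M.bpStep S ω b) → c = M.bpStep S ω b))) ∧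
    -- the two free energies have the same derivatives with respect to the beliefs of the BP part
    (∀ b c : M.Beliefs, M.AgreeOffBP b c → M.freeEnergy c ≠ ⊤ →
      (∀ i ∈ M.IBP, ∀ x, 0 < c.1 i x → ∃ d : ℝ,
        HasDerivAt (fun s => (M.freeEnergy (M.setVar c i x s)).toReal) d (c.1 i x) ∧
        HasDerivAt (fun s => (M.betheFreeEnergy (M.mfMessagesOf b) (M.setVar c i x s)).toReal)
          d (c.1 i x)) ∧
      (∀ a y, 0 < c.2 a y → ∃ d : ℝ,
        HasDerivAt (fun s => (M.freeEnergy (M.setFac c a y s)).toReal) d (c.2 a y) ∧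
        HasDerivAt (fun s => (M.betheFreeEnergy (M.mfMessagesOf b) (M.setFac c a y s)).toReal)
          d (c.2 a y))) ∧
    -- the update of one belief in the MF part
    (∀ b, M.Feasible b → ∀ i ∈ M.IMF \ M.IBP,
      M.Feasible (M.mfUpdate b i) ∧
      M.freeEnergy (M.mfUpdate b i) ≤ M.freeEnergy b ∧
      ∀ q : X i → ℝ, (∀ x, 0 ≤ q x) → ∑ x, q x = 1 →
        M.freeEnergy (M.mfUpdate b i) ≤ M.freeEnergy (Function.update b.1 i q, b.2)) ∧
    -- the whole algorithm
    (∀ (S : ℕ → List M.MsgName) (ω : ℕ → A → I → ℝ) (L : ℕ → List I) (b₀ : M.Beliefs),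
      (∀ t, M.IsForwardBackward (S t)) → (∀ t a i, 0 < ω t a i) → (∀ t, M.IsMFOrder (L t)) →
      M.MFNormalized b₀ →
      -- the beliefs satisfy the constraints, and the free energy never increases
      (∀ t, M.Feasible (M.run S ω L b₀ (t + 1))) ∧
      (∀ t, M.Feasible (M.run S ω L b₀ t) →
        M.freeEnergy (M.run S ω L b₀ (t + 1)) ≤ M.freeEnergy (M.run S ω L b₀ t)) ∧
      -- it converges to a finite limit
      (∃ F : ℝ, Filter.Tendsto (fun t => M.freeEnergy (M.run S ω L b₀ t)) Filter.atTop
        (nhds (F : EReal))) ∧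
      -- the change of the beliefs in one round tends to zero
      Filter.Tendsto (fun t => M.run S ω L b₀ (t + 1) - M.run S ω L b₀ t) Filter.atTop (nhds 0) ∧
      -- the beliefs approach the nonempty set of solutions of the fixed-point equations,
      -- and each of their limit points is such a solution
      (∃ b, M.IsFixedPoint b) ∧
      Filter.Tendsto (fun t => Metric.infDist (M.run S ω L b₀ t) {b | M.IsFixedPoint b})
        Filter.atTop (nhds 0) ∧
      (∀ b, MapClusterPt b Filter.atTop (M.run S ω L b₀) → M.IsFixedPoint b) ∧
      -- the beliefs converge as soon as one limit point is an isolated solution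
      (∀ b, MapClusterPt b Filter.atTop (M.run S ω L b₀) →
        (∃ ε > 0, ∀ b', M.IsFixedPoint b' → dist b' b < ε → b' = b) →
        Filter.Tendsto (M.run S ω L b₀) Filter.atTop (nhds b))) := by
  refine ⟨M.exists_isForwardBackward hcycle, fun S ω b hS hω hb => ?_, fun b c hbc hfin => ?_,
    fun b hb i hi => ?_, fun S ω L b₀ hS hω hL hb₀ => ?_⟩
  · obtain ⟨h1, h2⟩ := BPMF.Model.marginals_bpStep hS hω hb hcycle
    exact ⟨BPMF.Model.feasible_bpStep hS hω hb, BPMF.Model.agreeOffBP_bpStep b, h1, h2,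
      fun c hc hbc => BPMF.Model.bpStep_minimizes hS hω hcycle hone hb hc hbc⟩
  · have hd := M.dominated_of_freeEnergy_ne_top hfin
    exact ⟨fun i hi x hx => BPMF.Model.exists_hasDerivAt_setVar hone hbc hd hi hx,
      fun a y hy => BPMF.Model.exists_hasDerivAt_setFac hone hbc hd hy⟩
  · have hi' := M.mem_IMF_sdiff_IBP.1 hi
    exact ⟨BPMF.Model.feasible_mfUpdate hb hi', BPMF.Model.freeEnergy_mfUpdate_le_self hb hi',
      fun q hq hq₁ => M.freeEnergy_mfUpdate_le b hi' ⟨hq, hq₁⟩⟩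
  · have hrun := BPMF.Model.feasible_dominated_run hS hω hL hb₀
    have hmem : ∀ᶠ t in atTop, M.run S ω L b₀ t ∈ {b | M.Feasible b} := by
      filter_upwards [eventually_ge_atTop 1] with t ht
      obtain ⟨t, rfl⟩ := Nat.exists_eq_add_of_le' ht
      exact (hrun t).1
    have hfix : ∀ b, MapClusterPt b atTop (M.run S ω L b₀) → M.IsFixedPoint b := fun b hb =>
      BPMF.Model.isFixedPoint_of_mapClusterPt_run hcycle hone hS hω hL hb₀ hb
    have hdist := BPMF.Model.tendsto_dist_run hcycle hone hS hω hL hb₀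
    have hinf := BPMF.tendsto_infDist_of_mapClusterPt (Z := {b | M.IsFixedPoint b})
      M.isCompact_feasible hmem hfix
    refine ⟨fun t => (hrun t).1, fun t ht => ?_, ?_, ?_, ?_, hinf, hfix, fun b hb hiso => ?_⟩
    · exact (BPMF.Model.freeEnergy_mfSweep_le
        (fun i hi => M.mem_IMF_sdiff_IBP.1 (((hL t).2 i).1 hi))
        (BPMF.Model.feasible_bpStep (hS t) (hω t) ht.mfNormalized)).trans
        (BPMF.Model.bpStep_minimizes (hS t) (hω t) hcycle hone ht.mfNormalized ht
          fun _ _ => rfl).2.2.1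
    · obtain ⟨F, hF⟩ := BPMF.Model.exists_tendsto_freeEnergyReal_run hcycle hone hS hω hL hb₀
      refine ⟨F, ((continuous_coe_real_ereal.tendsto F).comp hF).congr' ?_⟩
      filter_upwards [eventually_ge_atTop 1] with t ht
      obtain ⟨t, rfl⟩ := Nat.exists_eq_add_of_le' ht
      exact (hrun t).2.freeEnergy_eq.symm
    · rw [tendsto_zero_iff_norm_tendsto_zero]
      simpa only [dist_eq_norm] using hdist
    · obtain ⟨b, -, hb⟩ :=
        M.isCompact_feasible.exists_mapClusterPt_of_frequently hmem.frequently
      exact ⟨b, hfix b hb⟩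
    · exact BPMF.tendsto_of_isolated_mapClusterPt hdist hinf (hfix b hb) hb hiso
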